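/- Let $p,q:\mathbb R\to\mathbb C$ be $\pi$-periodic and of bounded variation on $[0,\pi]$, let $J=\begin{pmatrix}0&1\\-1&0\end{pmatrix}$ and $Q=\begin{pmatrix}p&q\\q&-p\end{pmatrix}$. For $t\in\mathbb C$ let $L_t(Q)$ be the operator in $L_2([0,\pi];\mathbb C^2)$ generated by $J\mathbf y'+Q\mathbf y$ and the boundary condition $\mathbf y(\pi)=e^{i\pi t}\mathbf y(0)$; its adjoint is $L_{\bar t}(\overline Q)$. Let $\mathbf c(x,\lambda)=(c_1,c_2)$ and $\mathbf s(x,\lambda)=(s_1,s_2)$ be the absolutely continuous solutions of $J\mathbf y'+Q\mathbf y=\lambda\mathbf y$ with $\mathbf c(0,\lambda)=(1,0)$, $\mathbf s(0,\lambda)=(0,1)$, and put $F(\lambda)=c_1(\pi,\lambda)+s_2(\pi,\lambda)$ and $\Delta(\lambda,t)=\det\begin{pmatrix}c_1(\pi,\lambda)-e^{i\pi t}&s_1(\pi,\lambda)\\c_2(\pi,\lambda)&s_2(\pi,\lambda)-e^{i\pi t}\end{pmatrix}$. The eigenvalues of $L_t(Q)$ are the zeros of $\Delta(\cdot,t)$,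 counted with their multiplicity as zeros. For a set $S\subset\mathbb C$, a Bloch system along $S$ consists of functions $\lambda_{n,j}$ ($n\in\mathbb Z$, $j=1,2$), continuous on $S$, such that for every $t\in S$ the numbers $\lambda_{n,j}(t)$ are the eigenvalues of $L_t(Q)$ counted with multiplicity, and, for those $t\in S$ at which $\lambda_{n,j}(t)$ is a simple eigenvalue, of an eigenfunction $\Psi_{n,j,t}$ of $L_t(Q)$ for $\lambda_{n,j}(t)$ with $\|e^{-itx}\Psi_{n,j,t}\|=1$ and an eigenfunction $\Psi^*_{n,j,t}$ of $L_{\bar t}(\overline Q)$ for $\overline{\lambda_{n,j}(t)}$ with $\|e^{-i\bar tx}\Psi^*_{n,j,t}\|=1$. Here $(u,v)=\int_0^\pi (u_1\overline{v_1}+u_2\overline{v_2})\,dx$ and $\|\cdot\|$ is the corresponding norm. Put $\alpha_{n,j}(t)=(\Psi_{n,j,t},\Psi^*_{n,j,t})$. For real $t_0$, a number $\lambda_0$ is an essential spectral singularity (ESS) at $t_0$ if there are $n,j$ with $\lambda_{n,j}(t_0)=\lambda_0$ such that for every $\varepsilon>0$ the function $1/\alpha_{n,j}$ is not integrable on $(t_0-\varepsilon,t_0+\varepsilon)$.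 Let $0<h<1/10$ and $D_h=\{t\in\mathbb C:|\operatorname{Im}t|\le 2h,\ -h\le\operatorname{Re}t\le 2-h\}$. Let $A$ be the set of $t\in D_h$ for which $L_t(Q)$ has an eigenvalue $\lambda$ with $F'(\lambda)=0$ or $s_1(\pi,\lambda)=0$. For $a=0,1$ let $\gamma(a,h)=\{t\in\mathbb C:|t-a|=h,\ \operatorname{Im}t\ge 0\}$, and assume $(\gamma(0,h)\cup\gamma(1,h))\cap A=\varnothing$. Let $E(h)=([h,1-h]\cup[1+h,2-h])\setminus A$. Let $f:\mathbb R\to\mathbb C^2$ be continuous with compact support, let $f_t(x)=\sum_{k\in\mathbb Z}f(x+k\pi)e^{-ik\pi t}$, and let $$a_{k,j}(t)\Psi_{k,j,t}(x)=\frac1{\alpha_{k,j}(t)}\,(f_t,\Psi^*_{k,j,t})\,\Psi_{k,j,t}(x).$$ Then for all $k\in\mathbb Z$, $j\in\{1,2\}$ and $x\in[0,\pi]$: 1. For each of the sets $S=E(h)$, $S=\gamma(0,h)$, $S=\gamma(1,h)$ and every Bloch system along $S$, the function $t\mapsto a_{k,j}(t)\Psi_{k,j,t}(x)$ is integrable over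 $S$. 2. For every Bloch system along $(-h,h)$ for which $\lambda_{k,j}(0)$ is not an ESS at $0$, this function is integrable over $(-h,h)$. 3. For every Bloch system along $(1-h,1+h)$ for which $\lambda_{k,j}(1)$ is not an ESS at $1$, this function is integrable over $(1-h,1+h)$. -/

import Mathlib

open MeasureTheory Set
open scoped Matrix ComplexConjugate

noncomputable section

namespace Dirac

/-- The potential `Q(x)` with rows `(p, q)` and `(q, -p)`. -/
def potential (p q : ℝ → ℂ) (x : ℝ) : Matrix (Fin 2) (Fin 2) ℂ :=
  !![p x, q x; q x, -p x]

/-- The constant matrix with rows `(0, 1)` and `(-1, 0)`. -/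
def J : Matrix (Fin 2) (Fin 2) ℂ := !![0, 1; -1, 0]

/-- `y` is an (absolutely continuous) solution on `[0, π]` of `J y' + Q y = mu y`. -/
structure IsSolution (p q : ℝ → ℂ) (mu : ℂ) (y : ℝ → Fin 2 → ℂ) : Prop where
  ac : AbsolutelyContinuousOnInterval y 0 Real.pi
  eqn : ∀ᵐ x ∂(volume.restrict (Icc 0 Real.pi)),
    ∃ y' : Fin 2 → ℂ, HasDerivAt y y' x ∧ J *ᵥ y' + potential p q x *ᵥ y x = mu • y x

/-- The solution of `J y' + Q y = mu y` on `[0, π]` with initial value `y 0 = v`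
(it exists and is unique on `[0, π]` for integrable coefficients). -/
def solution (p q : ℝ → ℂ) (mu : ℂ) (v : Fin 2 → ℂ) : ℝ → Fin 2 → ℂ :=
  Classical.epsilon fun y => IsSolution p q mu y ∧ y 0 = v

/-- `c(x, mu)`, the solution with `c₁(0) = 1`, `c₂(0) = 0`. -/
def cSol (p q : ℝ → ℂ) (mu : ℂ) : ℝ → Fin 2 → ℂ := solution p q mu ![1, 0]

/-- `s(x, mu)`, the solution with `s₁(0) = 0`, `s₂(0) = 1`. -/
def sSol (p q : ℝ → ℂ) (mu : ℂ) : ℝ → Fin 2 → ℂ := solution p q mu ![0, 1]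

/-- `F(mu) = c₁(π, mu) + s₂(π, mu)`. -/
def discriminant (p q : ℝ → ℂ) (mu : ℂ) : ℂ :=
  cSol p q mu Real.pi 0 + sSol p q mu Real.pi 1

/-- The multiplier `e^{iπt}` of the quasimomentum `t`. -/
def multiplier (t : ℂ) : ℂ := Complex.exp (Complex.I * Real.pi * t)

/-- The characteristic determinant `Δ(mu, t)` of `L_t(Q)`. -/
def charDet (p q : ℝ → ℂ) (mu t : ℂ) : ℂ :=
  Matrix.det !![cSol p q mu Real.pi 0 - multiplier t, sSol p q mu Real.pi 0;
    cSol p q mu Real.pi 1, sSol p q mu Real.pi 1 - multiplier t]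

/-- The multiplicity of `mu` as an eigenvalue of `L_t(Q)`: its multiplicity as a root of
`Δ(·, t)`; it is `0` when `mu` is not an eigenvalue. -/
def multiplicity (p q : ℝ → ℂ) (t mu : ℂ) : ℕ∞ :=
  analyticOrderAt (fun z => charDet p q z t) mu

/-- The inner product of `L²([0, π]; ℂ²)`, linear in the first argument. -/
def ip (u v : ℝ → Fin 2 → ℂ) : ℂ :=
  ∫ x in (0 : ℝ)..Real.pi, ∑ i, u x i * conj (v x i)

/-- `y` is an eigenfunction of `L_t(Q)` for the eigenvalue `mu`, normalized by
`‖e^{-itx} y‖ = 1` in `L²([0, π]; ℂ²)`. -/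
structure IsNormalizedEigenfunction (p q : ℝ → ℂ) (t mu : ℂ) (y : ℝ → Fin 2 → ℂ) : Prop where
  sol : IsSolution p q mu y
  bdry : y Real.pi = multiplier t • y 0
  norm_eq : ∫ x in (0 : ℝ)..Real.pi,
    ∑ i, ‖Complex.exp (-(Complex.I * t * x)) * y x i‖ ^ 2 = 1

/-- A numbering `lam n j t` of the Bloch eigenvalues along a set `S` of quasimomenta, with
normalized eigenfunctions `Psi n j t` of `L_t(Q)` and `PsiStar n j t` of the adjoint operator
`L_{conj t}(conj Q)`. The eigenvalues are counted with multiplicity and depend continuously on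
`t` along `S`; the eigenfunctions are those at simple eigenvalues, with arbitrary phases. -/
structure IsBlochSystem (p q : ℝ → ℂ) (S : Set ℂ) (lam : ℤ → Fin 2 → ℂ → ℂ)
    (Psi PsiStar : ℤ → Fin 2 → ℂ → ℝ → Fin 2 → ℂ) : Prop where
  enum : ∀ t ∈ S, ∀ mu : ℂ,
    {nj : ℤ × Fin 2 | lam nj.1 nj.2 t = mu}.encard = multiplicity p q t mu
  cont : ∀ n j, ContinuousOn (lam n j) S
  eigen : ∀ n j, ∀ t ∈ S, multiplicity p q t (lam n j t) = 1 →
    IsNormalizedEigenfunction p q t (lam n j t) (Psi n j t)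
  eigenStar : ∀ n j, ∀ t ∈ S, multiplicity p q t (lam n j t) = 1 →
    IsNormalizedEigenfunction (fun x => conj (p x)) (fun x => conj (q x))
      (conj t) (conj (lam n j t)) (PsiStar n j t)

/-- `mu0` is an essential spectral singularity at the real quasimomentum `t0`:
for some `(n, j)` with `lam n j t0 = mu0`, the function `1 / α_{n,j}`, where
`α_{n,j}(t) = (Psi_{n,j,t}, PsiStar_{n,j,t})`, is not integrable on any interval
`(t0 - ε, t0 + ε)`. Absolute values make this independent of the phases. -/
def IsESS (lam : ℤ → Fin 2 → ℂ → ℂ) (Psi PsiStar : ℤ → Fin 2 → ℂ → ℝ → Fin 2 → ℂ)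
    (t0 : ℝ) (mu0 : ℂ) : Prop :=
  ∃ (n : ℤ) (j : Fin 2), lam n j t0 = mu0 ∧ ∀ ε : ℝ, 0 < ε →
    ¬ IntegrableOn (fun t : ℝ => ‖(ip (Psi n j t) (PsiStar n j t))⁻¹‖)
      (Ioo (t0 - ε) (t0 + ε))

/-- The Gelfand transform `f_t(x) = ∑ₖ f(x + kπ) e^{-ikπt}`. -/
def gelfand (f : ℝ → Fin 2 → ℂ) (t : ℂ) (x : ℝ) : Fin 2 → ℂ :=
  ∑' k : ℤ, Complex.exp (-(Complex.I * k * Real.pi * t)) • f (x + k * Real.pi)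

/-- The value at `x` of `a Ψ = (1 / α) (f_t, Ψ*) Ψ`, where `α = (Ψ, Ψ*)`. -/
def expansionTerm (f : ℝ → Fin 2 → ℂ) (t : ℂ) (psi psiStar : ℝ → Fin 2 → ℂ) (x : ℝ) :
    Fin 2 → ℂ :=
  ((ip psi psiStar)⁻¹ * ip (gelfand f t) psiStar) • psi x

/-- The strip piece `D_h`. -/
def stripD (h : ℝ) : Set ℂ := {t | |t.im| ≤ 2 * h ∧ -h ≤ t.re ∧ t.re ≤ 2 - h}

/-- The set `A` of exceptional quasimomenta in `D_h`: `L_t(Q)` has an eigenvalue at which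
`F'` or `s₁(π, ·)` vanishes. -/
def exceptional (p q : ℝ → ℂ) (h : ℝ) : Set ℂ :=
  {t | t ∈ stripD h ∧ ∃ mu : ℂ, charDet p q mu t = 0 ∧
    (deriv (discriminant p q) mu = 0 ∨ sSol p q mu Real.pi 0 = 0)}

/-- The semicircle `γ(a, h)` in the closed upper half plane. -/
def semicircle (a h : ℝ) : Set ℂ := {t | ‖t - a‖ = h ∧ 0 ≤ t.im}

/-- `g` is integrable over `γ(a, h)`, parametrized by `t = a + h e^{iθ}`, `0 ≤ θ ≤ π`. -/
def SemicircleIntegrable (g : ℂ → Fin 2 → ℂ) (a h : ℝ) : Prop :=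
  IntervalIntegrable (fun θ : ℝ => g (circleMap a h θ)) volume 0 Real.pi

/-- `E(h)`: the set `B(h) = [h, 1 - h] ∪ [1 + h, 2 - h]` without its exceptional points. -/
def setE (p q : ℝ → ℂ) (h : ℝ) : Set ℝ :=
  {t | t ∈ Icc h (1 - h) ∪ Icc (1 + h) (2 - h) ∧ (t : ℂ) ∉ exceptional p q h}

end Dirac

end

/-!
The discriminant `F` is entire and `F(λ) = 2 cos πλ + o(e^{π |Im λ|})`, and the eigenvalues of
`L_t(Q)` are the solutions of `F(λ) = 2 cos πt`. Differentiating `F` by variation of constants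
shows that the term `(1 / α) (f_t, Ψ*) Ψ(x)` equals `R(λ(t), t) / F'(λ(t))` with `R` jointly
continuous, whenever `F'(λ(t)) ≠ 0` and `t ∉ ℤ`. Near a real `t₀ ∉ ℤ` the asymptotics confine
`λ(t)` to a bounded region, so `λ` has one-sided limits at `t₀`; if `F'` vanishes to order `m` at
such a limit, then `1 / F'(λ(t)) = O(|t - t₀|^{-m / (m + 1)})`, because `cos πt` has
non-zero derivative at `t₀`, and this is integrable. At `t₀ ∈ ℤ` the term is dominated by
`1 / |α|`, whose integrability is what the absence of an essential spectral singularity provides.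
-/

noncomputable section

namespace Dirac

open Filter Topology

section LinearIntegralEquations

lemma absolutelyContinuousOnInterval_of_dist_le {X Y : Type*} [PseudoMetricSpace X]
    [PseudoMetricSpace Y] {f : ℝ → X} {g : ℝ → Y} {a b : ℝ}
    (hg : AbsolutelyContinuousOnInterval g a b)
    (h : ∀ x ∈ uIcc a b, ∀ y ∈ uIcc a b, dist (f x) (f y) ≤ dist (g x) (g y)) :
    AbsolutelyContinuousOnInterval f a b := by
  rw [absolutelyContinuousOnInterval_iff] at hg ⊢
  intro ε hε
  obtain ⟨δ, hδ, H⟩ := hg ε hε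
  refine ⟨δ, hδ, fun I hI hI_len => lt_of_le_of_lt ?_ (H I hI hI_len)⟩
  exact Finset.sum_le_sum fun i hi => h _ (hI.1 i hi).1 _ (hI.1 i hi).2

variable {E : Type*} [NormedAddCommGroup E] [NormedSpace ℝ E]

lemma absolutelyContinuousOnInterval_integral {f : ℝ → E} {a b : ℝ}
    (hf : IntervalIntegrable f volume a b) :
    AbsolutelyContinuousOnInterval (fun x => ∫ s in a..x, f s) a b := by
  refine absolutelyContinuousOnInterval_of_dist_le
    (hf.norm.absolutelyContinuousOnInterval_intervalIntegral (c := a) left_mem_uIcc)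
    fun x hx y hy => ?_
  have hf_mono : ∀ z ∈ uIcc a b, IntervalIntegrable f volume a z := fun z hz =>
    hf.mono_set (uIcc_subset_uIcc left_mem_uIcc hz)
  rw [dist_eq_norm, Real.dist_eq,
    intervalIntegral.integral_interval_sub_left (hf_mono x hx) (hf_mono y hy),
    intervalIntegral.integral_interval_sub_left (hf_mono x hx).norm (hf_mono y hy).norm]
  exact intervalIntegral.norm_integral_le_abs_integral_norm

theorem le_mul_exp_of_le_add_integral {φ : ℝ → ℝ} {a b c K : ℝ}
    (hφ : ContinuousOn φ (Icc a b)) (hK : 0 ≤ K)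
    (h : ∀ x ∈ Icc a b, φ x ≤ c + K * ∫ s in a..x, φ s) {x : ℝ} (hx : x ∈ Icc a b) :
    φ x ≤ c * Real.exp (K * (x - a)) := by
  have hab : a ≤ b := hx.1.trans hx.2
  set ψ : ℝ → ℝ := IccExtend hab ((Icc a b).domRestrict φ)
  have hψ : Continuous ψ := hφ.domRestrict.Icc_extend'
  have hψφ : ∀ y ∈ Icc a b, ψ y = φ y := fun y hy => IccExtend_of_mem hab _ hy
  have hint : ∀ y ∈ Icc a b, ∫ s in a..y, ψ s = ∫ s in a..y, φ s := fun y hy =>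
    intervalIntegral.integral_congr fun s hs => by
      rw [uIcc_of_le hy.1] at hs
      exact hψφ s ⟨hs.1, hs.2.trans hy.2⟩
  have hderiv : ∀ y, HasDerivAt (fun y => c + K * ∫ s in a..y, ψ s) (K * ψ y) y := fun y =>
    ((hψ.integral_hasStrictDerivAt a y).hasDerivAt.const_mul K).const_add c
  have hbound := le_gronwallBound_of_liminf_deriv_right_le (δ := c) (K := K) (ε := 0)
    (fun y _ => (hderiv y).continuousAt.continuousWithinAt)
    (fun y _ r hr => ((hderiv y).hasDerivWithinAt.liminf_right_slope_le hr).mono fun z hz => by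
      simpa only [slope_def_field, div_eq_inv_mul] using hz)
    (by simp) (fun y hy => ?_) x hx
  · rw [gronwallBound_ε0, hint x hx] at hbound
    exact (h x hx).trans hbound
  · have hy' := Ico_subset_Icc_self hy
    rw [add_zero, hψφ y hy', hint y hy']
    exact mul_le_mul_of_nonneg_left (h y hy') hK

section Picard

variable {A : ℝ → E →L[ℝ] E} {a b C : ℝ}

lemma integrableOn_clm_apply (hA : AEStronglyMeasurable A (volume.restrict (Icc a b)))
    (hC : ∀ x ∈ Icc a b, ‖A x‖ ≤ C) {w : ℝ → E} (hw : ContinuousOn w (Icc a b)) :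
    IntegrableOn (fun s => A s (w s)) (Icc a b) := by
  obtain ⟨M, hM⟩ := isCompact_Icc.exists_bound_of_continuousOn hw
  refine IntegrableOn.of_bound (C := C * M) (by simp)
    ((ContinuousLinearMap.id ℝ (E →L[ℝ] E)).aestronglyMeasurable_comp₂ hA
      (hw.aestronglyMeasurable measurableSet_Icc)) ?_
  exact ae_restrict_of_forall_mem measurableSet_Icc fun x hx =>
    (A x).le_of_opNorm_le_of_le (hC x hx) (hM x hx)

/-- The `n`-th term of the Picard series solving the linear integral equation
`y x = v + ∫ s in a..x, A s (y s)`. -/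
def picardTerm (A : ℝ → E →L[ℝ] E) (a : ℝ) (v : E) : ℕ → ℝ → E
  | 0 => fun _ => v
  | n + 1 => fun x => ∫ s in a..x, A s (picardTerm A a v n s)

lemma continuousOn_picardTerm (hA : AEStronglyMeasurable A (volume.restrict (Icc a b)))
    (hC : ∀ x ∈ Icc a b, ‖A x‖ ≤ C) (v : E) (n : ℕ) :
    ContinuousOn (picardTerm A a v n) (Icc a b) := by
  rcases lt_or_ge b a with hba | hab
  · simp [Icc_eq_empty_of_lt hba]
  induction n with
  | zero => exact continuousOn_const
  | succ n ih =>
    rw [← uIcc_of_le hab]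
    refine intervalIntegral.continuousOn_primitive_interval ?_
    rw [uIcc_of_le hab]
    exact integrableOn_clm_apply hA hC ih

lemma norm_picardTerm_le (hC : ∀ x ∈ Icc a b, ‖A x‖ ≤ C) (v : E) (n : ℕ) :
    ∀ x ∈ Icc a b, ‖picardTerm A a v n x‖ ≤ ‖v‖ * ((C * (x - a)) ^ n / n.factorial) := by
  induction n with
  | zero => intro x _; simp [picardTerm]
  | succ n ih =>
    intro x hx
    calc ‖picardTerm A a v (n + 1) x‖
        ≤ ∫ s in a..x, C * (‖v‖ * ((C * (s - a)) ^ n / n.factorial)) := by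
          refine intervalIntegral.norm_integral_le_of_norm_le hx.1
            (Eventually.of_forall fun s hs => ?_) (Continuous.intervalIntegrable (by fun_prop) _ _)
          have hs' : s ∈ Icc a b := ⟨hs.1.le, hs.2.trans hx.2⟩
          exact (A s).le_of_opNorm_le_of_le (hC s hs') (ih s hs')
      _ = (C * ‖v‖ * C ^ n / n.factorial) * ∫ s in a..x, (s - a) ^ n := by
          rw [← intervalIntegral.integral_const_mul]
          exact intervalIntegral.integral_congr fun s _ => by
            simp only [mul_pow]
            ring
      _ = ‖v‖ * ((C * (x - a)) ^ (n + 1) / (n + 1).factorial) := by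
          rw [intervalIntegral.integral_comp_sub_right (fun s => s ^ n), integral_pow, sub_self,
            zero_pow n.succ_ne_zero, sub_zero, mul_pow, Nat.factorial_succ]
          push_cast
          field_simp
          ring

lemma norm_picardTerm_le_of_mem (hC : ∀ x ∈ Icc a b, ‖A x‖ ≤ C) (v : E) (n : ℕ) {x : ℝ}
    (hx : x ∈ Icc a b) :
    ‖picardTerm A a v n x‖ ≤ ‖v‖ * ((C * (b - a)) ^ n / n.factorial) := by
  refine (norm_picardTerm_le hC v n x hx).trans ?_
  have hC0 : 0 ≤ C := (norm_nonneg _).trans (hC x hx)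
  have hxa : 0 ≤ x - a := sub_nonneg.2 hx.1
  have := hx.2
  gcongr

variable [CompleteSpace E]

theorem exists_eq_add_integral_clm_apply
    (hA : AEStronglyMeasurable A (volume.restrict (Icc a b)))
    (hC : ∀ x ∈ Icc a b, ‖A x‖ ≤ C) (v : E) :
    ∃ y : ℝ → E, ContinuousOn y (Icc a b) ∧
      ∀ x ∈ Icc a b, y x = v + ∫ s in a..x, A s (y s) := by
  set u := picardTerm A a v
  have hcont := continuousOn_picardTerm hA hC v
  have hbound : ∀ n, ∀ x ∈ Icc a b, ‖u n x‖ ≤ ‖v‖ * ((C * (b - a)) ^ n / n.factorial) :=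
    fun n x hx => norm_picardTerm_le_of_mem hC v n hx
  have hmajorant : Summable fun n : ℕ => ‖v‖ * ((C * (b - a)) ^ n / n.factorial) :=
    (Real.summable_pow_div_factorial _).mul_left _
  have hsummable : ∀ x ∈ Icc a b, Summable fun n => u n x := fun x hx =>
    hmajorant.of_norm_bounded fun n => hbound n x hx
  refine ⟨fun x => ∑' n, u n x, continuousOn_tsum hcont hmajorant hbound, fun x hx => ?_⟩
  have hIoc : uIoc a x ⊆ Icc a b := by
    rw [uIoc_of_le hx.1]
    exact Ioc_subset_Icc_self.trans (Icc_subset_Icc_right hx.2)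
  have hasSum_integral :
      HasSum (fun n => ∫ s in a..x, A s (u n s)) (∫ s in a..x, A s (∑' n, u n s)) := by
    refine intervalIntegral.hasSum_integral_of_dominated_convergence
      (fun n _ => C * (‖v‖ * ((C * (b - a)) ^ n / n.factorial))) (fun n => ?_)
      (fun n => Eventually.of_forall fun s hs => ?_)
      (Eventually.of_forall fun s _ => hmajorant.mul_left _) intervalIntegrable_const
      (Eventually.of_forall fun s hs => (A s).hasSum (hsummable s (hIoc hs)).hasSum)
    · exact ((integrableOn_clm_apply hA hC (hcont n)).mono_set hIoc).aestronglyMeasurable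
    · exact (A s).le_of_opNorm_le_of_le (hC s (hIoc hs)) (hbound n s (hIoc hs))
  beta_reduce
  rw [(hsummable x hx).tsum_eq_zero_add, ← hasSum_integral.tsum_eq]
  rfl

end Picard

theorem eq_add_integral_of_absolutelyContinuous [CompleteSpace E] {f f' : ℝ → E} {a b : ℝ}
    (hf : AbsolutelyContinuousOnInterval f a b)
    (hf' : ∀ᵐ x, x ∈ uIcc a b → HasDerivAt f (f' x) x)
    (hf'_int : IntervalIntegrable f' volume a b) {x : ℝ} (hx : x ∈ uIcc a b) :
    f x = f a + ∫ s in a..x, f' s := by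
  have hderiv_zero : ∀ᵐ x, x ∈ uIcc a b →
      HasDerivAt (f - fun x => ∫ s in a..x, f' s) 0 x := by
    filter_upwards [hf', hf'_int.ae_hasDerivAt_integral] with x hfx hprim hmem
    simpa using (hfx hmem).sub (hprim hmem a left_mem_uIcc)
  obtain ⟨C, hC⟩ := (hf.sub
    (absolutelyContinuousOnInterval_integral hf'_int)).const_of_ae_hasDerivAt_zero hderiv_zero
  have hxa : f x - ∫ s in a..x, f' s = f a := by
    simpa using (hC x hx).trans (hC a left_mem_uIcc).symm
  rw [← hxa, sub_add_cancel]

end LinearIntegralEquations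

section BoundedVariation

lemma intervalIntegrable_of_boundedVariationOn {f : ℝ → ℂ} {a b : ℝ} (hab : a ≤ b)
    (hf : BoundedVariationOn f (Icc a b)) : IntervalIntegrable f volume a b := by
  have real_case : ∀ g : ℝ → ℝ, BoundedVariationOn g (Icc a b) →
      IntegrableOn g (Ioc a b) volume := by
    intro g hg
    obtain ⟨u, w, hu, hw, rfl⟩ := hg.locallyBoundedVariationOn.exists_monotoneOn_sub_monotoneOn
    rw [← uIcc_of_le hab] at hu hw
    exact (hu.intervalIntegrable.sub hw.intervalIntegrable).1
  rw [intervalIntegrable_iff_integrableOn_Ioc_of_le hab]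
  exact Integrable.re_im_iff.1
    ⟨real_case _ (Complex.reCLM.lipschitz.comp_boundedVariationOn hf),
      real_case _ (Complex.imCLM.lipschitz.comp_boundedVariationOn hf)⟩

lemma exists_bound_of_boundedVariationOn {E : Type*} [SeminormedAddCommGroup E] {f : ℝ → E}
    {s : Set ℝ} (hf : BoundedVariationOn f s) : ∃ K, ∀ x ∈ s, ‖f x‖ ≤ K := by
  rcases s.eq_empty_or_nonempty with rfl | ⟨a, ha⟩
  · exact ⟨0, by simp⟩
  · refine ⟨‖f a‖ + (eVariationOn f s).toReal, fun x hx => ?_⟩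
    have hdist := hf.dist_le hx ha
    rw [dist_eq_norm] at hdist
    linarith [norm_sub_norm_le (f x) (f a)]

end BoundedVariation

section RiemannLebesgue

lemma exists_contDiff_integral_norm_sub_le {E : Type*} [NormedAddCommGroup E] [NormedSpace ℝ E]
    {f : ℝ → E} {a b ε : ℝ} (hab : a ≤ b) (hf : IntervalIntegrable f volume a b) (hε : 0 < ε) :
    ∃ g : ℝ → E, ContDiff ℝ 1 g ∧ ∫ x in a..b, ‖f x - g x‖ ≤ ε := by
  have hf_ext : Integrable ((Ioc a b).indicator f) :=
    (integrable_indicator_iff measurableSet_Ioc).2 hf.1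
  obtain ⟨g, hg_supp, hg_smooth, hg⟩ :=
    (memLp_one_iff_integrable.2 hf_ext).exist_eLpNorm_sub_le ENNReal.one_ne_top le_rfl hε
  have hdiff : Integrable ((Ioc a b).indicator f - g) :=
    hf_ext.sub (hg_smooth.continuous.integrable_of_hasCompactSupport hg_supp)
  refine ⟨g, hg_smooth.of_le (by simp), ?_⟩
  calc ∫ x in a..b, ‖f x - g x‖
      = ∫ x in Ioc a b, ‖((Ioc a b).indicator f - g) x‖ := by
        rw [intervalIntegral.integral_of_le hab]
        exact setIntegral_congr_fun measurableSet_Ioc fun x hx => by simp [hx]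
    _ ≤ ∫ x, ‖((Ioc a b).indicator f - g) x‖ :=
        setIntegral_le_integral hdiff.norm (Eventually.of_forall fun _ => norm_nonneg _)
    _ ≤ ε := by
        rw [eLpNorm_one_eq_lintegral_enorm] at hg
        rw [integral_norm_eq_lintegral_enorm hdiff.aestronglyMeasurable]
        exact ENNReal.toReal_le_of_le_ofReal hε.le hg

lemma hasDerivAt_exp_mul_ofReal_add (c d : ℂ) (x : ℝ) :
    HasDerivAt (fun r : ℝ => Complex.exp (c * r + d)) (c * Complex.exp (c * x + d)) x := by
  have h : HasDerivAt (fun r : ℝ => c * (r : ℂ) + d) c x := by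
    simpa using ((Complex.ofRealCLM.hasDerivAt (x := x)).const_mul c).add_const d
  simpa only [mul_comm] using h.cexp

lemma norm_integral_exp_mul_le_of_contDiff {g : ℝ → ℂ} {s x G G' : ℝ} {c d : ℂ} (hc : c ≠ 0)
    (hg : ContDiff ℝ 1 g) (hsx : s ≤ x) (hG : ∀ r ∈ Icc s x, ‖g r‖ ≤ G)
    (hG' : ∀ r ∈ Icc s x, ‖deriv g r‖ ≤ G')
    (hexp : ∀ r ∈ Icc s x, ‖Complex.exp (c * r + d)‖ ≤ 1) :
    ‖∫ r in s..x, Complex.exp (c * r + d) * g r‖ ≤ (2 * G + (x - s) * G') / ‖c‖ := by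
  have hc0 : 0 < ‖c‖ := norm_pos_iff.2 hc
  have hexp_cont : Continuous fun r : ℝ => Complex.exp (c * r + d) := by fun_prop
  have hg'_cont : Continuous (deriv g) := hg.continuous_deriv_one
  have by_parts : c * ∫ r in s..x, Complex.exp (c * r + d) * g r =
      Complex.exp (c * x + d) * g x - Complex.exp (c * s + d) * g s -
        ∫ r in s..x, Complex.exp (c * r + d) * deriv g r := by
    have h := intervalIntegral.integral_mul_deriv_eq_deriv_mul (a := s) (b := x)
      (fun r _ => ((hg.differentiable one_ne_zero) r).hasDerivAt)
      (fun r _ => hasDerivAt_exp_mul_ofReal_add c d r)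
      (hg'_cont.intervalIntegrable _ _) ((hexp_cont.const_mul c).intervalIntegrable _ _)
    rw [← intervalIntegral.integral_const_mul]
    simp only [mul_comm, mul_left_comm] at h ⊢
    exact h
  have norm_mul_le : ∀ u : ℝ → ℂ, ∀ B, (∀ r ∈ Icc s x, ‖u r‖ ≤ B) → ∀ r ∈ Icc s x,
      ‖Complex.exp (c * r + d) * u r‖ ≤ B := fun u B hu r hr => by
    rw [norm_mul]
    exact (mul_le_of_le_one_left (norm_nonneg _) (hexp r hr)).trans (hu r hr)
  have hint : ‖∫ r in s..x, Complex.exp (c * r + d) * deriv g r‖ ≤ G' * (x - s) := by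
    rw [← abs_of_nonneg (sub_nonneg.2 hsx)]
    refine intervalIntegral.norm_integral_le_of_norm_le_const fun r hr => ?_
    rw [uIoc_of_le hsx] at hr
    exact norm_mul_le _ _ hG' r (Ioc_subset_Icc_self hr)
  rw [le_div_iff₀ hc0, mul_comm, ← norm_mul, by_parts]
  refine (norm_sub_le _ _).trans ?_
  linarith [norm_sub_le (Complex.exp (c * x + d) * g x) (Complex.exp (c * s + d) * g s),
    norm_mul_le _ _ hG x ⟨hsx, le_rfl⟩, norm_mul_le _ _ hG s ⟨le_rfl, hsx⟩]

lemma norm_integral_exp_mul_sub_le {f g : ℝ → ℂ} {a b s x : ℝ} {c d : ℂ}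
    (hfg : IntervalIntegrable (fun r => f r - g r) volume a b) (has : a ≤ s) (hsx : s ≤ x)
    (hxb : x ≤ b) (hexp : ∀ r ∈ Icc s x, ‖Complex.exp (c * r + d)‖ ≤ 1) :
    ‖∫ r in s..x, Complex.exp (c * r + d) * (f r - g r)‖ ≤ ∫ r in a..b, ‖f r - g r‖ := by
  have hfg_sx : IntervalIntegrable (fun r => f r - g r) volume s x := hfg.mono_set (by
    rw [uIcc_of_le hsx, uIcc_of_le (has.trans (hsx.trans hxb))]
    exact Icc_subset_Icc has hxb)
  calc ‖∫ r in s..x, Complex.exp (c * r + d) * (f r - g r)‖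
      ≤ ∫ r in s..x, ‖f r - g r‖ := by
        refine intervalIntegral.norm_integral_le_of_norm_le hsx
          (Eventually.of_forall fun r hr => ?_) hfg_sx.norm
        rw [norm_mul]
        exact mul_le_of_le_one_left (norm_nonneg _) (hexp r (Ioc_subset_Icc_self hr))
    _ ≤ ∫ r in a..b, ‖f r - g r‖ := intervalIntegral.integral_mono_interval has hsx hxb
        (Eventually.of_forall fun _ => norm_nonneg _) hfg.norm

theorem exists_norm_integral_exp_mul_le {f : ℝ → ℂ} {a b ε : ℝ} (hab : a ≤ b) (hε : 0 < ε)
    (hf : IntervalIntegrable f volume a b) :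
    ∃ R > 0, ∀ c d : ℂ, R ≤ ‖c‖ → ∀ s x : ℝ, a ≤ s → s ≤ x → x ≤ b →
      (∀ r ∈ Icc s x, ‖Complex.exp (c * r + d)‖ ≤ 1) →
      ‖∫ r in s..x, Complex.exp (c * r + d) * f r‖ ≤ ε := by
  obtain ⟨g, hg, hfg⟩ := exists_contDiff_integral_norm_sub_le hab hf (half_pos hε)
  obtain ⟨G, hG⟩ := isCompact_Icc.exists_bound_of_continuousOn (s := Icc a b)
    hg.continuous.continuousOn
  obtain ⟨G', hG'⟩ := isCompact_Icc.exists_bound_of_continuousOn (s := Icc a b)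
    hg.continuous_deriv_one.continuousOn
  have hG0 : 0 ≤ G := (norm_nonneg _).trans (hG a ⟨le_rfl, hab⟩)
  have hG'0 : 0 ≤ G' := (norm_nonneg _).trans (hG' a ⟨le_rfl, hab⟩)
  have : 0 ≤ b - a := sub_nonneg.2 hab
  refine ⟨2 * (2 * G + (b - a) * G') / ε + 1, by positivity, fun c d hc s x has hsx hxb hexp => ?_⟩
  have hc0 : 0 < ‖c‖ := lt_of_lt_of_le (by positivity) hc
  have hIcc : Icc s x ⊆ Icc a b := Icc_subset_Icc has hxb
  have hfgi : IntervalIntegrable (fun r => f r - g r) volume a b :=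
    hf.sub (hg.continuous.intervalIntegrable _ _)
  have hexp_cont : Continuous fun r : ℝ => Complex.exp (c * r + d) := by fun_prop
  have hsmooth : ‖∫ r in s..x, Complex.exp (c * r + d) * g r‖ ≤ ε / 2 := by
    refine (norm_integral_exp_mul_le_of_contDiff (norm_pos_iff.1 hc0) hg hsx
      (fun r hr => hG r (hIcc hr)) (fun r hr => hG' r (hIcc hr)) hexp).trans ?_
    have hR : 2 * (2 * G + (b - a) * G') / ε ≤ ‖c‖ := by linarith
    rw [div_le_iff₀ hε] at hR
    rw [div_le_iff₀ hc0]
    nlinarith [mul_le_mul_of_nonneg_right (by linarith : x - s ≤ b - a) hG'0]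
  have hsplit : ∫ r in s..x, Complex.exp (c * r + d) * f r =
      (∫ r in s..x, Complex.exp (c * r + d) * (f r - g r)) +
        ∫ r in s..x, Complex.exp (c * r + d) * g r := by
    rw [← intervalIntegral.integral_add (g := fun r : ℝ => Complex.exp (c * r + d) * g r)
      ((hfgi.mono_set (by rw [uIcc_of_le hsx, uIcc_of_le hab]; exact hIcc)).continuousOn_mul
        hexp_cont.continuousOn)
      (Continuous.intervalIntegrable (hexp_cont.mul hg.continuous) _ _)]
    simp only [← mul_add, sub_add_cancel]
  rw [hsplit]
  exact (norm_add_le _ _).trans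
    (by linarith [norm_integral_exp_mul_sub_le hfgi has hsx hxb hexp])

end RiemannLebesgue

section Solutions

/-- The regularity of the potential that the argument uses: coefficients integrable and bounded on
`[0, π]`. Pointwise boundedness replaces essential boundedness because `IsSolution` is an equation
for pointwise values. -/
structure BoundedPotential (p q : ℝ → ℂ) : Prop where
  intervalIntegrable_p : IntervalIntegrable p volume 0 Real.pi
  intervalIntegrable_q : IntervalIntegrable q volume 0 Real.pi
  bound_p : ∃ K, ∀ x ∈ Icc 0 Real.pi, ‖p x‖ ≤ K
  bound_q : ∃ K, ∀ x ∈ Icc 0 Real.pi, ‖q x‖ ≤ K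

lemma boundedPotential_of_boundedVariationOn {p q : ℝ → ℂ}
    (hp : BoundedVariationOn p (Icc 0 Real.pi)) (hq : BoundedVariationOn q (Icc 0 Real.pi)) :
    BoundedPotential p q :=
  ⟨intervalIntegrable_of_boundedVariationOn Real.pi_pos.le hp,
    intervalIntegrable_of_boundedVariationOn Real.pi_pos.le hq,
    exists_bound_of_boundedVariationOn hp, exists_bound_of_boundedVariationOn hq⟩

/-- Multiplication by a complex matrix as an operator over `ℝ`, the scalars of the time variable. -/
def matrixCLM (M : Matrix (Fin 2) (Fin 2) ℂ) : (Fin 2 → ℂ) →L[ℝ] (Fin 2 → ℂ) :=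
  LinearMap.toContinuousLinearMap ((Matrix.toLin' M).restrictScalars ℝ)

lemma matrixCLM_apply (M : Matrix (Fin 2) (Fin 2) ℂ) (v : Fin 2 → ℂ) :
    matrixCLM M v = M *ᵥ v := by
  simp [matrixCLM]

/-- The operator `-J (mu - Q(x))`, which puts the Dirac equation in the form `y' = coeff y`. -/
def coeff (p q : ℝ → ℂ) (mu : ℂ) (x : ℝ) : (Fin 2 → ℂ) →L[ℝ] (Fin 2 → ℂ) :=
  p x • matrixCLM !![0, -1; -1, 0] + q x • matrixCLM !![1, 0; 0, -1] +
    mu • matrixCLM !![0, -1; 1, 0]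

lemma coeff_apply (p q : ℝ → ℂ) (mu : ℂ) (x : ℝ) (v : Fin 2 → ℂ) :
    coeff p q mu x v =
      ![-mu * v 1 + q x * v 0 - p x * v 1, mu * v 0 - p x * v 0 - q x * v 1] := by
  ext i
  fin_cases i <;> simp [coeff, matrixCLM_apply, dotProduct, Fin.sum_univ_two] <;> ring

lemma J_mulVec_add_potential_mulVec_eq_iff (p q : ℝ → ℂ) (mu : ℂ) (x : ℝ) (v v' : Fin 2 → ℂ) :
    J *ᵥ v' + potential p q x *ᵥ v = mu • v ↔ v' = coeff p q mu x v := by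
  simp only [coeff_apply, J, potential, funext_iff, Fin.forall_fin_two, Pi.add_apply,
    Pi.smul_apply, smul_eq_mul, Matrix.mulVec, dotProduct, Fin.sum_univ_two, Matrix.of_apply,
    Matrix.cons_val_zero, Matrix.cons_val_one]
  constructor <;> rintro ⟨h0, h1⟩
  · exact ⟨by linear_combination -h1, by linear_combination h0⟩
  · exact ⟨by linear_combination h1, by linear_combination -h0⟩

variable {p q : ℝ → ℂ}

namespace BoundedPotential

lemma exists_norm_coeff_le (hpq : BoundedPotential p q) :
    ∃ κ > 0, ∀ mu : ℂ, ∀ x ∈ Icc 0 Real.pi, ‖coeff p q mu x‖ ≤ κ * (1 + ‖mu‖) := by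
  obtain ⟨K, hK⟩ := hpq.bound_p
  obtain ⟨L, hL⟩ := hpq.bound_q
  have hK0 : 0 ≤ K := (norm_nonneg _).trans (hK 0 ⟨le_rfl, Real.pi_pos.le⟩)
  have hL0 : 0 ≤ L := (norm_nonneg _).trans (hL 0 ⟨le_rfl, Real.pi_pos.le⟩)
  set P := ‖matrixCLM !![0, -1; -1, 0]‖
  set R := ‖matrixCLM !![1, 0; 0, -1]‖
  set M := ‖matrixCLM !![0, -1; 1, 0]‖
  refine ⟨K * P + L * R + M + 1, by positivity, fun mu x hx => ?_⟩
  calc ‖coeff p q mu x‖ ≤ ‖p x‖ * P + ‖q x‖ * R + ‖mu‖ * M := by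
        refine norm_add₃_le.trans_eq ?_
        simp only [norm_smul, P, R, M]
    _ ≤ K * P + L * R + ‖mu‖ * M := by
        gcongr
        exacts [hK x hx, hL x hx]
    _ ≤ (K * P + L * R + M + 1) * (1 + ‖mu‖) := by
        have : 0 ≤ (K * P + L * R) * ‖mu‖ + M + 1 + ‖mu‖ := by positivity
        linarith

lemma aestronglyMeasurable_coeff (hpq : BoundedPotential p q) (mu : ℂ) :
    AEStronglyMeasurable (coeff p q mu) (volume.restrict (Icc 0 Real.pi)) := by
  have hmeas : ∀ f : ℝ → ℂ, IntervalIntegrable f volume 0 Real.pi →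
      AEStronglyMeasurable f (volume.restrict (Icc 0 Real.pi)) := fun f hf =>
    ((intervalIntegrable_iff_integrableOn_Icc_of_le Real.pi_pos.le).1 hf).aestronglyMeasurable
  exact (((hmeas p hpq.intervalIntegrable_p).smul_const _).add
    ((hmeas q hpq.intervalIntegrable_q).smul_const _)).add aestronglyMeasurable_const

lemma intervalIntegrable_coeff_apply (hpq : BoundedPotential p q) (mu : ℂ)
    {y : ℝ → Fin 2 → ℂ} (hy : ContinuousOn y (Icc 0 Real.pi)) :
    IntervalIntegrable (fun s => coeff p q mu s (y s)) volume 0 Real.pi := by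
  obtain ⟨κ, -, hκ⟩ := hpq.exists_norm_coeff_le
  rw [intervalIntegrable_iff_integrableOn_Icc_of_le Real.pi_pos.le]
  exact integrableOn_clm_apply (hpq.aestronglyMeasurable_coeff mu) (hκ mu) hy

end BoundedPotential

lemma IsSolution.continuousOn {mu : ℂ} {y : ℝ → Fin 2 → ℂ} (hy : IsSolution p q mu y) :
    ContinuousOn y (Icc 0 Real.pi) := by
  simpa only [uIcc_of_le Real.pi_pos.le] using hy.ac.continuousOn

lemma IsSolution.ae_hasDerivAt {mu : ℂ} {y : ℝ → Fin 2 → ℂ} (hy : IsSolution p q mu y) :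
    ∀ᵐ x, x ∈ uIcc 0 Real.pi → HasDerivAt y (coeff p q mu x (y x)) x := by
  rw [uIcc_of_le Real.pi_pos.le]
  filter_upwards [(ae_restrict_iff' measurableSet_Icc).1 hy.eqn] with x hx hx_mem
  obtain ⟨y', hy', heqn⟩ := hx hx_mem
  rwa [← (J_mulVec_add_potential_mulVec_eq_iff p q mu x (y x) y').1 heqn]

lemma IsSolution.eq_add_integral {mu : ℂ} {y : ℝ → Fin 2 → ℂ} (hpq : BoundedPotential p q)
    (hy : IsSolution p q mu y) {x : ℝ} (hx : x ∈ Icc 0 Real.pi) :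
    y x = y 0 + ∫ s in 0..x, coeff p q mu s (y s) :=
  eq_add_integral_of_absolutelyContinuous hy.ac hy.ae_hasDerivAt
    (hpq.intervalIntegrable_coeff_apply mu hy.continuousOn)
    (by rwa [uIcc_of_le Real.pi_pos.le])

lemma isSolution_of_eq_add_integral {mu : ℂ} {y : ℝ → Fin 2 → ℂ} {v : Fin 2 → ℂ}
    (hpq : BoundedPotential p q) (hy : ContinuousOn y (Icc 0 Real.pi))
    (h : ∀ x ∈ Icc 0 Real.pi, y x = v + ∫ s in 0..x, coeff p q mu s (y s)) :
    IsSolution p q mu y := by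
  have hint := hpq.intervalIntegrable_coeff_apply mu hy
  refine ⟨absolutelyContinuousOnInterval_of_dist_le
    (absolutelyContinuousOnInterval_integral hint) fun a ha b hb => ?_, ?_⟩
  · rw [uIcc_of_le Real.pi_pos.le] at ha hb
    rw [h a ha, h b hb, dist_add_left]
  · rw [ae_restrict_iff' measurableSet_Icc]
    filter_upwards [hint.ae_hasDerivAt_integral, Measure.ae_ne volume 0,
      Measure.ae_ne volume Real.pi] with x hx hx0 hxpi hx_mem
    have hx_Ioo : x ∈ Ioo 0 Real.pi :=
      ⟨hx_mem.1.lt_of_ne hx0.symm, hx_mem.2.lt_of_ne hxpi⟩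
    have hderiv := (hx (by rwa [uIcc_of_le Real.pi_pos.le]) 0 left_mem_uIcc).const_add v
    refine ⟨_, hderiv.congr_of_eventuallyEq ?_,
      (J_mulVec_add_potential_mulVec_eq_iff p q mu x (y x) _).2 rfl⟩
    filter_upwards [Icc_mem_nhds hx_Ioo.1 hx_Ioo.2] with z hz using h z hz

theorem BoundedPotential.exists_isSolution (hpq : BoundedPotential p q) (mu : ℂ)
    (v : Fin 2 → ℂ) : ∃ y, IsSolution p q mu y ∧ y 0 = v := by
  obtain ⟨κ, -, hκ⟩ := hpq.exists_norm_coeff_le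
  obtain ⟨y, hy, h⟩ := exists_eq_add_integral_clm_apply
    (hpq.aestronglyMeasurable_coeff mu) (hκ mu) v
  refine ⟨y, isSolution_of_eq_add_integral hpq hy h, ?_⟩
  simpa using h 0 ⟨le_rfl, Real.pi_pos.le⟩

theorem BoundedPotential.exists_norm_solution_le (hpq : BoundedPotential p q) :
    ∃ κ > 0, ∀ (mu : ℂ) (y : ℝ → Fin 2 → ℂ), IsSolution p q mu y → ∀ x ∈ Icc 0 Real.pi,
      ‖y x‖ ≤ ‖y 0‖ * Real.exp (κ * (1 + ‖mu‖)) := by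
  obtain ⟨κ, hκ, hcoeff⟩ := hpq.exists_norm_coeff_le
  refine ⟨κ * Real.pi, mul_pos hκ Real.pi_pos, fun mu y hy x hx => ?_⟩
  have hnorm_cont : ContinuousOn (fun x => ‖y x‖) (Icc 0 Real.pi) := hy.continuousOn.norm
  have hintegral : ∀ x ∈ Icc 0 Real.pi,
      ‖y x‖ ≤ ‖y 0‖ + κ * (1 + ‖mu‖) * ∫ s in 0..x, ‖y s‖ := fun x hx => by
    rw [hy.eq_add_integral hpq hx, ← intervalIntegral.integral_const_mul]
    refine (norm_add_le _ _).trans (add_le_add_right ?_ _)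
    refine intervalIntegral.norm_integral_le_of_norm_le hx.1 (Eventually.of_forall fun s hs =>
      (coeff p q mu s).le_of_opNorm_le (hcoeff mu s ⟨hs.1.le, hs.2.trans hx.2⟩) _) ?_
    refine ContinuousOn.intervalIntegrable ?_
    rw [uIcc_of_le hx.1]
    exact (hnorm_cont.mono (Icc_subset_Icc_right hx.2)).const_mul _
  calc ‖y x‖ ≤ ‖y 0‖ * Real.exp (κ * (1 + ‖mu‖) * (x - 0)) :=
        le_mul_exp_of_le_add_integral hnorm_cont (by positivity) hintegral hx
    _ ≤ ‖y 0‖ * Real.exp (κ * Real.pi * (1 + ‖mu‖)) := by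
        rw [sub_zero, mul_right_comm κ]
        have := hx.2
        gcongr

namespace IsSolution

lemma add {mu : ℂ} {y z : ℝ → Fin 2 → ℂ} (hy : IsSolution p q mu y)
    (hz : IsSolution p q mu z) : IsSolution p q mu (fun x => y x + z x) := by
  refine ⟨hy.ac.add hz.ac, ?_⟩
  filter_upwards [hy.eqn, hz.eqn] with x ⟨y', hy', hy_eqn⟩ ⟨z', hz', hz_eqn⟩
  refine ⟨y' + z', hy'.add hz', ?_⟩
  rw [Matrix.mulVec_add, Matrix.mulVec_add, smul_add, ← hy_eqn, ← hz_eqn, add_add_add_comm]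

lemma smul {mu : ℂ} {y : ℝ → Fin 2 → ℂ} (c : ℂ) (hy : IsSolution p q mu y) :
    IsSolution p q mu (fun x => c • y x) := by
  refine ⟨hy.ac.const_smul c, ?_⟩
  filter_upwards [hy.eqn] with x ⟨y', hy', hy_eqn⟩
  refine ⟨c • y', hy'.const_smul c, ?_⟩
  rw [Matrix.mulVec_smul, Matrix.mulVec_smul, ← smul_add, hy_eqn, smul_comm]

theorem eqOn (hpq : BoundedPotential p q) {mu : ℂ} {y z : ℝ → Fin 2 → ℂ}
    (hy : IsSolution p q mu y) (hz : IsSolution p q mu z) (h : y 0 = z 0) :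
    EqOn y z (Icc 0 Real.pi) := by
  intro x hx
  obtain ⟨κ, -, hκ⟩ := hpq.exists_norm_solution_le
  have hdiff := hκ mu _ (hy.add (hz.smul (-1))) x hx
  simpa only [h, neg_smul, one_smul, add_neg_cancel, norm_zero, zero_mul, norm_le_zero_iff,
    add_neg_eq_zero] using hdiff

end IsSolution

namespace BoundedPotential

lemma solution_spec (hpq : BoundedPotential p q) (mu : ℂ) (v : Fin 2 → ℂ) :
    IsSolution p q mu (solution p q mu v) ∧ solution p q mu v 0 = v :=
  Classical.epsilon_spec (hpq.exists_isSolution mu v)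

lemma isSolution_cSol (hpq : BoundedPotential p q) (mu : ℂ) :
    IsSolution p q mu (cSol p q mu) := (hpq.solution_spec mu _).1

lemma isSolution_sSol (hpq : BoundedPotential p q) (mu : ℂ) :
    IsSolution p q mu (sSol p q mu) := (hpq.solution_spec mu _).1

lemma cSol_zero (hpq : BoundedPotential p q) (mu : ℂ) :
    cSol p q mu 0 = ![1, 0] := (hpq.solution_spec mu _).2

lemma sSol_zero (hpq : BoundedPotential p q) (mu : ℂ) :
    sSol p q mu 0 = ![0, 1] := (hpq.solution_spec mu _).2

end BoundedPotential

namespace IsSolution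

lemma eq_smul_add_smul (hpq : BoundedPotential p q) {mu : ℂ} {y : ℝ → Fin 2 → ℂ}
    (hy : IsSolution p q mu y) {x : ℝ} (hx : x ∈ Icc 0 Real.pi) :
    y x = y 0 0 • cSol p q mu x + y 0 1 • sSol p q mu x := by
  refine hy.eqOn hpq (((hpq.isSolution_cSol mu).smul (y 0 0)).add
    ((hpq.isSolution_sSol mu).smul (y 0 1))) ?_ hx
  ext i
  fin_cases i <;> simp [hpq.cSol_zero, hpq.sSol_zero]

lemma ac_apply {mu : ℂ} {y : ℝ → Fin 2 → ℂ} (hy : IsSolution p q mu y) (i : Fin 2) :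
    AbsolutelyContinuousOnInterval (fun x => y x i) 0 Real.pi :=
  absolutelyContinuousOnInterval_of_dist_le hy.ac fun _ _ _ _ => dist_le_pi_dist _ _ i

theorem lagrange_identity {la mu : ℂ} {y z : ℝ → Fin 2 → ℂ}
    (hy : IsSolution p q la y) (hz : IsSolution p q mu z) {x : ℝ} (hx : x ∈ Icc 0 Real.pi) :
    y x 0 * z x 1 - y x 1 * z x 0 = y 0 0 * z 0 1 - y 0 1 * z 0 0 +
      (mu - la) * ∫ s in 0..x, (y s 0 * z s 0 + y s 1 * z s 1) := by
  rw [← intervalIntegral.integral_const_mul]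
  refine eq_add_integral_of_absolutelyContinuous
    (f := fun x => y x 0 * z x 1 - y x 1 * z x 0)
    (((hy.ac_apply 0).smul (hz.ac_apply 1)).sub ((hy.ac_apply 1).smul (hz.ac_apply 0)))
    ?_ ?_ (by rwa [uIcc_of_le Real.pi_pos.le])
  · filter_upwards [hy.ae_hasDerivAt, hz.ae_hasDerivAt] with s hys hzs hs
    have hy' := hasDerivAt_pi.1 (hys hs)
    have hz' := hasDerivAt_pi.1 (hzs hs)
    refine (((hy' 0).mul (hz' 1)).sub ((hy' 1).mul (hz' 0))).congr_deriv ?_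
    simp only [coeff_apply, Matrix.cons_val_zero, Matrix.cons_val_one]
    ring
  · refine ContinuousOn.intervalIntegrable ?_
    rw [uIcc_of_le Real.pi_pos.le]
    have hy_cont := continuousOn_pi.1 hy.continuousOn
    have hz_cont := continuousOn_pi.1 hz.continuousOn
    exact (((hy_cont 0).mul (hz_cont 0)).add ((hy_cont 1).mul (hz_cont 1))).const_mul _

end IsSolution

lemma IsSolution.conj {mu : ℂ} {y : ℝ → Fin 2 → ℂ}
    (hy : IsSolution (fun x => conj (p x)) (fun x => conj (q x)) (conj mu) y) :
    IsSolution p q mu (fun x i => conj (y x i)) := by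
  constructor
  · refine absolutelyContinuousOnInterval_of_dist_le hy.ac fun a _ b _ => le_of_eq ?_
    simp only [dist_pi_def, nndist_eq_nnnorm, ← map_sub, RCLike.nnnorm_conj]
  · filter_upwards [hy.eqn] with x ⟨y', hy', heqn⟩
    refine ⟨fun i => conj (y' i), hasDerivAt_pi.2 fun i => (hasDerivAt_pi.1 hy' i).star, ?_⟩
    rw [J_mulVec_add_potential_mulVec_eq_iff,
      (J_mulVec_add_potential_mulVec_eq_iff _ _ _ _ _ _).1 heqn]
    ext i
    fin_cases i <;> simp [coeff_apply]

end Solutions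

section Floquet

/-- The nearest point of `[0, π]`. Composing with it turns functions that are only continuous on
`[0, π]`, such as solutions, into globally continuous ones. -/
def clamp (x : ℝ) : ℝ := projIcc 0 Real.pi Real.pi_pos.le x

lemma continuous_clamp : Continuous clamp := continuous_subtype_val.comp continuous_projIcc

lemma clamp_mem (x : ℝ) : clamp x ∈ Icc 0 Real.pi := (projIcc 0 Real.pi Real.pi_pos.le x).2

lemma clamp_of_mem {x : ℝ} (hx : x ∈ Icc 0 Real.pi) : clamp x = x := by
  rw [clamp, projIcc_of_mem _ hx]

/-- The bilinear pairing `∫₀ˣ y · z` without conjugation, for which the Dirac operator is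
symmetric. -/
def pairing (y z : ℝ → Fin 2 → ℂ) (x : ℝ) : ℂ :=
  ∫ s in 0..x, (y s 0 * z s 0 + y s 1 * z s 1)

lemma pairing_comm (y z : ℝ → Fin 2 → ℂ) (x : ℝ) : pairing y z x = pairing z y x := by
  simp only [pairing, mul_comm]

lemma norm_pairing_le {y z : ℝ → Fin 2 → ℂ} {B C x : ℝ}
    (hy : ∀ s ∈ Icc 0 Real.pi, ‖y s‖ ≤ B) (hz : ∀ s ∈ Icc 0 Real.pi, ‖z s‖ ≤ C)
    (hx : x ∈ Icc 0 Real.pi) : ‖pairing y z x‖ ≤ 2 * B * C * Real.pi := by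
  have hB : 0 ≤ B := (norm_nonneg _).trans (hy x hx)
  have hC : 0 ≤ C := (norm_nonneg _).trans (hz x hx)
  have hbound : ∀ s ∈ uIoc 0 x, ‖y s 0 * z s 0 + y s 1 * z s 1‖ ≤ 2 * B * C := fun s hs => by
    rw [uIoc_of_le hx.1] at hs
    have hs_mem : s ∈ Icc 0 Real.pi := ⟨hs.1.le, hs.2.trans hx.2⟩
    have hprod : ∀ i, ‖y s i * z s i‖ ≤ B * C := fun i => norm_mul_le_of_le
      ((norm_le_pi_norm _ i).trans (hy s hs_mem)) ((norm_le_pi_norm _ i).trans (hz s hs_mem))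
    linarith [norm_add_le_of_le (hprod 0) (hprod 1)]
  refine (intervalIntegral.norm_integral_le_of_norm_le_const hbound).trans ?_
  rw [sub_zero, abs_of_nonneg hx.1]
  exact mul_le_mul_of_nonneg_left hx.2 (by positivity)

lemma continuous_pairing_of_continuous_clamp {X : Type*} [TopologicalSpace X]
    {y z : X → ℝ → Fin 2 → ℂ} (hy : Continuous fun w : X × ℝ => y w.1 (clamp w.2))
    (hz : Continuous fun w : X × ℝ => z w.1 (clamp w.2)) {x : ℝ} (hx : x ∈ Icc 0 Real.pi) :
    Continuous fun w => pairing (y w) (z w) x := by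
  have hclamp : ∀ w, pairing (y w) (z w) x = ∫ s in 0..x,
      (y w (clamp s) 0 * z w (clamp s) 0 + y w (clamp s) 1 * z w (clamp s) 1) := fun w =>
    intervalIntegral.integral_congr fun s hs => by
      rw [uIcc_of_le hx.1] at hs
      simp only [clamp_of_mem ⟨hs.1, hs.2.trans hx.2⟩]
  simp only [hclamp]
  apply intervalIntegral.continuous_parametric_intervalIntegral_of_continuous'
  have hy' := continuous_pi_iff.1 hy
  have hz' := continuous_pi_iff.1 hz
  exact ((hy' 0).mul (hz' 0)).add ((hy' 1).mul (hz' 1))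

variable {p q : ℝ → ℂ}

lemma BoundedPotential.wronskian_eq_one (hpq : BoundedPotential p q) (mu : ℂ) {x : ℝ}
    (hx : x ∈ Icc 0 Real.pi) :
    cSol p q mu x 0 * sSol p q mu x 1 - cSol p q mu x 1 * sSol p q mu x 0 = 1 := by
  simpa [hpq.cSol_zero, hpq.sSol_zero] using
    (hpq.isSolution_cSol mu).lagrange_identity (hpq.isSolution_sSol mu) hx

theorem IsSolution.variation_of_constants (hpq : BoundedPotential p q) {la mu : ℂ}
    {y : ℝ → Fin 2 → ℂ} (hy : IsSolution p q mu y) {x : ℝ} (hx : x ∈ Icc 0 Real.pi) :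
    y x = y 0 0 • cSol p q la x + y 0 1 • sSol p q la x + (mu - la) •
      (pairing (cSol p q la) y x • sSol p q la x - pairing (sSol p q la) y x • cSol p q la x) := by
  have hc := (hpq.isSolution_cSol la).lagrange_identity hy hx
  have hs := (hpq.isSolution_sSol la).lagrange_identity hy hx
  have hW := hpq.wronskian_eq_one la hx
  simp only [hpq.cSol_zero, hpq.sSol_zero, Matrix.cons_val_zero, Matrix.cons_val_one] at hc hs
  simp only [funext_iff, Fin.forall_fin_two, Pi.add_apply, Pi.sub_apply, Pi.smul_apply,
    smul_eq_mul, pairing]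
  constructor
  · linear_combination sSol p q la x 0 * hc - cSol p q la x 0 * hs - y x 0 * hW
  · linear_combination sSol p q la x 1 * hc - cSol p q la x 1 * hs - y x 1 * hW

namespace BoundedPotential

lemma exists_norm_solution_le_of_norm_le (hpq : BoundedPotential p q) (R : ℝ) :
    ∃ B > 0, ∀ (mu : ℂ), ‖mu‖ ≤ R → ∀ (y : ℝ → Fin 2 → ℂ), IsSolution p q mu y →
      ∀ x ∈ Icc 0 Real.pi, ‖y x‖ ≤ ‖y 0‖ * B := by
  obtain ⟨κ, hκ, hbound⟩ := hpq.exists_norm_solution_le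
  refine ⟨Real.exp (κ * (1 + R)), Real.exp_pos _, fun mu hmu y hy x hx =>
    (hbound mu y hy x hx).trans ?_⟩
  gcongr

lemma exists_norm_fundamental_le (hpq : BoundedPotential p q) (R : ℝ) :
    ∃ B > 0, ∀ (mu : ℂ), ‖mu‖ ≤ R → ∀ x ∈ Icc 0 Real.pi,
      ‖cSol p q mu x‖ ≤ B ∧ ‖sSol p q mu x‖ ≤ B := by
  obtain ⟨B, hB, hbound⟩ := hpq.exists_norm_solution_le_of_norm_le R
  refine ⟨B, hB, fun mu hmu x hx => ⟨?_, ?_⟩⟩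
  · simpa [hpq.cSol_zero, Pi.norm_def, Fin.univ_succ] using
      hbound mu hmu _ (hpq.isSolution_cSol mu) x hx
  · simpa [hpq.sSol_zero, Pi.norm_def, Fin.univ_succ] using
      hbound mu hmu _ (hpq.isSolution_sSol mu) x hx

lemma solution_sub_solution (hpq : BoundedPotential p q) (v : Fin 2 → ℂ) (la mu : ℂ) {x : ℝ}
    (hx : x ∈ Icc 0 Real.pi) :
    solution p q mu v x - solution p q la v x = (mu - la) •
      (pairing (cSol p q la) (solution p q mu v) x • sSol p q la x -
        pairing (sSol p q la) (solution p q mu v) x • cSol p q la x) := by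
  obtain ⟨hmu, hmu_zero⟩ := hpq.solution_spec mu v
  obtain ⟨hla, hla_zero⟩ := hpq.solution_spec la v
  rw [hmu.variation_of_constants hpq (la := la) hx, hla.eq_smul_add_smul hpq hx, hmu_zero,
    hla_zero, add_sub_cancel_left]

lemma exists_norm_solution_sub_le (hpq : BoundedPotential p q) (v : Fin 2 → ℂ) (R : ℝ) :
    ∃ C, ∀ la mu : ℂ, ‖la‖ ≤ R → ‖mu‖ ≤ R → ∀ x ∈ Icc 0 Real.pi,
      ‖solution p q mu v x - solution p q la v x‖ ≤ C * ‖mu - la‖ := by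
  obtain ⟨B, -, hB⟩ := hpq.exists_norm_solution_le_of_norm_le R
  obtain ⟨D, -, hD_bound⟩ := hpq.exists_norm_fundamental_le R
  refine ⟨2 * (2 * D * (‖v‖ * B) * Real.pi * D), fun la mu hla hmu x hx => ?_⟩
  have hsol : ∀ s ∈ Icc 0 Real.pi, ‖solution p q mu v s‖ ≤ ‖v‖ * B := fun s hs => by
    simpa only [(hpq.solution_spec mu v).2] using hB mu hmu _ (hpq.solution_spec mu v).1 s hs
  have hterm : ∀ {y z : ℝ → Fin 2 → ℂ}, (∀ s ∈ Icc 0 Real.pi, ‖y s‖ ≤ D) → ‖z x‖ ≤ D →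
      ‖pairing y (solution p q mu v) x • z x‖ ≤ 2 * D * (‖v‖ * B) * Real.pi * D :=
    fun hy hz => by
      rw [norm_smul]
      exact mul_le_mul (norm_pairing_le hy hsol hx) hz (norm_nonneg _)
        ((norm_nonneg _).trans (norm_pairing_le hy hsol hx))
  rw [hpq.solution_sub_solution v la mu hx, norm_smul, mul_comm, two_mul]
  gcongr
  exact norm_sub_le_of_le
    (hterm (fun s hs => (hD_bound la hla s hs).1) (hD_bound la hla x hx).2)
    (hterm (fun s hs => (hD_bound la hla s hs).2) (hD_bound la hla x hx).1)

theorem continuous_solution_clamp (hpq : BoundedPotential p q) (v : Fin 2 → ℂ) :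
    Continuous fun z : ℂ × ℝ => solution p q z.1 v (clamp z.2) := by
  rw [continuous_iff_continuousAt]
  rintro ⟨la, x⟩
  obtain ⟨C, hC⟩ := hpq.exists_norm_solution_sub_le v (‖la‖ + 1)
  have hla_cont : Continuous fun z : ℂ × ℝ => solution p q la v (clamp z.2) :=
    (hpq.solution_spec la v).1.continuousOn.comp_continuous (continuous_clamp.comp continuous_snd)
      fun _ => clamp_mem _
  have hdiff : Tendsto (fun z : ℂ × ℝ =>
      solution p q z.1 v (clamp z.2) - solution p q la v (clamp z.2)) (𝓝 (la, x)) (𝓝 0) := by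
    have hlim : Tendsto (fun z : ℂ × ℝ => C * ‖z.1 - la‖) (𝓝 (la, x)) (𝓝 0) := by
      have hcont : Continuous fun z : ℂ × ℝ => C * ‖z.1 - la‖ := by fun_prop
      simpa using hcont.tendsto (la, x)
    have hnear : ∀ᶠ z : ℂ × ℝ in 𝓝 (la, x), ‖z.1‖ < ‖la‖ + 1 :=
      continuous_fst.norm.continuousAt.eventually_lt_const (lt_add_one _)
    refine squeeze_zero_norm' ?_ hlim
    filter_upwards [hnear] with z hz
    exact hC la z.1 (lt_add_one _).le hz.le _ (clamp_mem _)
  simpa only [ContinuousAt, sub_add_cancel, zero_add] using hdiff.add (hla_cont.tendsto (la, x))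

lemma continuous_solution_apply (hpq : BoundedPotential p q) (v : Fin 2 → ℂ) {x : ℝ}
    (hx : x ∈ Icc 0 Real.pi) : Continuous fun mu => solution p q mu v x := by
  simpa only [Function.comp_def, clamp_of_mem hx] using
    (hpq.continuous_solution_clamp v).comp (Continuous.prodMk_left x)

theorem hasDerivAt_solution (hpq : BoundedPotential p q) (la : ℂ) (v : Fin 2 → ℂ) {x : ℝ}
    (hx : x ∈ Icc 0 Real.pi) :
    HasDerivAt (fun mu => solution p q mu v x)
      (pairing (cSol p q la) (solution p q la v) x • sSol p q la x -
        pairing (sSol p q la) (solution p q la v) x • cSol p q la x) la := by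
  have hpairing : ∀ w, Continuous fun mu =>
      pairing (solution p q la w) (solution p q mu v) x := fun w =>
    continuous_pairing_of_continuous_clamp
      ((hpq.continuous_solution_clamp w).comp (continuous_const.prodMk continuous_snd))
      (hpq.continuous_solution_clamp v) hx
  have hslope : Continuous fun mu =>
      pairing (cSol p q la) (solution p q mu v) x • sSol p q la x -
        pairing (sSol p q la) (solution p q mu v) x • cSol p q la x :=
    ((hpairing _).smul continuous_const).sub ((hpairing _).smul continuous_const)
  rw [hasDerivAt_iff_tendsto_slope]
  refine ((hslope.tendsto la).mono_left nhdsWithin_le_nhds).congr' ?_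
  filter_upwards [self_mem_nhdsWithin] with mu hmu
  rw [slope_def_module, hpq.solution_sub_solution v la mu hx,
    inv_smul_smul₀ (sub_ne_zero.2 hmu)]

theorem hasDerivAt_discriminant (hpq : BoundedPotential p q) (mu : ℂ) :
    HasDerivAt (discriminant p q)
      (pairing (cSol p q mu) (cSol p q mu) Real.pi * sSol p q mu Real.pi 0 -
        pairing (cSol p q mu) (sSol p q mu) Real.pi * cSol p q mu Real.pi 0 +
        pairing (cSol p q mu) (sSol p q mu) Real.pi * sSol p q mu Real.pi 1 -
        pairing (sSol p q mu) (sSol p q mu) Real.pi * cSol p q mu Real.pi 1) mu := by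
  have hc := hasDerivAt_pi.1 (hpq.hasDerivAt_solution mu ![1, 0] ⟨Real.pi_pos.le, le_rfl⟩) 0
  have hs := hasDerivAt_pi.1 (hpq.hasDerivAt_solution mu ![0, 1] ⟨Real.pi_pos.le, le_rfl⟩) 1
  refine (hc.add hs).congr_deriv ?_
  simp only [Pi.sub_apply, Pi.smul_apply, smul_eq_mul, ← cSol.eq_def, ← sSol.eq_def]
  rw [pairing_comm (sSol p q mu) (cSol p q mu)]
  ring

lemma differentiable_discriminant (hpq : BoundedPotential p q) :
    Differentiable ℂ (discriminant p q) :=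
  fun mu => (hpq.hasDerivAt_discriminant mu).differentiableAt

lemma differentiable_sSol_zero (hpq : BoundedPotential p q) :
    Differentiable ℂ (fun mu => sSol p q mu Real.pi 0) := fun mu =>
  (hasDerivAt_pi.1 (hpq.hasDerivAt_solution mu ![0, 1] ⟨Real.pi_pos.le, le_rfl⟩)
    0).differentiableAt

lemma charDet_eq (hpq : BoundedPotential p q) (mu t : ℂ) :
    charDet p q mu t = 1 + multiplier t ^ 2 - multiplier t * discriminant p q mu := by
  have hW := hpq.wronskian_eq_one mu (x := Real.pi) ⟨Real.pi_pos.le, le_rfl⟩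
  rw [charDet, Matrix.det_fin_two_of, discriminant]
  linear_combination hW

end BoundedPotential

lemma multiplier_ne_zero (t : ℂ) : multiplier t ≠ 0 := Complex.exp_ne_zero _

lemma inv_multiplier (t : ℂ) : (multiplier t)⁻¹ = multiplier (-t) := by
  rw [multiplier, multiplier, ← Complex.exp_neg, mul_neg]

lemma multiplier_add_inv (t : ℂ) :
    multiplier t + (multiplier t)⁻¹ = 2 * Complex.cos (Real.pi * t) := by
  rw [inv_multiplier, multiplier, multiplier, Complex.two_cos]
  congr 2 <;> ring

namespace BoundedPotential

theorem charDet_eq_zero_iff (hpq : BoundedPotential p q) (mu t : ℂ) :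
    charDet p q mu t = 0 ↔ discriminant p q mu = 2 * Complex.cos (Real.pi * t) := by
  have hne := multiplier_ne_zero t
  rw [hpq.charDet_eq, sub_eq_zero, eq_comm, ← multiplier_add_inv,
    ← mul_right_inj' hne (b := discriminant p q mu), mul_add, mul_inv_cancel₀ hne, ← sq, add_comm]

lemma multiplicity_eq_one (hpq : BoundedPotential p q) {mu t : ℂ}
    (h : charDet p q mu t = 0) (h' : deriv (discriminant p q) mu ≠ 0) :
    multiplicity p q t mu = 1 := by
  have hderiv : ∀ z, HasDerivAt (fun z => charDet p q z t)
      (-(multiplier t * deriv (discriminant p q) z)) z := fun z => by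
    simp only [hpq.charDet_eq]
    exact ((hpq.differentiable_discriminant z).hasDerivAt.const_mul _).const_sub _
  have hdiff : Differentiable ℂ fun z => charDet p q z t := fun z => (hderiv z).differentiableAt
  refine (hdiff.analyticAt mu).analyticOrderAt_eq_one_of_zero_deriv_ne_zero h ?_
  rw [(hderiv mu).deriv]
  exact neg_ne_zero.2 (mul_ne_zero (multiplier_ne_zero t) h')

end BoundedPotential

lemma IsBlochSystem.charDet_eq_zero {S : Set ℂ} {lam : ℤ → Fin 2 → ℂ → ℂ}
    {Psi PsiStar : ℤ → Fin 2 → ℂ → ℝ → Fin 2 → ℂ}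
    (hB : IsBlochSystem p q S lam Psi PsiStar) (k : ℤ) (j : Fin 2) {t : ℂ} (ht : t ∈ S) :
    charDet p q (lam k j t) t = 0 := by
  by_contra hne
  have henum := hB.enum t ht (lam k j t)
  rw [multiplicity, analyticOrderAt_eq_zero.2 (.inr (by exact hne)), encard_eq_zero] at henum
  exact eq_empty_iff_forall_notMem.1 henum (k, j) rfl

end Floquet

section Expansion

variable {p q : ℝ → ℂ}

lemma exists_eq_smul_vecMulVec_of_mulVec_eq_smul {A : Matrix (Fin 2) (Fin 2) ℂ} {m n : ℂ}
    {v w : Fin 2 → ℂ} (hmn : m ≠ n) (hv : v ≠ 0) (hw : w ≠ 0) (hAv : A *ᵥ v = m • v)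
    (hAw : A *ᵥ w = n • w) : ∃ r : ℂ, (n • 1 - A) * J = r • Matrix.vecMulVec v w := by
  -- `v wᵀ - w vᵀ = -W • J` in dimension two, and `n - A` kills `w`.
  set W := w 0 * v 1 - w 1 * v 0 with hW
  have hprod : (m - n) • Matrix.vecMulVec v w = W • ((n • 1 - A) * J) := by
    simp only [funext_iff, Fin.forall_fin_two, Matrix.mulVec, dotProduct, Fin.sum_univ_two,
      Pi.smul_apply, smul_eq_mul] at hAv hAw
    ext i j
    fin_cases i <;> fin_cases j <;>
      simp [J, Matrix.vecMulVec_apply, Matrix.mul_apply, Fin.sum_univ_two, Matrix.one_apply, hW]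
    · linear_combination -w 0 * hAv.1 + v 0 * hAw.1
    · linear_combination -w 1 * hAv.1 + v 1 * hAw.1
    · linear_combination -w 0 * hAv.2 + v 0 * hAw.2
    · linear_combination -w 1 * hAv.2 + v 1 * hAw.2
  have hW_ne : W ≠ 0 := fun h => by
    simp [h, sub_eq_zero, hmn, Matrix.vecMulVec_eq_zero, hv, hw] at hprod
  exact ⟨W⁻¹ * (m - n), by rw [mul_smul, hprod, inv_smul_smul₀ hW_ne]⟩

/-- The fundamental system `(c, s)` as a family indexed by the initial coordinate. -/
def fundSol (p q : ℝ → ℂ) (mu : ℂ) : Fin 2 → ℝ → Fin 2 → ℂ := ![cSol p q mu, sSol p q mu]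

/-- The monodromy matrix `(c(π), s(π))`, which maps `y(0)` to `y(π)` for every solution `y`. -/
def monodromy (p q : ℝ → ℂ) (mu : ℂ) : Matrix (Fin 2) (Fin 2) ℂ :=
  Matrix.of fun i j => fundSol p q mu j Real.pi i

/-- `(e^{-iπt} - M) J` for the monodromy matrix `M`. Up to the factor `F'`, these are the
coefficients of the spectral projection onto an eigenfunction in the fundamental system. -/
def residueMatrix (p q : ℝ → ℂ) (mu t : ℂ) : Matrix (Fin 2) (Fin 2) ℂ :=
  ((multiplier t)⁻¹ • 1 - monodromy p q mu) * J

/-- The pairing of the Gelfand transform of `f` with `y` over `[0, π]`. -/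
def gelfandPairing (f : ℝ → Fin 2 → ℂ) (t : ℂ) (y : ℝ → Fin 2 → ℂ) : ℂ :=
  pairing (gelfand f t) y Real.pi

/-- The product of the expansion term with `F'(mu)`, written through the fundamental system; unlike
the expansion term it depends continuously on `(mu, t)` everywhere. -/
def residueTerm (p q : ℝ → ℂ) (f : ℝ → Fin 2 → ℂ) (x : ℝ) (mu t : ℂ) : Fin 2 → ℂ :=
  ∑ i, (∑ j, residueMatrix p q mu t i j * gelfandPairing f t (fundSol p q mu j)) •
    fundSol p q mu i x

namespace BoundedPotential

lemma continuousOn_fundSol (hpq : BoundedPotential p q) (mu : ℂ) (i : Fin 2) :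
    ContinuousOn (fundSol p q mu i) (Icc 0 Real.pi) := by
  fin_cases i
  exacts [(hpq.isSolution_cSol mu).continuousOn, (hpq.isSolution_sSol mu).continuousOn]

lemma deriv_discriminant_eq_sum (hpq : BoundedPotential p q) (mu t : ℂ) :
    deriv (discriminant p q) mu = ∑ i, ∑ j, residueMatrix p q mu t i j *
      pairing (fundSol p q mu i) (fundSol p q mu j) Real.pi := by
  rw [(hpq.hasDerivAt_discriminant mu).deriv]
  simp only [residueMatrix, monodromy, fundSol, J, Matrix.mul_apply, Matrix.sub_apply,
    Matrix.smul_apply, Matrix.one_apply, Matrix.of_apply, Fin.sum_univ_two, Matrix.cons_val_zero,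
    Matrix.cons_val_one, smul_eq_mul, pairing_comm (sSol p q mu) (cSol p q mu)]
  norm_num
  ring

end BoundedPotential

lemma IsSolution.eq_sum_fundSol (hpq : BoundedPotential p q) {mu : ℂ} {y : ℝ → Fin 2 → ℂ}
    (hy : IsSolution p q mu y) {x : ℝ} (hx : x ∈ Icc 0 Real.pi) :
    y x = ∑ i, y 0 i • fundSol p q mu i x := by
  rw [Fin.sum_univ_two]
  exact hy.eq_smul_add_smul hpq hx

lemma IsSolution.monodromy_mulVec (hpq : BoundedPotential p q) {mu : ℂ} {y : ℝ → Fin 2 → ℂ}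
    (hy : IsSolution p q mu y) : monodromy p q mu *ᵥ y 0 = y Real.pi := by
  ext i
  simp [hy.eq_sum_fundSol hpq ⟨Real.pi_pos.le, le_rfl⟩, monodromy, Matrix.mulVec, dotProduct,
    Finset.sum_apply, mul_comm]

lemma pairing_eq_sum {ι : Type*} [Fintype ι] {u w : ℝ → Fin 2 → ℂ} {φ : ι → ℝ → Fin 2 → ℂ}
    {b : ι → ℂ} (hu : ContinuousOn u (Icc 0 Real.pi))
    (hφ : ∀ i, ContinuousOn (φ i) (Icc 0 Real.pi))
    (hw : ∀ x ∈ Icc 0 Real.pi, w x = ∑ i, b i • φ i x) :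
    pairing u w Real.pi = ∑ i, b i * pairing u (φ i) Real.pi := by
  have hint : ∀ i, IntervalIntegrable (fun s => u s 0 * φ i s 0 + u s 1 * φ i s 1)
      volume 0 Real.pi := fun i => by
    refine ContinuousOn.intervalIntegrable ?_
    rw [uIcc_of_le Real.pi_pos.le]
    have hu' := continuousOn_pi.1 hu
    have hφ' := continuousOn_pi.1 (hφ i)
    exact ((hu' 0).mul (hφ' 0)).add ((hu' 1).mul (hφ' 1))
  simp only [pairing, ← intervalIntegral.integral_const_mul]
  rw [← intervalIntegral.integral_finsetSum fun i _ => (hint i).const_mul (b i)]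
  refine intervalIntegral.integral_congr fun s hs => ?_
  rw [uIcc_of_le Real.pi_pos.le] at hs
  simp only [hw s hs, Finset.sum_apply, Pi.smul_apply, smul_eq_mul, Finset.mul_sum,
    ← Finset.sum_add_distrib]
  exact Finset.sum_congr rfl fun i _ => by ring

lemma exists_finset_gelfand_eq_sum {f : ℝ → Fin 2 → ℂ} (hfc : HasCompactSupport f) :
    ∃ s : Finset ℤ, ∀ (t : ℂ), ∀ x ∈ Icc 0 Real.pi, gelfand f t x =
      ∑ k ∈ s, Complex.exp (-(Complex.I * k * Real.pi * t)) • f (x + k * Real.pi) := by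
  obtain ⟨R, hR⟩ := hfc.isCompact.isBounded.subset_closedBall 0
  obtain ⟨N, hN⟩ := exists_nat_gt (R / Real.pi + 1)
  refine ⟨Finset.Icc (-N : ℤ) N, fun t x hx => tsum_eq_sum fun k hk => ?_⟩
  suffices f (x + k * Real.pi) = 0 by rw [this, smul_zero]
  by_contra hne
  have hle : |x + k * Real.pi| ≤ R := by
    simpa using hR (subset_tsupport f hne)
  have hkR : |(k : ℝ)| * Real.pi ≤ R + Real.pi := by
    calc |(k : ℝ)| * Real.pi = |(x + k * Real.pi) - x| := by
          rw [add_sub_cancel_left, abs_mul, abs_of_pos Real.pi_pos]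
      _ ≤ |x + k * Real.pi| + |x| := abs_sub _ _
      _ ≤ R + Real.pi := add_le_add hle (abs_le.2 ⟨by linarith [hx.1, hx.2], hx.2⟩)
  have hkN : |(k : ℝ)| ≤ N := by
    refine ((le_div_iff₀ Real.pi_pos).2 hkR).trans ?_
    rw [add_div, div_self Real.pi_ne_zero]
    exact hN.le
  exact hk (Finset.mem_Icc.2 (abs_le.1 (by exact_mod_cast hkN)))

lemma continuous_gelfand_clamp {f : ℝ → Fin 2 → ℂ} (hf : Continuous f)
    (hfc : HasCompactSupport f) : Continuous fun z : ℂ × ℝ => gelfand f z.1 (clamp z.2) := by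
  obtain ⟨s, hs⟩ := exists_finset_gelfand_eq_sum hfc
  simp only [hs _ _ (clamp_mem _)]
  have := continuous_clamp
  fun_prop

lemma continuousOn_gelfand {f : ℝ → Fin 2 → ℂ} (hf : Continuous f)
    (hfc : HasCompactSupport f) (t : ℂ) : ContinuousOn (gelfand f t) (Icc 0 Real.pi) :=
  ((continuous_gelfand_clamp hf hfc).comp (Continuous.prodMk_right t)).continuousOn.congr
    fun x hx => by simp only [Function.comp_apply, clamp_of_mem hx]

lemma multiplier_conj (t : ℂ) : conj (multiplier (conj t)) = (multiplier t)⁻¹ := by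
  rw [inv_multiplier, multiplier, multiplier, ← Complex.exp_conj]
  simp

lemma multiplier_ne_inv {t : ℂ} (ht : ∀ n : ℤ, t ≠ n) : multiplier t ≠ (multiplier t)⁻¹ := by
  rw [inv_multiplier, multiplier, multiplier, Ne, Complex.exp_eq_exp_iff_exists_int]
  rintro ⟨n, hn⟩
  have hpi : (Real.pi : ℂ) ≠ 0 := by exact_mod_cast Real.pi_ne_zero
  refine ht n (mul_left_cancel₀ (mul_ne_zero (mul_ne_zero two_ne_zero Complex.I_ne_zero) hpi) ?_)
  linear_combination hn

theorem BoundedPotential.continuous_residueTerm (hpq : BoundedPotential p q)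
    {f : ℝ → Fin 2 → ℂ} (hf : Continuous f) (hfc : HasCompactSupport f) {x : ℝ}
    (hx : x ∈ Icc 0 Real.pi) : Continuous fun z : ℂ × ℂ => residueTerm p q f x z.1 z.2 := by
  have hpi : Real.pi ∈ Icc 0 Real.pi := ⟨Real.pi_pos.le, le_rfl⟩
  have hfund : ∀ i, ∀ x ∈ Icc 0 Real.pi, Continuous fun z : ℂ × ℂ => fundSol p q z.1 i x := by
    intro i x hx
    fin_cases i
    exacts [(hpq.continuous_solution_apply _ hx).comp continuous_fst,
      (hpq.continuous_solution_apply _ hx).comp continuous_fst]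
  have hgelfand : ∀ i, Continuous fun z : ℂ × ℂ => gelfandPairing f z.2 (fundSol p q z.1 i) := by
    intro i
    refine continuous_pairing_of_continuous_clamp (y := fun z : ℂ × ℂ => gelfand f z.2)
      (z := fun z => fundSol p q z.1 i) ((continuous_gelfand_clamp hf hfc).comp
      ((continuous_snd.comp continuous_fst).prodMk continuous_snd)) ?_ hpi
    fin_cases i
    exacts [(hpq.continuous_solution_clamp _).comp (continuous_fst.fst.prodMk continuous_snd),
      (hpq.continuous_solution_clamp _).comp (continuous_fst.fst.prodMk continuous_snd)]
  have hmultiplier : Continuous fun z : ℂ × ℂ => (multiplier z.2)⁻¹ :=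
    Continuous.inv₀ (by unfold multiplier; fun_prop) fun z => multiplier_ne_zero z.2
  have hmatrix : Continuous fun z : ℂ × ℂ => residueMatrix p q z.1 z.2 :=
    ((hmultiplier.smul continuous_const).sub (continuous_matrix fun i j =>
      (continuous_apply i).comp (hfund j _ hpi))).matrix_mul continuous_const
  exact continuous_finsetSum _ fun i _ => (continuous_finsetSum _ fun j _ =>
    (hmatrix.matrix_elem i j).mul (hgelfand j)).smul (hfund i x hx)

lemma IsNormalizedEigenfunction.apply_zero_ne_zero (hpq : BoundedPotential p q) {t mu : ℂ}
    {y : ℝ → Fin 2 → ℂ} (hy : IsNormalizedEigenfunction p q t mu y) : y 0 ≠ 0 := by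
  intro hzero
  have hnorm := hy.norm_eq
  rw [intervalIntegral.integral_congr (g := fun _ => (0 : ℝ)) fun x hx => ?_] at hnorm
  · simp at hnorm
  · rw [uIcc_of_le Real.pi_pos.le] at hx
    simp [hy.sol.eq_smul_add_smul hpq hx, hzero]

lemma BoundedPotential.conj (hpq : BoundedPotential p q) :
    BoundedPotential (fun x => conj (p x)) (fun x => conj (q x)) where
  intervalIntegrable_p := ⟨Complex.conjCLE.toContinuousLinearMap.integrable_comp
    hpq.intervalIntegrable_p.1, Complex.conjCLE.toContinuousLinearMap.integrable_comp
    hpq.intervalIntegrable_p.2⟩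
  intervalIntegrable_q := ⟨Complex.conjCLE.toContinuousLinearMap.integrable_comp
    hpq.intervalIntegrable_q.1, Complex.conjCLE.toContinuousLinearMap.integrable_comp
    hpq.intervalIntegrable_q.2⟩
  bound_p := by simpa only [RCLike.norm_conj] using hpq.bound_p
  bound_q := by simpa only [RCLike.norm_conj] using hpq.bound_q

lemma ip_eq_pairing (u v : ℝ → Fin 2 → ℂ) :
    ip u v = pairing u (fun x i => conj (v x i)) Real.pi := by
  simp only [ip, pairing, Fin.sum_univ_two]

/-- The conjugate of an adjoint eigenfunction solves the original equation with the inverse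
multiplier, so the two initial values are eigenvectors of the monodromy matrix for distinct
eigenvalues. -/
lemma exists_residueMatrix_eq_smul_vecMulVec (hpq : BoundedPotential p q) {t mu : ℂ}
    {psi psiStar : ℝ → Fin 2 → ℂ} (hpsi : IsNormalizedEigenfunction p q t mu psi)
    (hstar : IsNormalizedEigenfunction (fun x => conj (p x)) (fun x => conj (q x))
      (conj t) (conj mu) psiStar) (ht : multiplier t ≠ (multiplier t)⁻¹) :
    ∃ r : ℂ, residueMatrix p q mu t =
      r • Matrix.vecMulVec (psi 0) (fun i => conj (psiStar 0 i)) := by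
  refine exists_eq_smul_vecMulVec_of_mulVec_eq_smul ht (hpsi.apply_zero_ne_zero hpq) ?_ ?_ ?_
  · simpa [funext_iff] using hstar.apply_zero_ne_zero hpq.conj
  · rw [hpsi.sol.monodromy_mulVec hpq, hpsi.bdry]
  · rw [hstar.sol.conj.monodromy_mulVec hpq, hstar.bdry]
    ext i
    simp only [Pi.smul_apply, smul_eq_mul, map_mul, multiplier_conj]

theorem expansionTerm_eq (hpq : BoundedPotential p q) {f : ℝ → Fin 2 → ℂ} (hf : Continuous f)
    (hfc : HasCompactSupport f) {x : ℝ} (hx : x ∈ Icc 0 Real.pi) {t mu : ℂ}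
    {psi psiStar : ℝ → Fin 2 → ℂ} (hpsi : IsNormalizedEigenfunction p q t mu psi)
    (hstar : IsNormalizedEigenfunction (fun x => conj (p x)) (fun x => conj (q x))
      (conj t) (conj mu) psiStar)
    (ht : multiplier t ≠ (multiplier t)⁻¹) (hmu : deriv (discriminant p q) mu ≠ 0) :
    expansionTerm f t psi psiStar x =
      (deriv (discriminant p q) mu)⁻¹ • residueTerm p q f x mu t := by
  obtain ⟨r, hr⟩ := exists_residueMatrix_eq_smul_vecMulVec hpq hpsi hstar ht
  set φ := fundSol p q mu
  set w : Fin 2 → ℂ := fun i => conj (psiStar 0 i)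
  have hφ := hpq.continuousOn_fundSol mu
  have hpsi_sum : ∀ s ∈ Icc 0 Real.pi, psi s = ∑ i, psi 0 i • φ i s :=
    fun s hs => hpsi.sol.eq_sum_fundSol hpq hs
  have hstar_sum : ∀ s ∈ Icc 0 Real.pi, (fun i => conj (psiStar s i)) = ∑ i, w i • φ i s :=
    fun s hs => hstar.sol.conj.eq_sum_fundSol hpq hs
  have hip : ∀ {u}, ContinuousOn u (Icc 0 Real.pi) →
      ip u psiStar = ∑ j, w j * pairing u (φ j) Real.pi := fun hu => by
    rw [ip_eq_pairing, pairing_eq_sum hu hφ hstar_sum]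
  have hpairing : ∀ j, pairing psi (φ j) Real.pi =
      ∑ i, psi 0 i * pairing (φ i) (φ j) Real.pi := fun j => by
    rw [pairing_comm, pairing_eq_sum (hφ j) hφ hpsi_sum]
    simp only [pairing_comm (φ j), φ]
  have hderiv : deriv (discriminant p q) mu = r * ip psi psiStar := by
    rw [hpq.deriv_discriminant_eq_sum mu t, hr, hip hpsi.sol.continuousOn]
    simp only [hpairing, Finset.mul_sum, Matrix.smul_apply, Matrix.vecMulVec_apply, smul_eq_mul]
    rw [Finset.sum_comm]
    exact Finset.sum_congr rfl fun j _ => Finset.sum_congr rfl fun i _ => by ring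
  have hresidue : residueTerm p q f x mu t = r • (ip (gelfand f t) psiStar) • psi x := by
    rw [residueTerm, hr, hpsi_sum x hx, hip (continuousOn_gelfand hf hfc t)]
    simp only [Finset.smul_sum, smul_smul, Matrix.smul_apply, Matrix.vecMulVec_apply, smul_eq_mul,
      Finset.sum_mul, gelfandPairing, Finset.sum_smul]
    refine Finset.sum_congr rfl fun i _ => Finset.sum_congr rfl fun j _ => ?_
    congr 1
    ring
  have hr_ne : r ≠ 0 := fun h => hmu (by rw [hderiv, h, zero_mul])
  rw [expansionTerm, hresidue, hderiv, smul_smul, smul_smul, mul_inv]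
  congr 1
  field_simp

theorem IsBlochSystem.expansionTerm_eq (hpq : BoundedPotential p q) {S : Set ℂ}
    {lam : ℤ → Fin 2 → ℂ → ℂ} {Psi PsiStar : ℤ → Fin 2 → ℂ → ℝ → Fin 2 → ℂ}
    (hB : IsBlochSystem p q S lam Psi PsiStar) {f : ℝ → Fin 2 → ℂ} (hf : Continuous f)
    (hfc : HasCompactSupport f) {x : ℝ} (hx : x ∈ Icc 0 Real.pi) (k : ℤ) (j : Fin 2) {t : ℂ}
    (htS : t ∈ S) (ht : ∀ n : ℤ, t ≠ n) (h' : deriv (discriminant p q) (lam k j t) ≠ 0) :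
    expansionTerm f t (Psi k j t) (PsiStar k j t) x =
      (deriv (discriminant p q) (lam k j t))⁻¹ • residueTerm p q f x (lam k j t) t := by
  have hsimple := hpq.multiplicity_eq_one (hB.charDet_eq_zero k j htS) h'
  exact Dirac.expansionTerm_eq hpq hf hfc hx (hB.eigen k j t htS hsimple)
    (hB.eigenStar k j t htS hsimple) (multiplier_ne_inv ht) h'

lemma IsSolution.norm_apply_zero_le (hpq : BoundedPotential p q) {mu : ℂ} {y : ℝ → Fin 2 → ℂ}
    (hy : IsSolution p q mu y) {B x : ℝ} (hx : x ∈ Icc 0 Real.pi) (hc : ‖cSol p q mu x‖ ≤ B)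
    (hs : ‖sSol p q mu x‖ ≤ B) : ‖y 0‖ ≤ 2 * B * ‖y x‖ := by
  have hB : 0 ≤ B := (norm_nonneg _).trans hc
  have hterm : ∀ (w : Fin 2 → ℂ) (i j : Fin 2), ‖w‖ ≤ B → ‖w i * y x j‖ ≤ B * ‖y x‖ :=
    fun w i j hw => norm_mul_le_of_le ((norm_le_pi_norm w i).trans hw) (norm_le_pi_norm _ j)
  have hwronskian : ∀ w : Fin 2 → ℂ, ‖w‖ ≤ B → ‖w 0 * y x 1 - w 1 * y x 0‖ ≤ 2 * B * ‖y x‖ :=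
    fun w hw => (norm_sub_le_of_le (hterm w 0 1 hw) (hterm w 1 0 hw)).trans_eq (by ring)
  have hcy := (hpq.isSolution_cSol mu).lagrange_identity hy hx
  have hsy := (hpq.isSolution_sSol mu).lagrange_identity hy hx
  simp only [hpq.cSol_zero, hpq.sSol_zero, sub_self, zero_mul, add_zero, one_mul, sub_zero,
    zero_sub, Matrix.cons_val_zero, Matrix.cons_val_one] at hcy hsy
  rw [pi_norm_le_iff_of_nonneg (by positivity), Fin.forall_fin_two, ← hcy, ← norm_neg (y 0 0),
    ← hsy]
  exact ⟨hwronskian _ hs, hwronskian _ hc⟩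

lemma sq_norm_le_sum_sq_norm {ι : Type*} [Fintype ι] {E : Type*} [SeminormedAddCommGroup E]
    (v : ι → E) : ‖v‖ ^ 2 ≤ ∑ i, ‖v i‖ ^ 2 := by
  have hsum : 0 ≤ ∑ i, ‖v i‖ ^ 2 := Finset.sum_nonneg fun i _ => sq_nonneg _
  refine (Real.le_sqrt (norm_nonneg v) hsum).1 ((pi_norm_le_iff_of_nonneg (Real.sqrt_nonneg _)).2
    fun i => (Real.le_sqrt (norm_nonneg _) hsum).2 ?_)
  exact Finset.single_le_sum (f := fun i => ‖v i‖ ^ 2) (fun i _ => sq_nonneg _) (Finset.mem_univ i)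

lemma IsNormalizedEigenfunction.norm_apply_zero_le {t : ℝ} {mu : ℂ} {y : ℝ → Fin 2 → ℂ}
    (hy : IsNormalizedEigenfunction p q t mu y) {C : ℝ} (hC : 0 ≤ C)
    (h : ∀ s ∈ Icc 0 Real.pi, ‖y 0‖ ≤ C * ‖y s‖) : ‖y 0‖ ≤ C := by
  have hcont : ContinuousOn
      (fun s : ℝ => C ^ 2 * ∑ i, ‖Complex.exp (-(Complex.I * t * s)) * y s i‖ ^ 2)
      (Icc 0 Real.pi) :=
    continuousOn_const.mul (continuousOn_finsetSum _ fun i _ =>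
      ((Continuous.continuousOn (by fun_prop)).mul
        (continuousOn_pi.1 hy.sol.continuousOn i)).norm.pow 2)
  have hpointwise : ∀ s ∈ Icc 0 Real.pi, ‖y 0‖ ^ 2 ≤
      C ^ 2 * ∑ i, ‖Complex.exp (-(Complex.I * t * s)) * y s i‖ ^ 2 := fun s hs => by
    have hexp : ‖Complex.exp (-(Complex.I * t * s))‖ = 1 := by simp [Complex.norm_exp]
    simp only [norm_mul, hexp, one_mul]
    calc ‖y 0‖ ^ 2 ≤ (C * ‖y s‖) ^ 2 := pow_le_pow_left₀ (norm_nonneg _) (h s hs) 2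
      _ = C ^ 2 * ‖y s‖ ^ 2 := mul_pow _ _ _
      _ ≤ _ := by gcongr; exact sq_norm_le_sum_sq_norm _
  have hintegral := intervalIntegral.integral_mono_on Real.pi_pos.le
    (intervalIntegrable_const (μ := volume)) (hcont.intervalIntegrable_of_Icc Real.pi_pos.le)
    hpointwise
  rw [intervalIntegral.integral_const_mul, hy.norm_eq, intervalIntegral.integral_const, sub_zero,
    smul_eq_mul, mul_one] at hintegral
  refine le_of_sq_le_sq (le_trans ?_ hintegral) hC
  exact le_mul_of_one_le_left (sq_nonneg _) (by linarith [Real.pi_gt_three])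

theorem BoundedPotential.exists_norm_eigenfunction_le (hpq : BoundedPotential p q) (R : ℝ) :
    ∃ C, ∀ (t : ℝ) (mu : ℂ) (y : ℝ → Fin 2 → ℂ), ‖mu‖ ≤ R →
      IsNormalizedEigenfunction p q t mu y → ∀ x ∈ Icc 0 Real.pi, ‖y x‖ ≤ C := by
  obtain ⟨B, hB, hfund⟩ := hpq.exists_norm_fundamental_le R
  obtain ⟨D, hD, hsol⟩ := hpq.exists_norm_solution_le_of_norm_le R
  refine ⟨2 * B * D, fun t mu y hmu hy x hx => (hsol mu hmu y hy.sol x hx).trans ?_⟩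
  gcongr
  exact hy.norm_apply_zero_le (by positivity) fun s hs =>
    hy.sol.norm_apply_zero_le hpq hs (hfund mu hmu s hs).1 (hfund mu hmu s hs).2

end Expansion

section Asymptotics

lemma absolutelyContinuousOnInterval_exp (c : ℂ) (a b : ℝ) :
    AbsolutelyContinuousOnInterval (fun x : ℝ => Complex.exp (c * x)) a b := by
  refine (ContDiff.contDiffOn ?_).absolutelyContinuousOnInterval
  have : ContDiff ℝ 1 (fun x : ℝ => (x : ℂ)) := Complex.ofRealCLM.contDiff
  fun_prop

lemma hasDerivAt_exp_mul_ofReal (c : ℂ) (x : ℝ) :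
    HasDerivAt (fun r : ℝ => Complex.exp (c * r)) (c * Complex.exp (c * x)) x := by
  simpa only [add_zero] using hasDerivAt_exp_mul_ofReal_add c 0 x

lemma integral_mul_eq_of_absolutelyContinuous {k W W' : ℝ → ℂ} {a b : ℝ}
    (hk : IntervalIntegrable k volume a b) (hW : AbsolutelyContinuousOnInterval W a b)
    (hW' : ∀ᵐ s, s ∈ uIcc a b → HasDerivAt W (W' s) s) (hW'i : IntervalIntegrable W' volume a b) :
    ∫ s in a..b, k s * W s =
      (∫ r in a..b, k r) * W a + ∫ s in a..b, (∫ r in s..b, k r) * W' s := by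
  have hprim : ∀ s ∈ uIcc a b,
      (∫ r in a..b, k r) - ∫ r in a..s, k r = ∫ r in s..b, k r := fun s hs =>
    intervalIntegral.integral_interval_sub_left hk
      (hk.mono_set (uIcc_subset_uIcc left_mem_uIcc hs))
  set P : ℝ → ℂ := fun s => (∫ r in a..b, k r) - ∫ r in a..s, k r
  have hP : AbsolutelyContinuousOnInterval P a b :=
    (ContDiffOn.absolutelyContinuousOnInterval contDiffOn_const).sub
      (absolutelyContinuousOnInterval_integral hk)
  have hkW : IntervalIntegrable (fun s => k s * W s) volume a b :=
    hk.mul_continuousOn hW.continuousOn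
  have hPW' : IntervalIntegrable (fun s => P s * W' s) volume a b :=
    hW'i.continuousOn_mul hP.continuousOn
  have hderiv : ∀ᵐ s, s ∈ uIcc a b →
      HasDerivAt (fun s => P s * W s) (-(k s * W s) + P s * W' s) s := by
    filter_upwards [hk.ae_hasDerivAt_integral, hW'] with s h1 h2 hs
    exact (((h1 hs a left_mem_uIcc).const_sub _).mul (h2 hs)).congr_deriv (by ring)
  have key := eq_add_integral_of_absolutelyContinuous (hP.smul hW) hderiv
    (hkW.neg.add hPW') right_mem_uIcc
  have hsplit : ∫ s in a..b, (-(k s * W s) + P s * W' s) =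
      -(∫ s in a..b, k s * W s) + ∫ s in a..b, P s * W' s := by
    rw [← intervalIntegral.integral_neg]
    exact intervalIntegral.integral_add hkW.neg hPW'
  rw [← intervalIntegral.integral_congr fun s hs => congrArg (· * W' s) (hprim s hs)]
  simp only [hsplit, P, smul_eq_mul, Pi.mul_apply, sub_self, zero_mul,
    intervalIntegral.integral_same, sub_zero] at key
  linear_combination key

lemma norm_integral_mul_le_of_norm_integral_le {k W W' : ℝ → ℂ} {a b η A : ℝ} (hab : a ≤ b)
    (hk : IntervalIntegrable k volume a b) (hη : ∀ s ∈ Icc a b, ‖∫ r in s..b, k r‖ ≤ η)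
    (hW : AbsolutelyContinuousOnInterval W a b)
    (hW' : ∀ᵐ s, s ∈ uIcc a b → HasDerivAt W (W' s) s) (hW'i : IntervalIntegrable W' volume a b)
    (hA : ∀ s ∈ Icc a b, ‖W' s‖ ≤ A) :
    ‖∫ s in a..b, k s * W s‖ ≤ η * (‖W a‖ + A * (b - a)) := by
  have hη_nonneg : 0 ≤ η := (norm_nonneg _).trans (hη a ⟨le_rfl, hab⟩)
  have hint : ‖∫ s in a..b, (∫ r in s..b, k r) * W' s‖ ≤ η * A * |b - a| := by
    refine intervalIntegral.norm_integral_le_of_norm_le_const fun s hs => ?_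
    have hs' : s ∈ Icc a b := Ioc_subset_Icc_self (uIoc_of_le hab ▸ hs)
    rw [norm_mul]
    exact mul_le_mul (hη s hs') (hA s hs') (norm_nonneg _) hη_nonneg
  rw [abs_of_nonneg (sub_nonneg.2 hab)] at hint
  rw [integral_mul_eq_of_absolutelyContinuous hk hW hW' hW'i, mul_add, ← mul_assoc]
  refine (norm_add_le _ _).trans (add_le_add ?_ hint)
  rw [norm_mul]
  exact mul_le_mul_of_nonneg_right (hη a ⟨le_rfl, hab⟩) (norm_nonneg _)

/-- Integrable coefficients on `[0, ℓ]` bounded by `K`, for the off-diagonal entries of a first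
order `2 × 2` system. -/
structure BoundedCoeffPair (a b : ℝ → ℂ) (ℓ K : ℝ) : Prop where
  integrable_left : IntervalIntegrable a volume 0 ℓ
  integrable_right : IntervalIntegrable b volume 0 ℓ
  norm_left_le : ∀ x ∈ Icc 0 ℓ, ‖a x‖ ≤ K
  norm_right_le : ∀ x ∈ Icc 0 ℓ, ‖b x‖ ≤ K

/-- The system `U' = cU + aW`, `W' = bU` on `[0, ℓ]`. It is the Zakharov–Shabat system
`u' = iλu + aw`, `w' = -iλw + bu` rescaled by `e^{iλx}`, with `c = 2iλ`; for `Re c ≤ 0` its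
solutions are bounded uniformly in `c`. -/
structure IsRescaledSolution (a b : ℝ → ℂ) (c : ℂ) (ℓ : ℝ) (U W : ℝ → ℂ) : Prop where
  ac_left : AbsolutelyContinuousOnInterval U 0 ℓ
  ac_right : AbsolutelyContinuousOnInterval W 0 ℓ
  deriv_left : ∀ᵐ x, x ∈ uIcc 0 ℓ → HasDerivAt U (c * U x + a x * W x) x
  deriv_right : ∀ᵐ x, x ∈ uIcc 0 ℓ → HasDerivAt W (b x * U x) x

variable {a b : ℝ → ℂ} {c : ℂ} {ℓ K : ℝ} {U W : ℝ → ℂ}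

lemma BoundedCoeffPair.swap (hab : BoundedCoeffPair a b ℓ K) : BoundedCoeffPair b a ℓ K :=
  ⟨hab.integrable_right, hab.integrable_left, hab.norm_right_le, hab.norm_left_le⟩

lemma norm_exp_mul_le_one (hc : c.re ≤ 0) {x : ℝ} (hx : 0 ≤ x) : ‖Complex.exp (c * x)‖ ≤ 1 := by
  rw [Complex.norm_exp, Real.exp_le_one_iff, Complex.re_mul_ofReal]
  exact mul_nonpos_of_nonpos_of_nonneg hc hx

lemma norm_exp_mul_sub_le_one (hc : c.re ≤ 0) {s x : ℝ} (hsx : s ≤ x) :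
    ‖Complex.exp (-c * s + c * x)‖ ≤ 1 := by
  convert norm_exp_mul_le_one hc (sub_nonneg.2 hsx) using 3
  push_cast
  ring

namespace IsRescaledSolution

lemma right_eq (h : IsRescaledSolution a b c ℓ U W) (hb : IntervalIntegrable b volume 0 ℓ)
    {x : ℝ} (hx : x ∈ uIcc 0 ℓ) : W x = W 0 + ∫ s in 0..x, b s * U s :=
  eq_add_integral_of_absolutelyContinuous h.ac_right h.deriv_right
    (hb.mul_continuousOn h.ac_left.continuousOn) hx

lemma left_eq (h : IsRescaledSolution a b c ℓ U W) (ha : IntervalIntegrable a volume 0 ℓ)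
    {x : ℝ} (hx : x ∈ uIcc 0 ℓ) :
    U x = Complex.exp (c * x) * U 0 +
      ∫ s in 0..x, Complex.exp (-c * s + c * x) * a s * W s := by
  have hderiv : ∀ᵐ s, s ∈ uIcc 0 ℓ → HasDerivAt (fun s : ℝ => Complex.exp (-c * s) * U s)
      (Complex.exp (-c * s) * (a s * W s)) s := by
    filter_upwards [h.deriv_left] with s hs hsℓ
    exact ((hasDerivAt_exp_mul_ofReal (-c) s).mul (hs hsℓ)).congr_deriv (by ring)
  have key := eq_add_integral_of_absolutelyContinuous
    ((absolutelyContinuousOnInterval_exp (-c) 0 ℓ).smul h.ac_left) hderiv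
    ((ha.mul_continuousOn h.ac_right.continuousOn).continuousOn_mul
      (Continuous.continuousOn (by fun_prop))) hx
  simp only [smul_eq_mul, Pi.mul_apply, Complex.ofReal_zero, mul_zero, Complex.exp_zero,
    one_mul] at key
  calc U x = Complex.exp (c * x) * (Complex.exp (-c * x) * U x) := by
        rw [← mul_assoc, ← Complex.exp_add, neg_mul, add_neg_cancel, Complex.exp_zero, one_mul]
    _ = _ := by
        rw [key, mul_add, ← intervalIntegral.integral_const_mul]
        simp only [Complex.exp_add, mul_assoc, mul_left_comm]

lemma norm_left_le_integral (h : IsRescaledSolution a b c ℓ U W)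
    (hab : BoundedCoeffPair a b ℓ K) (hc : c.re ≤ 0) {x : ℝ} (hx : x ∈ Icc 0 ℓ) :
    ‖U x‖ ≤ ‖U 0‖ + K * ∫ s in 0..x, ‖W s‖ := by
  have hxℓ : uIcc 0 x ⊆ uIcc 0 ℓ := uIcc_subset_uIcc_left (Icc_subset_uIcc hx)
  rw [h.left_eq hab.integrable_left (Icc_subset_uIcc hx), ← intervalIntegral.integral_const_mul]
  refine (norm_add_le _ _).trans (add_le_add ?_ ?_)
  · rw [norm_mul]
    exact mul_le_of_le_one_left (norm_nonneg _) (norm_exp_mul_le_one hc hx.1)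
  · refine intervalIntegral.norm_integral_le_of_norm_le hx.1
      (Eventually.of_forall fun s hs => ?_)
      ((h.ac_right.continuousOn.mono hxℓ).norm.intervalIntegrable.const_mul K)
    rw [norm_mul, norm_mul]
    exact mul_le_mul_of_nonneg_right ((mul_le_of_le_one_left (norm_nonneg _)
      (norm_exp_mul_sub_le_one hc hs.2)).trans
        (hab.norm_left_le s ⟨hs.1.le, hs.2.trans hx.2⟩)) (norm_nonneg _)

lemma norm_right_le_integral (h : IsRescaledSolution a b c ℓ U W)
    (hab : BoundedCoeffPair a b ℓ K) {x : ℝ} (hx : x ∈ Icc 0 ℓ) :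
    ‖W x‖ ≤ ‖W 0‖ + K * ∫ s in 0..x, ‖U s‖ := by
  have hxℓ : uIcc 0 x ⊆ uIcc 0 ℓ := uIcc_subset_uIcc_left (Icc_subset_uIcc hx)
  rw [h.right_eq hab.integrable_right (Icc_subset_uIcc hx), ← intervalIntegral.integral_const_mul]
  refine (norm_add_le _ _).trans (add_le_add_right
    (intervalIntegral.norm_integral_le_of_norm_le hx.1 (Eventually.of_forall fun s hs => ?_)
      ((h.ac_left.continuousOn.mono hxℓ).norm.intervalIntegrable.const_mul K)) _)
  rw [norm_mul]
  exact mul_le_mul_of_nonneg_right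
    (hab.norm_right_le s ⟨hs.1.le, hs.2.trans hx.2⟩) (norm_nonneg _)

lemma norm_add_norm_le (h : IsRescaledSolution a b c ℓ U W) (hab : BoundedCoeffPair a b ℓ K)
    (hc : c.re ≤ 0) {x : ℝ} (hx : x ∈ Icc 0 ℓ) :
    ‖U x‖ + ‖W x‖ ≤ (‖U 0‖ + ‖W 0‖) * Real.exp (K * ℓ) := by
  have hK : 0 ≤ K := (norm_nonneg _).trans (hab.norm_left_le x hx)
  have hcont : ContinuousOn (fun x => ‖U x‖ + ‖W x‖) (Icc 0 ℓ) :=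
    (h.ac_left.continuousOn.norm.add h.ac_right.continuousOn.norm).mono Icc_subset_uIcc
  have hintegral : ∀ x ∈ Icc 0 ℓ,
      ‖U x‖ + ‖W x‖ ≤ ‖U 0‖ + ‖W 0‖ + K * ∫ s in 0..x, (‖U s‖ + ‖W s‖) := fun x hx => by
    have hxℓ : uIcc 0 x ⊆ uIcc 0 ℓ := uIcc_subset_uIcc_left (Icc_subset_uIcc hx)
    rw [intervalIntegral.integral_add (h.ac_left.continuousOn.mono hxℓ).norm.intervalIntegrable
      (h.ac_right.continuousOn.mono hxℓ).norm.intervalIntegrable]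
    linarith [h.norm_left_le_integral hab hc hx, h.norm_right_le_integral hab hx]
  calc ‖U x‖ + ‖W x‖ ≤ (‖U 0‖ + ‖W 0‖) * Real.exp (K * (x - 0)) :=
        le_mul_exp_of_le_add_integral hcont hK hintegral hx
    _ ≤ (‖U 0‖ + ‖W 0‖) * Real.exp (K * ℓ) := by
        rw [sub_zero]
        have := hx.2
        gcongr

-- `W` varies slowly, so integrating by parts moves the smallness of the oscillating integrals of
-- `a` onto `∫ e^{c(x-s)} a W`.
lemma norm_left_sub_le (h : IsRescaledSolution a b c ℓ U W) (hab : BoundedCoeffPair a b ℓ K)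
    (hc : c.re ≤ 0) {x η : ℝ} (hx : x ∈ Icc 0 ℓ)
    (hη : ∀ s ∈ Icc 0 x, ‖∫ r in s..x, Complex.exp (-c * r + c * x) * a r‖ ≤ η) :
    ‖U x - Complex.exp (c * x) * U 0‖ ≤
      η * ((1 + K * Real.exp (K * ℓ) * ℓ) * (‖U 0‖ + ‖W 0‖)) := by
  have hxℓ : uIcc 0 x ⊆ uIcc 0 ℓ := uIcc_subset_uIcc_left (Icc_subset_uIcc hx)
  have hK : 0 ≤ K := (norm_nonneg _).trans (hab.norm_left_le x hx)
  have hη_nonneg : 0 ≤ η := (norm_nonneg _).trans (hη 0 ⟨le_rfl, hx.1⟩)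
  have hbU : ∀ s ∈ Icc 0 x, ‖b s * U s‖ ≤ K * ((‖U 0‖ + ‖W 0‖) * Real.exp (K * ℓ)) :=
    fun s hs => by
      have hs' : s ∈ Icc 0 ℓ := ⟨hs.1, hs.2.trans hx.2⟩
      rw [norm_mul]
      exact mul_le_mul (hab.norm_right_le s hs')
        ((le_add_of_nonneg_right (norm_nonneg _)).trans (h.norm_add_norm_le hab hc hs'))
        (norm_nonneg _) hK
  rw [h.left_eq hab.integrable_left (Icc_subset_uIcc hx), add_sub_cancel_left]
  refine (norm_integral_mul_le_of_norm_integral_le hx.1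
    ((hab.integrable_left.mono_set hxℓ).continuousOn_mul
      (Continuous.continuousOn (by fun_prop))) hη (h.ac_right.mono hxℓ)
    (h.deriv_right.mono fun s hs hsx => hs (hxℓ hsx))
    ((hab.integrable_right.mul_continuousOn h.ac_left.continuousOn).mono_set hxℓ) hbU).trans ?_
  refine mul_le_mul_of_nonneg_left ?_ hη_nonneg
  have : K * ((‖U 0‖ + ‖W 0‖) * Real.exp (K * ℓ)) * (x - 0) ≤
      K * ((‖U 0‖ + ‖W 0‖) * Real.exp (K * ℓ)) * ℓ :=
    mul_le_mul_of_nonneg_left (by linarith [hx.2]) (by positivity)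
  linarith [norm_nonneg (U 0)]

lemma norm_right_sub_le (h : IsRescaledSolution a b c ℓ U W) (hab : BoundedCoeffPair a b ℓ K)
    (hℓ : 0 ≤ ℓ) {η δ : ℝ} (hη : ‖∫ s in 0..ℓ, Complex.exp (c * s) * b s‖ ≤ η)
    (hδ : ∀ x ∈ Icc 0 ℓ, ‖U x - Complex.exp (c * x) * U 0‖ ≤ δ) :
    ‖W ℓ - W 0‖ ≤ η * ‖U 0‖ + K * δ * ℓ := by
  have hK : 0 ≤ K := (norm_nonneg _).trans (hab.norm_left_le 0 ⟨le_rfl, hℓ⟩)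
  have hexp_cont : Continuous fun s : ℝ => Complex.exp (c * s) := by fun_prop
  have hrem_int : IntervalIntegrable (fun s => b s * (U s - Complex.exp (c * s) * U 0))
      volume 0 ℓ :=
    hab.integrable_right.mul_continuousOn
      (h.ac_left.continuousOn.sub (hexp_cont.mul continuous_const).continuousOn)
  have hsplit : ∫ s in 0..ℓ, b s * U s = (∫ s in 0..ℓ, Complex.exp (c * s) * b s) * U 0 +
      ∫ s in 0..ℓ, b s * (U s - Complex.exp (c * s) * U 0) := by
    rw [← intervalIntegral.integral_mul_const, ← intervalIntegral.integral_add
      ((hab.integrable_right.continuousOn_mul hexp_cont.continuousOn).mul_const _) hrem_int]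
    congr 1 with s
    ring
  have hrem : ‖∫ s in 0..ℓ, b s * (U s - Complex.exp (c * s) * U 0)‖ ≤ K * δ * |ℓ - 0| := by
    refine intervalIntegral.norm_integral_le_of_norm_le_const fun s hs => ?_
    have hs' : s ∈ Icc 0 ℓ := Ioc_subset_Icc_self (uIoc_of_le hℓ ▸ hs)
    rw [norm_mul]
    exact mul_le_mul (hab.norm_right_le s hs') (hδ s hs') (norm_nonneg _) hK
  rw [sub_zero, abs_of_nonneg hℓ] at hrem
  rw [h.right_eq hab.integrable_right right_mem_uIcc, add_sub_cancel_left, hsplit]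
  refine (norm_add_le _ _).trans (add_le_add ?_ hrem)
  rw [norm_mul]
  exact mul_le_mul_of_nonneg_right hη (norm_nonneg _)

end IsRescaledSolution

lemma BoundedCoeffPair.exists_rescaled_asymptotic (hab : BoundedCoeffPair a b ℓ K) (hℓ : 0 ≤ ℓ)
    {ε : ℝ} (hε : 0 < ε) :
    ∃ R, ∀ c : ℂ, c.re ≤ 0 → R ≤ ‖c‖ → ∀ U W, IsRescaledSolution a b c ℓ U W →
      ‖U ℓ - Complex.exp (c * ℓ) * U 0‖ ≤ ε * (‖U 0‖ + ‖W 0‖) ∧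
      ‖W ℓ - W 0‖ ≤ ε * (‖U 0‖ + ‖W 0‖) := by
  have hK : 0 ≤ K := (norm_nonneg _).trans (hab.norm_left_le 0 ⟨le_rfl, hℓ⟩)
  set L := 1 + K * Real.exp (K * ℓ) * ℓ
  have : 0 < L := by positivity
  obtain ⟨η, hη, hηε⟩ : ∃ η > 0, η * (L + 1 + K * L * ℓ) = ε :=
    ⟨ε / (L + 1 + K * L * ℓ), by positivity, div_mul_cancel₀ _ (by positivity)⟩
  obtain ⟨Ra, -, hRa⟩ := exists_norm_integral_exp_mul_le hℓ hη hab.integrable_left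
  obtain ⟨Rb, -, hRb⟩ := exists_norm_integral_exp_mul_le hℓ hη hab.integrable_right
  refine ⟨max Ra Rb, fun c hc hcR U W h => ?_⟩
  have hU : ∀ x ∈ Icc 0 ℓ,
      ‖U x - Complex.exp (c * x) * U 0‖ ≤ η * (L * (‖U 0‖ + ‖W 0‖)) := fun x hx =>
    h.norm_left_sub_le hab hc hx fun s hs => hRa (-c) (c * x)
      (by rw [norm_neg]; exact (le_max_left _ _).trans hcR) s x hs.1 hs.2 hx.2
      fun r hr => norm_exp_mul_sub_le_one hc hr.2
  have hb : ‖∫ s in 0..ℓ, Complex.exp (c * s) * b s‖ ≤ η := by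
    simpa only [add_zero] using hRb c 0 ((le_max_right _ _).trans hcR) 0 ℓ le_rfl hℓ le_rfl
      fun r hr => by simpa only [add_zero] using norm_exp_mul_le_one hc hr.1
  have hW := h.norm_right_sub_le hab hℓ hb hU
  have : 0 ≤ ‖U 0‖ + ‖W 0‖ := by positivity
  have h1 : 0 ≤ η * (1 + K * L * ℓ) * (‖U 0‖ + ‖W 0‖) := by positivity
  have h2 : 0 ≤ η * L * (‖U 0‖ + ‖W 0‖) := by positivity
  have h3 : 0 ≤ η * ‖W 0‖ := by positivity
  rw [← hηε]
  exact ⟨by linarith [hU ℓ ⟨hℓ, le_rfl⟩], by linarith⟩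

/-- The Zakharov–Shabat system `u' = iλu + aw`, `w' = -iλw + bu` on `[0, ℓ]`. -/
structure IsZSSolution (a b : ℝ → ℂ) (la : ℂ) (ℓ : ℝ) (u w : ℝ → ℂ) : Prop where
  ac_left : AbsolutelyContinuousOnInterval u 0 ℓ
  ac_right : AbsolutelyContinuousOnInterval w 0 ℓ
  deriv_left : ∀ᵐ x, x ∈ uIcc 0 ℓ → HasDerivAt u (Complex.I * la * u x + a x * w x) x
  deriv_right : ∀ᵐ x, x ∈ uIcc 0 ℓ → HasDerivAt w (-(Complex.I * la) * w x + b x * u x) x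

variable {la : ℂ} {u w : ℝ → ℂ}

lemma IsZSSolution.swap (h : IsZSSolution a b la ℓ u w) : IsZSSolution b a (-la) ℓ w u where
  ac_left := h.ac_right
  ac_right := h.ac_left
  deriv_left := h.deriv_right.mono fun _ hx hxℓ => (hx hxℓ).congr_deriv (by ring)
  deriv_right := h.deriv_left.mono fun _ hx hxℓ => (hx hxℓ).congr_deriv (by ring)

lemma IsZSSolution.rescale (h : IsZSSolution a b la ℓ u w) :
    IsRescaledSolution a b (2 * (Complex.I * la)) ℓ
      (fun x => Complex.exp (Complex.I * la * x) * u x)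
      (fun x => Complex.exp (Complex.I * la * x) * w x) where
  ac_left := (absolutelyContinuousOnInterval_exp (Complex.I * la) 0 ℓ).smul h.ac_left
  ac_right := (absolutelyContinuousOnInterval_exp (Complex.I * la) 0 ℓ).smul h.ac_right
  deriv_left := h.deriv_left.mono fun x hx hxℓ =>
    ((hasDerivAt_exp_mul_ofReal (Complex.I * la) x).mul (hx hxℓ)).congr_deriv (by ring)
  deriv_right := h.deriv_right.mono fun x hx hxℓ =>
    ((hasDerivAt_exp_mul_ofReal (Complex.I * la) x).mul (hx hxℓ)).congr_deriv (by ring)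

lemma BoundedCoeffPair.exists_zs_asymptotic_of_im_nonneg (hab : BoundedCoeffPair a b ℓ K)
    (hℓ : 0 ≤ ℓ) {ε : ℝ} (hε : 0 < ε) :
    ∃ R, ∀ la : ℂ, 0 ≤ la.im → R ≤ ‖la‖ → ∀ u w, IsZSSolution a b la ℓ u w →
      ‖u ℓ - Complex.exp (Complex.I * la * ℓ) * u 0‖ ≤
        Real.exp (ℓ * la.im) * (ε * (‖u 0‖ + ‖w 0‖)) ∧
      ‖w ℓ - Complex.exp (-(Complex.I * la * ℓ)) * w 0‖ ≤
        Real.exp (ℓ * la.im) * (ε * (‖u 0‖ + ‖w 0‖)) := by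
  obtain ⟨R, hR⟩ := hab.exists_rescaled_asymptotic hℓ hε
  refine ⟨R, fun la him hla u w h => ?_⟩
  have hc : (2 * (Complex.I * la)).re ≤ 0 := by simpa using him
  have hcR : R ≤ ‖2 * (Complex.I * la)‖ := by
    simp only [norm_mul, Complex.norm_ofNat, Complex.norm_I]
    linarith [norm_nonneg la]
  obtain ⟨hu, hw⟩ := hR _ hc hcR _ _ h.rescale
  simp only [Complex.ofReal_zero, mul_zero, Complex.exp_zero, one_mul] at hu hw
  have hexp_norm : ‖Complex.exp (-(Complex.I * la * ℓ))‖ = Real.exp (ℓ * la.im) := by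
    rw [Complex.norm_exp]
    simp [mul_comm]
  have hcancel : Complex.exp (-(Complex.I * la * ℓ)) * Complex.exp (Complex.I * la * ℓ) = 1 := by
    rw [← Complex.exp_add, neg_add_cancel, Complex.exp_zero]
  have hdouble : Complex.exp (2 * (Complex.I * la) * ℓ) =
      Complex.exp (Complex.I * la * ℓ) * Complex.exp (Complex.I * la * ℓ) := by
    rw [← Complex.exp_add]
    ring_nf
  have hscale : ∀ z z' : ℂ, ‖z'‖ ≤ ε * (‖u 0‖ + ‖w 0‖) →
      z = Complex.exp (-(Complex.I * la * ℓ)) * z' →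
      ‖z‖ ≤ Real.exp (ℓ * la.im) * (ε * (‖u 0‖ + ‖w 0‖)) := by
    rintro z z' hz' rfl
    rw [norm_mul, hexp_norm]
    exact mul_le_mul_of_nonneg_left hz' (Real.exp_pos _).le
  constructor
  · refine hscale _ _ hu ?_
    rw [hdouble]
    linear_combination (Complex.exp (Complex.I * la * ℓ) * u 0 - u ℓ) * hcancel
  · refine hscale _ _ hw ?_
    linear_combination (-w ℓ) * hcancel

theorem BoundedCoeffPair.exists_zs_asymptotic (hab : BoundedCoeffPair a b ℓ K) (hℓ : 0 ≤ ℓ)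
    {ε : ℝ} (hε : 0 < ε) :
    ∃ R, ∀ la : ℂ, R ≤ ‖la‖ → ∀ u w, IsZSSolution a b la ℓ u w →
      ‖u ℓ - Complex.exp (Complex.I * la * ℓ) * u 0‖ ≤
        Real.exp (ℓ * |la.im|) * (ε * (‖u 0‖ + ‖w 0‖)) ∧
      ‖w ℓ - Complex.exp (-(Complex.I * la * ℓ)) * w 0‖ ≤
        Real.exp (ℓ * |la.im|) * (ε * (‖u 0‖ + ‖w 0‖)) := by
  obtain ⟨R, hR⟩ := hab.exists_zs_asymptotic_of_im_nonneg hℓ hε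
  obtain ⟨R', hR'⟩ := hab.swap.exists_zs_asymptotic_of_im_nonneg hℓ hε
  refine ⟨max R R', fun la hla u w h => ?_⟩
  rcases le_total 0 la.im with him | him
  · rw [abs_of_nonneg him]
    exact hR la him ((le_max_left _ _).trans hla) u w h
  · have h' := hR' (-la) (by simpa using him)
      (by rw [norm_neg]; exact (le_max_right _ _).trans hla) w u h.swap
    rw [abs_of_nonpos him, add_comm ‖u 0‖]
    simpa only [Complex.neg_im, mul_neg, neg_mul, neg_neg] using h'.symm

variable {p q : ℝ → ℂ}

lemma IsSolution.isZSSolution {mu : ℂ} {y : ℝ → Fin 2 → ℂ} (hy : IsSolution p q mu y) :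
    IsZSSolution (fun x => q x - Complex.I * p x) (fun x => q x + Complex.I * p x) mu Real.pi
      (fun x => y x 0 + Complex.I * y x 1) (fun x => y x 0 - Complex.I * y x 1) where
  ac_left := (hy.ac_apply 0).add ((hy.ac_apply 1).const_smul Complex.I)
  ac_right := (hy.ac_apply 0).sub ((hy.ac_apply 1).const_smul Complex.I)
  deriv_left := by
    filter_upwards [hy.ae_hasDerivAt] with x hx hxI
    have hderiv := hasDerivAt_pi.1 (hx hxI)
    refine ((hderiv 0).add ((hderiv 1).const_mul Complex.I)).congr_deriv ?_
    simp only [coeff_apply, Matrix.cons_val_zero, Matrix.cons_val_one]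
    linear_combination -(mu * y x 1 + p x * y x 1) * Complex.I_sq
  deriv_right := by
    filter_upwards [hy.ae_hasDerivAt] with x hx hxI
    have hderiv := hasDerivAt_pi.1 (hx hxI)
    refine ((hderiv 0).sub ((hderiv 1).const_mul Complex.I)).congr_deriv ?_
    simp only [coeff_apply, Matrix.cons_val_zero, Matrix.cons_val_one]
    linear_combination -(mu * y x 1 + p x * y x 1) * Complex.I_sq

namespace BoundedPotential

lemma exists_boundedCoeffPair (hpq : BoundedPotential p q) :
    ∃ K, BoundedCoeffPair (fun x => q x - Complex.I * p x) (fun x => q x + Complex.I * p x)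
      Real.pi K := by
  obtain ⟨K, hK⟩ := hpq.bound_p
  obtain ⟨L, hL⟩ := hpq.bound_q
  have hIp := hpq.intervalIntegrable_p.const_mul Complex.I
  have hIp_norm : ∀ x ∈ Icc 0 Real.pi, ‖Complex.I * p x‖ ≤ K := fun x hx => by
    rw [norm_mul, Complex.norm_I, one_mul]
    exact hK x hx
  exact ⟨L + K, hpq.intervalIntegrable_q.sub hIp, hpq.intervalIntegrable_q.add hIp,
    fun x hx => (norm_sub_le _ _).trans (add_le_add (hL x hx) (hIp_norm x hx)),
    fun x hx => (norm_add_le _ _).trans (add_le_add (hL x hx) (hIp_norm x hx))⟩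

lemma exists_solution_asymptotic (hpq : BoundedPotential p q) {ε : ℝ} (hε : 0 < ε) :
    ∃ R, ∀ mu : ℂ, R ≤ ‖mu‖ → ∀ y, IsSolution p q mu y →
      ‖(y Real.pi 0 + Complex.I * y Real.pi 1) -
        Complex.exp (Complex.I * mu * Real.pi) * (y 0 0 + Complex.I * y 0 1)‖ ≤
          Real.exp (Real.pi * |mu.im|) * (ε * (‖y 0 0‖ + ‖y 0 1‖)) ∧
      ‖(y Real.pi 0 - Complex.I * y Real.pi 1) -
        Complex.exp (-(Complex.I * mu * Real.pi)) * (y 0 0 - Complex.I * y 0 1)‖ ≤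
          Real.exp (Real.pi * |mu.im|) * (ε * (‖y 0 0‖ + ‖y 0 1‖)) := by
  obtain ⟨K, hK⟩ := hpq.exists_boundedCoeffPair
  obtain ⟨R, hR⟩ := hK.exists_zs_asymptotic Real.pi_pos.le (half_pos hε)
  refine ⟨R, fun mu hmu y hy => ?_⟩
  obtain ⟨hu, hw⟩ := hR mu hmu _ _ hy.isZSSolution
  have hnorm : ε / 2 * (‖y 0 0 + Complex.I * y 0 1‖ + ‖y 0 0 - Complex.I * y 0 1‖) ≤
      ε * (‖y 0 0‖ + ‖y 0 1‖) := by
    have h1 := norm_add_le (y 0 0) (Complex.I * y 0 1)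
    have h2 := norm_sub_le (y 0 0) (Complex.I * y 0 1)
    rw [norm_mul, Complex.norm_I, one_mul] at h1 h2
    nlinarith
  exact ⟨hu.trans (mul_le_mul_of_nonneg_left hnorm (Real.exp_pos _).le),
    hw.trans (mul_le_mul_of_nonneg_left hnorm (Real.exp_pos _).le)⟩

theorem exists_asymptotic (hpq : BoundedPotential p q) {ε : ℝ} (hε : 0 < ε) :
    ∃ R, ∀ mu : ℂ, R ≤ ‖mu‖ →
      ‖discriminant p q mu - 2 * Complex.cos (Real.pi * mu)‖ ≤
        ε * Real.exp (Real.pi * |mu.im|) ∧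
      ‖sSol p q mu Real.pi 0 + Complex.sin (Real.pi * mu)‖ ≤
        ε * Real.exp (Real.pi * |mu.im|) := by
  obtain ⟨R, hR⟩ := hpq.exists_solution_asymptotic (half_pos hε)
  refine ⟨R, fun mu hmu => ?_⟩
  obtain ⟨hc, hc'⟩ := hR mu hmu _ (hpq.isSolution_cSol mu)
  obtain ⟨hs, hs'⟩ := hR mu hmu _ (hpq.isSolution_sSol mu)
  simp only [hpq.cSol_zero, hpq.sSol_zero, Matrix.cons_val_zero, Matrix.cons_val_one, mul_zero,
    add_zero, sub_zero, mul_one, zero_add, zero_sub, norm_one, norm_zero] at hc hc' hs hs'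
  have hcos : Complex.cos (Real.pi * mu) = (Complex.exp (Complex.I * mu * Real.pi) +
      Complex.exp (-(Complex.I * mu * Real.pi))) / 2 := by
    rw [Complex.cos]; congr 3 <;> ring
  have hsin : Complex.sin (Real.pi * mu) = (Complex.exp (-(Complex.I * mu * Real.pi)) -
      Complex.exp (Complex.I * mu * Real.pi)) * Complex.I / 2 := by
    rw [Complex.sin]; congr 4 <;> ring
  set e₁ := Complex.exp (Complex.I * mu * Real.pi)
  set e₂ := Complex.exp (-(Complex.I * mu * Real.pi))
  set A := cSol p q mu Real.pi 0 + Complex.I * cSol p q mu Real.pi 1 - e₁ with hA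
  set B := cSol p q mu Real.pi 0 - Complex.I * cSol p q mu Real.pi 1 - e₂ with hB
  set C := sSol p q mu Real.pi 0 + Complex.I * sSol p q mu Real.pi 1 - e₁ * Complex.I with hC
  set D := sSol p q mu Real.pi 0 - Complex.I * sSol p q mu Real.pi 1 - e₂ * -Complex.I with hD
  have hF : 2 * (discriminant p q mu - 2 * Complex.cos (Real.pi * mu)) =
      A + B + Complex.I * (D - C) := by
    rw [hcos, discriminant, hA, hB, hC, hD]
    linear_combination (2 * sSol p q mu Real.pi 1 - (e₁ + e₂)) * Complex.I_sq
  have hS : 2 * (sSol p q mu Real.pi 0 + Complex.sin (Real.pi * mu)) = C + D := by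
    rw [hsin, hC, hD]
    ring
  have hF_norm := norm_add_le (A + B) (Complex.I * (D - C))
  have hS_norm := norm_add_le C D
  rw [← hF, norm_mul, norm_mul, Complex.norm_I, Complex.norm_two] at hF_norm
  rw [← hS, norm_mul, Complex.norm_two] at hS_norm
  have := (norm_nonneg _).trans hc
  exact ⟨by linarith [norm_add_le A B, norm_sub_le D C], by linarith⟩

end BoundedPotential

end Asymptotics

section Trigonometry

lemma norm_two_cos_le (t : ℝ) : ‖2 * Complex.cos (Real.pi * t)‖ ≤ 2 := by
  rw [← Complex.ofReal_mul, ← Complex.ofReal_cos, norm_mul, Complex.norm_two, Complex.norm_real]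
  exact mul_le_of_le_one_right zero_le_two (Real.abs_cos_le_one _)

lemma exp_sub_one_le_norm_two_cos (z : ℂ) :
    Real.exp (Real.pi * |z.im|) - 1 ≤ ‖2 * Complex.cos (Real.pi * z)‖ := by
  have hpi := Real.pi_pos
  have hle := abs_norm_sub_norm_le (Complex.exp (Real.pi * z * Complex.I))
    (-Complex.exp (-(Real.pi * z) * Complex.I))
  rw [sub_neg_eq_add, ← Complex.two_cos, norm_neg, Complex.norm_exp, Complex.norm_exp] at hle
  refine le_trans ?_ hle
  have hre₁ : (Real.pi * z * Complex.I).re = -(Real.pi * z.im) := by simp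
  have hre₂ : (-(Real.pi * z) * Complex.I).re = Real.pi * z.im := by simp
  rw [hre₁, hre₂]
  rcases le_total 0 z.im with h | h
  · rw [abs_of_nonneg h, abs_sub_comm]
    have : Real.exp (-(Real.pi * z.im)) ≤ 1 := Real.exp_le_one_iff.2 (by nlinarith)
    exact (sub_le_sub_left this _).trans (le_abs_self _)
  · rw [abs_of_nonpos h, mul_neg]
    have : Real.exp (Real.pi * z.im) ≤ 1 := Real.exp_le_one_iff.2 (by nlinarith)
    exact (sub_le_sub_left this _).trans (le_abs_self _)

lemma norm_two_cos_of_re_eq_intCast {z : ℂ} {n : ℤ} (hz : z.re = n) :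
    ‖2 * Complex.cos (Real.pi * z)‖ = 2 * Real.cosh (Real.pi * z.im) := by
  have harg : (Real.pi : ℂ) * z = (Real.pi * z.im : ℝ) * Complex.I + n * Real.pi := by
    nth_rewrite 1 [← Complex.re_add_im z]
    rw [hz]
    push_cast
    ring
  rw [harg, Complex.cos_antiperiodic.add_int_mul_eq, Int.cast_negOnePow, Complex.cos_mul_I,
    ← Complex.ofReal_cosh, norm_mul, norm_mul, norm_zpow, norm_neg, norm_one, one_zpow, one_mul,
    Complex.norm_two, Complex.norm_real, Real.norm_of_nonneg (Real.cosh_pos _).le]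

lemma hasDerivAt_two_cos (t : ℝ) :
    HasDerivAt (fun t : ℝ => 2 * Complex.cos (Real.pi * t))
      (-(2 * Real.pi * Complex.sin (Real.pi * t))) t := by
  have hlin : HasDerivAt (fun z : ℂ => (Real.pi : ℂ) * z) Real.pi (t : ℂ) := by
    simpa only [id, mul_one] using (hasDerivAt_id (t : ℂ)).const_mul (Real.pi : ℂ)
  exact ((hlin.ccos.const_mul 2).comp_ofReal).congr_deriv (by ring)

lemma sin_pi_mul_ne_zero {a : ℝ} (ha : ∀ n : ℤ, a ≠ n) : Real.sin (Real.pi * a) ≠ 0 := by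
  rw [Real.sin_ne_zero_iff]
  intro n hn
  rw [mul_comm] at hn
  exact ha n (mul_left_cancel₀ Real.pi_ne_zero hn).symm

lemma deriv_two_cos_ne_zero {a : ℝ} (ha : ∀ n : ℤ, a ≠ n) :
    -(2 * Real.pi * Complex.sin (Real.pi * a)) ≠ 0 := by
  exact_mod_cast neg_ne_zero.2
    (mul_ne_zero (mul_ne_zero two_ne_zero Real.pi_ne_zero) (sin_pi_mul_ne_zero ha))

lemma sin_sq_le_of_norm_cos_sub_le {x η : ℝ} {z : ℂ} (hη : η ≤ 1)
    (hcos : ‖Complex.cos x - Complex.cos z‖ ≤ η) (hsin : ‖Complex.sin z‖ ≤ η) :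
    Real.sin x ^ 2 ≤ 5 * η := by
  have hη₀ : 0 ≤ η := (norm_nonneg _).trans hsin
  have hle : ‖Complex.cos x‖ ≤ 1 := by
    rw [← Complex.ofReal_cos, Complex.norm_real]
    exact Real.abs_cos_le_one x
  have hid : Complex.sin x ^ 2 = Complex.sin z ^ 2 - (Complex.cos x - Complex.cos z) *
      (2 * Complex.cos x - (Complex.cos x - Complex.cos z)) := by
    linear_combination Complex.sin_sq_add_cos_sq x - Complex.sin_sq_add_cos_sq z
  have hnorm : Real.sin x ^ 2 = ‖Complex.sin x ^ 2‖ := by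
    rw [norm_pow, ← Complex.ofReal_sin, Complex.norm_real, Real.norm_eq_abs, sq_abs]
  calc Real.sin x ^ 2
      ≤ ‖Complex.sin z‖ ^ 2 + ‖Complex.cos x - Complex.cos z‖ *
          (2 * ‖Complex.cos x‖ + ‖Complex.cos x - Complex.cos z‖) := by
        rw [hnorm, hid]
        refine (norm_sub_le _ _).trans (add_le_add (norm_pow _ _).le ?_)
        rw [norm_mul]
        gcongr
        exact (norm_sub_le _ _).trans_eq (by rw [norm_mul, Complex.norm_two])
    _ ≤ η ^ 2 + η * (2 * 1 + η) := by gcongr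
    _ ≤ 5 * η := by nlinarith

end Trigonometry

section ZerosOfEntireFunctions

variable {g : ℂ → ℂ}

lemma mem_codiscrete_ne_zero (hg : Differentiable ℂ g) (h₀ : ∃ z, g z ≠ 0) :
    {z | g z ≠ 0} ∈ codiscrete ℂ :=
  let ⟨_, hz⟩ := h₀
  AnalyticOnNhd.preimage_zero_mem_codiscrete (fun w _ => hg.analyticAt w) hz

lemma eventually_nhdsNE_of_mem_codiscrete {X : Type*} [TopologicalSpace X] {s : Set X}
    (hs : s ∈ codiscrete X) (x : X) : ∀ᶠ y in 𝓝[≠] x, y ∈ s :=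
  compl_compl s ▸ disjoint_principal_right.1 (mem_codiscrete.1 hs x)

lemma finite_inter_zeros (hg : Differentiable ℂ g) (h₀ : ∃ z, g z ≠ 0) {K : Set ℂ}
    (hK : IsCompact K) : (K ∩ {z | g z = 0}).Finite := by
  obtain ⟨hopen, hdisc⟩ := mem_codiscrete'.1 (mem_codiscrete_ne_zero hg h₀)
  have hcompl : {z | g z ≠ 0}ᶜ = {z | g z = 0} := by
    ext
    simp only [mem_compl_iff, mem_ofPred_eq, not_not]
  rw [hcompl] at hdisc
  exact (hK.inter_right (hcompl ▸ hopen.isClosed_compl)).finite (hdisc.mono inter_subset_right)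

end ZerosOfEntireFunctions

section CosineType

/-- Sine-type growth: `g(z) = -c sin πz + o(e^{π |Im z|})` as `z → ∞`. -/
def HasSineAsymptotic (c : ℂ) (g : ℂ → ℂ) : Prop :=
  ∀ ε > 0, ∃ R, ∀ z : ℂ, R ≤ ‖z‖ →
    ‖g z + c * Complex.sin (Real.pi * z)‖ ≤ ε * Real.exp (Real.pi * |z.im|)

/-- Entire functions of cosine type: `F(z) = 2 cos πz + o(e^{π |Im z|})` as `z → ∞`. The
discriminant of a Dirac operator is of this kind. -/
structure IsCosineType (F : ℂ → ℂ) : Prop where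
  differentiable : Differentiable ℂ F
  asymptotic : ∀ ε > 0, ∃ R, ∀ z : ℂ, R ≤ ‖z‖ →
    ‖F z - 2 * Complex.cos (Real.pi * z)‖ ≤ ε * Real.exp (Real.pi * |z.im|)

variable {F g : ℂ → ℂ} {c : ℂ}

lemma HasSineAsymptotic.exists_ne_zero (hg : HasSineAsymptotic c g) (hc : c ≠ 0) :
    ∃ z, g z ≠ 0 := by
  obtain ⟨R, hR⟩ := hg (‖c‖ / 2) (half_pos (norm_pos_iff.2 hc))
  obtain ⟨n, hn⟩ := exists_nat_ge R
  refine ⟨((n + 1 / 2 : ℝ) : ℂ), fun h₀ => ?_⟩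
  have hsin : ‖Complex.sin (Real.pi * ((n + 1 / 2 : ℝ) : ℂ))‖ = 1 := by
    rw [← Complex.ofReal_mul, ← Complex.ofReal_sin, Complex.norm_real, mul_add, mul_comm Real.pi n,
      add_comm, mul_one_div, Real.sin_add_nat_mul_pi, Real.sin_pi_div_two, mul_one, norm_pow,
      norm_neg, norm_one, one_pow]
  have hle := hR ((n + 1 / 2 : ℝ) : ℂ) (by
    rw [Complex.norm_real, Real.norm_of_nonneg (by positivity)]; linarith)
  rw [h₀, zero_add, norm_mul, hsin, Complex.ofReal_im, abs_zero, mul_zero, Real.exp_zero] at hle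
  linarith [norm_pos_iff.2 hc]

lemma IsCosineType.exists_abs_im_le (hF : IsCosineType F) :
    ∃ Y, ∀ z : ℂ, ‖F z‖ ≤ 2 → |z.im| ≤ Y := by
  obtain ⟨R, hR⟩ := hF.asymptotic (1 / 2) (by norm_num)
  refine ⟨max R 2, fun z hz => ?_⟩
  by_contra! hlt
  obtain ⟨hRlt, h2lt⟩ := max_lt_iff.1 hlt
  have hasymp := hR z (hRlt.le.trans (Complex.abs_im_le_norm z))
  have hcos := exp_sub_one_le_norm_two_cos z
  have htri := norm_sub_norm_le (2 * Complex.cos (Real.pi * z)) (F z)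
  rw [norm_sub_rev] at htri
  have hexp := Real.add_one_le_exp (Real.pi * |z.im|)
  have : 6 < Real.pi * |z.im| := by nlinarith [Real.pi_gt_three]
  linarith

lemma IsCosineType.exists_lt_norm_of_re_eq_intCast (hF : IsCosineType F) {κ : ℝ} (hκ : κ < 1) :
    ∃ N : ℝ, ∀ (z : ℂ) (n : ℤ), z.re = n → N ≤ |(n : ℝ)| → 2 * κ < ‖F z‖ := by
  obtain ⟨R, hR⟩ := hF.asymptotic ((1 - κ) / 2) (by linarith)
  refine ⟨R, fun z n hz hn => ?_⟩
  have hasymp := hR z ((hz ▸ hn : R ≤ |z.re|).trans (Complex.abs_re_le_norm z))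
  have htri := norm_sub_norm_le (2 * Complex.cos (Real.pi * z)) (F z)
  rw [norm_sub_rev, norm_two_cos_of_re_eq_intCast hz] at htri
  have hexp : Real.exp (Real.pi * |z.im|) ≤ 2 * Real.cosh (Real.pi * z.im) := by
    rw [← Real.cosh_abs, abs_mul, abs_of_pos Real.pi_pos, Real.cosh_eq]
    linarith [Real.exp_pos (-(Real.pi * |z.im|))]
  have hone := Real.one_le_cosh (Real.pi * z.im)
  have hlow : (1 + κ) * Real.cosh (Real.pi * z.im) ≤ ‖F z‖ := by
    have := mul_le_mul_of_nonneg_left hexp (by linarith : 0 ≤ (1 - κ) / 2)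
    linarith
  rcases le_total 0 κ with _ | _
  · nlinarith
  · nlinarith [norm_nonneg (F z)]

lemma IsCosineType.hasSineAsymptotic_deriv (hF : IsCosineType F) :
    HasSineAsymptotic (2 * Real.pi) (deriv F) := by
  intro ε hε
  obtain ⟨R, hR⟩ := hF.asymptotic (ε / Real.exp Real.pi) (by positivity)
  refine ⟨R + 1, fun z hz => ?_⟩
  have hderiv : ∀ w, HasDerivAt (fun z => F z - 2 * Complex.cos (Real.pi * z))
      (deriv F w + 2 * Real.pi * Complex.sin (Real.pi * w)) w := fun w => by
    have hlin : HasDerivAt (fun z : ℂ => (Real.pi : ℂ) * z) Real.pi w := by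
      simpa only [id, mul_one] using (hasDerivAt_id w).const_mul (Real.pi : ℂ)
    exact ((hF.differentiable w).hasDerivAt.sub (hlin.ccos.const_mul 2)).congr_deriv (by ring)
  have hsphere : ∀ w ∈ Metric.sphere z 1,
      ‖F w - 2 * Complex.cos (Real.pi * w)‖ ≤ ε * Real.exp (Real.pi * |z.im|) := fun w hw => by
    rw [mem_sphere_iff_norm] at hw
    have hnorm : R ≤ ‖w‖ := by
      have := norm_sub_norm_le z w
      rw [norm_sub_rev, hw] at this
      linarith
    have him : |w.im| ≤ 1 + |z.im| := by
      have := Complex.abs_im_le_norm (w - z)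
      rw [Complex.sub_im, hw] at this
      linarith [abs_sub_abs_le_abs_sub w.im z.im]
    calc ‖F w - 2 * Complex.cos (Real.pi * w)‖
        ≤ ε / Real.exp Real.pi * Real.exp (Real.pi * |w.im|) := hR w hnorm
      _ ≤ ε / Real.exp Real.pi * Real.exp (Real.pi * (1 + |z.im|)) := by
          have := Real.pi_pos
          gcongr
      _ = ε * Real.exp (Real.pi * |z.im|) := by
          rw [mul_one_add, Real.exp_add, ← mul_assoc, div_mul_cancel₀ _ (Real.exp_pos _).ne']
  have hcauchy := Complex.norm_deriv_le_of_forall_mem_sphere_norm_le one_pos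
    (Differentiable.diffContOnCl fun w => (hderiv w).differentiableAt) hsphere
  rwa [(hderiv z).deriv, div_one] at hcauchy

lemma two_pi_ne_zero : (2 * Real.pi : ℂ) ≠ 0 := by exact_mod_cast Real.two_pi_pos.ne'

lemma IsCosineType.eventually_ne (hF : IsCosineType F) (w c : ℂ) : ∀ᶠ z in 𝓝[≠] w, F z ≠ c := by
  have hne : ∃ z, F z - c ≠ 0 := by
    by_contra! hconst
    obtain ⟨z, hz⟩ := hF.hasSineAsymptotic_deriv.exists_ne_zero two_pi_ne_zero
    have : F = fun _ => c := funext fun z => sub_eq_zero.1 (hconst z)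
    exact hz (by rw [this, deriv_const])
  exact (eventually_nhdsNE_of_mem_codiscrete
    (mem_codiscrete_ne_zero (hF.differentiable.sub_const c) hne) w).mono fun _ => sub_ne_zero.1

lemma IsCosineType.exists_norm_le_of_eq_zero (hF : IsCosineType F) (hg : HasSineAsymptotic c g)
    (hc : c ≠ 0) {δ : ℝ} (hδ : 0 < δ) :
    ∃ R, ∀ (z : ℂ) (t : ℝ), F z = 2 * Complex.cos (Real.pi * t) → g z = 0 →
      δ ≤ Real.sin (Real.pi * t) ^ 2 → ‖z‖ ≤ R := by
  obtain ⟨Y, hY⟩ := hF.exists_abs_im_le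
  have hc' := norm_pos_iff.2 hc
  obtain ⟨η, hη₀, hη⟩ : ∃ η > 0, η < min 1 (δ / 5) := exists_between (by positivity)
  obtain ⟨hη1, hηδ⟩ := lt_min_iff.1 hη
  obtain ⟨R₁, hR₁⟩ := hF.asymptotic (2 * η / Real.exp (Real.pi * Y)) (by positivity)
  obtain ⟨R₂, hR₂⟩ := hg (‖c‖ * η / Real.exp (Real.pi * Y)) (by positivity)
  refine ⟨max R₁ R₂, fun z t hz hgz ht => ?_⟩
  by_contra! hlt
  obtain ⟨h₁, h₂⟩ := max_lt_iff.1 hlt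
  have hexp : ∀ {b : ℝ}, 0 ≤ b →
      b / Real.exp (Real.pi * Y) * Real.exp (Real.pi * |z.im|) ≤ b := fun {b} hb => by
    have him := hY z (hz ▸ norm_two_cos_le t)
    have := Real.pi_pos
    calc b / Real.exp (Real.pi * Y) * Real.exp (Real.pi * |z.im|)
        ≤ b / Real.exp (Real.pi * Y) * Real.exp (Real.pi * Y) := by gcongr
      _ = b := div_mul_cancel₀ _ (Real.exp_pos _).ne'
  have hcos : ‖Complex.cos (Real.pi * t : ℝ) - Complex.cos (Real.pi * z)‖ ≤ η := by
    have hle := (hR₁ z h₁.le).trans (hexp (by positivity))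
    rw [hz, ← mul_sub, norm_mul, Complex.norm_two] at hle
    push_cast
    linarith
  have hsin : ‖Complex.sin (Real.pi * z)‖ ≤ η := by
    have hle := (hR₂ z h₂.le).trans (hexp (by positivity))
    rw [hgz, zero_add, norm_mul] at hle
    exact le_of_mul_le_mul_left hle hc'
  linarith [sin_sq_le_of_norm_cos_sub_le hη1.le hcos hsin]

theorem IsCosineType.eventually_forall_ne_zero (hF : IsCosineType F) (hg : HasSineAsymptotic c g)
    (hc : c ≠ 0) (hgd : Differentiable ℂ g) {a : ℝ} (ha : ∀ n : ℤ, a ≠ n) :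
    ∀ᶠ t : ℝ in 𝓝[≠] a, ∀ z, F z = 2 * Complex.cos (Real.pi * t) → g z ≠ 0 := by
  have hpos : 0 < Real.sin (Real.pi * a) ^ 2 := sq_pos_of_ne_zero (sin_pi_mul_ne_zero ha)
  obtain ⟨δ, hδ₀, hδ⟩ := exists_between hpos
  obtain ⟨R, hR⟩ := hF.exists_norm_le_of_eq_zero hg hc hδ₀
  have hfin := finite_inter_zeros hgd (hg.exists_ne_zero hc) (isCompact_closedBall (0 : ℂ) R)
  have hsin : ∀ᶠ t : ℝ in 𝓝[≠] a, δ < Real.sin (Real.pi * t) ^ 2 := by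
    have : Continuous fun t : ℝ => Real.sin (Real.pi * t) ^ 2 := by fun_prop
    exact (this.continuousAt.eventually (lt_mem_nhds hδ)).filter_mono nhdsWithin_le_nhds
  have hne := (eventually_all_finite hfin).2 fun z _ =>
    (hasDerivAt_two_cos a).eventually_ne (c := F z) (deriv_two_cos_ne_zero ha)
  filter_upwards [hsin, hne] with t ht hfib z hz hgz
  exact hfib z ⟨mem_closedBall_zero_iff.2 (hR z t hz hgz ht.le), hgz⟩ hz.symm

end CosineType

section LimitsAlongConnectedSets

variable {X ι : Type*} [TopologicalSpace X] {f : Filter X} {p : ι → Prop} {s : ι → Set X}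

lemma exists_sphere_of_eventually_nhdsNE {E : Type*} [PseudoMetricSpace E] {l : E} {P : E → Prop}
    (h : ∀ᶠ z in 𝓝[≠] l, P z) {ε : ℝ} (hε : 0 < ε) :
    ∃ ρ > 0, ρ ≤ ε ∧ ∀ z ∈ Metric.sphere l ρ, P z := by
  obtain ⟨r, hr, hrP⟩ := Metric.mem_nhdsWithin_iff.1 h
  refine ⟨min ε (r / 2), by positivity, min_le_left _ _, fun z hz => hrP ⟨?_, ?_⟩⟩
  · exact Metric.mem_ball.2 (hz.trans_lt ((min_le_right _ _).trans_lt (half_lt_self hr)))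
  · rintro rfl
    rw [Metric.mem_sphere, dist_self] at hz
    exact (lt_min hε (half_pos hr)).ne hz

/-- A path that accumulates at an isolated point `l` of the fibre of `F` cannot cross a small
sphere around `l`, because `F` along the path tends to `F l`. -/
lemma tendsto_of_mapClusterPt_of_tendsto_comp {E Y : Type*} [PseudoMetricSpace E] [ProperSpace E]
    [TopologicalSpace Y] [T2Space Y] {F : E → Y} {γ : X → E} {l : E} {J : Set X}
    (hf : f.HasBasis p s) (hs : ∀ i, p i → IsPreconnected (s i)) (hJ : J ∈ f)
    (hγ : ContinuousOn γ J) (hl : MapClusterPt l f γ) (hF : Continuous F)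
    (hFγ : Tendsto (F ∘ γ) f (𝓝 (F l))) (hne : ∀ᶠ z in 𝓝[≠] l, F z ≠ F l) :
    Tendsto γ f (𝓝 l) := by
  rw [Metric.tendsto_nhds]
  intro ε hε
  obtain ⟨ρ, hρ, hρε, hsphere⟩ := exists_sphere_of_eventually_nhdsNE hne hε
  have hmem : (F '' Metric.sphere l ρ)ᶜ ∈ 𝓝 (F l) := by
    refine ((isCompact_sphere l ρ).image hF).isClosed.isOpen_compl.mem_nhds ?_
    rintro ⟨z, hz, hFz⟩
    exact hsphere z hz hFz
  obtain ⟨i, hi, hsub⟩ := hf.mem_iff.1 (inter_mem hJ (hFγ hmem))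
  have hdist : ContinuousOn (fun x => dist (γ x) l) (s i) :=
    continuous_dist.comp_continuousOn
      ((hγ.mono fun _ hx => (hsub hx).1).prodMk continuousOn_const)
  obtain ⟨x, hxρ, hx⟩ := ((hl.frequently (Metric.ball_mem_nhds l hρ)).and_eventually
    (hf.mem_of_mem hi)).exists
  filter_upwards [hf.mem_of_mem hi] with y hy
  by_contra! hle
  obtain ⟨w, hw, hwρ⟩ := (hs i hi).intermediate_value hx hy hdist
    ⟨(Metric.mem_ball.1 hxρ).le, hρε.trans hle⟩
  exact (hsub hw).2 ⟨γ w, hwρ, rfl⟩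

end LimitsAlongConnectedSets

section BranchLimits

variable {F : ℂ → ℂ} {la : ℝ → ℂ} {J : Set ℝ} {a : ℝ}

lemma IsCosineType.exists_norm_le_of_isPreconnected (hF : IsCosineType F) {X : Type*}
    [TopologicalSpace X] {s : Set X} (hs : IsPreconnected s) {u : X → ℂ} (hu : ContinuousOn u s)
    {κ : ℝ} (hκ : κ < 1) (hFu : ∀ x ∈ s, ‖F (u x)‖ ≤ 2 * κ) : ∃ R, ∀ x ∈ s, ‖u x‖ ≤ R := by
  rcases s.eq_empty_or_nonempty with rfl | ⟨x₀, hx₀⟩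
  · exact ⟨0, fun x hx => hx.elim⟩
  obtain ⟨Y, hY⟩ := hF.exists_abs_im_le
  obtain ⟨N, hN⟩ := hF.exists_lt_norm_of_re_eq_intCast hκ
  obtain ⟨M, hM⟩ := exists_nat_ge (max N |(u x₀).re|)
  obtain ⟨hNM, hreM⟩ := max_le_iff.1 hM
  have hre : ContinuousOn (fun x => (u x).re) s := Complex.continuous_re.comp_continuousOn hu
  have havoid : ∀ n : ℤ, |(n : ℝ)| = M → (n : ℝ) ∉ (fun x => (u x).re) '' s := by
    rintro n hn ⟨x, hx, hxn⟩
    exact (hN (u x) n hxn (hn ▸ hNM)).not_ge (hFu x hx)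
  have hbound : ∀ x ∈ s, |(u x).re| ≤ M := fun x hx => abs_le.2 <| by
    constructor <;> by_contra! hlt
    · refine havoid (-M : ℤ) (by simp) (hs.intermediate_value hx hx₀ hre ?_)
      push_cast
      exact ⟨hlt.le, (abs_le.1 hreM).1⟩
    · exact havoid (M : ℤ) (by simp) (hs.intermediate_value hx₀ hx hre ⟨(abs_le.1 hreM).2, hlt.le⟩)
  refine ⟨M + Y, fun x hx => (Complex.norm_le_abs_re_add_abs_im _).trans ?_⟩
  exact add_le_add (hbound x hx) (hY _ ((hFu x hx).trans (by linarith)))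

lemma continuous_two_cos : Continuous fun t : ℝ => 2 * Complex.cos (Real.pi * t) := by fun_prop

lemma exists_norm_two_cos_lt {a : ℝ} (ha : ∀ n : ℤ, a ≠ n) :
    ∃ κ < 1, ∀ᶠ t in 𝓝 a, ‖2 * Complex.cos (Real.pi * (t : ℝ))‖ < 2 * κ := by
  have hsin := sq_pos_of_ne_zero (sin_pi_mul_ne_zero ha)
  have hlt : ‖2 * Complex.cos (Real.pi * a)‖ < 2 * 1 := by
    rw [← Complex.ofReal_mul, ← Complex.ofReal_cos, norm_mul, Complex.norm_two, Complex.norm_real,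
      Real.norm_eq_abs, mul_lt_mul_iff_right₀ two_pos, ← sq_lt_one_iff_abs_lt_one]
    linarith [Real.sin_sq_add_cos_sq (Real.pi * a)]
  obtain ⟨κ, hκa, hκ⟩ := exists_between ((div_lt_iff₀' two_pos).2 hlt)
  exact ⟨κ, hκ, continuous_two_cos.norm.continuousAt.eventually
    (gt_mem_nhds ((div_lt_iff₀' two_pos).1 hκa))⟩

theorem IsCosineType.exists_tendsto (hF : IsCosineType F) (hJ : J.OrdConnected)
    [NeBot (𝓝[J] a)] (hla : ContinuousOn la J)
    (h : ∀ t ∈ J, F (la t) = 2 * Complex.cos (Real.pi * t)) (ha : ∀ n : ℤ, a ≠ n) :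
    ∃ l, Tendsto la (𝓝[J] a) (𝓝 l) ∧ F l = 2 * Complex.cos (Real.pi * a) := by
  have hbasis := nhdsWithin_hasBasis (nhds_basis_Ioo a) J
  have hconn : ∀ u v : ℝ, IsPreconnected (Ioo u v ∩ J) := fun u v =>
    (ordConnected_Ioo.inter hJ).isPreconnected
  have hFt : Tendsto (F ∘ la) (𝓝[J] a) (𝓝 (2 * Complex.cos (Real.pi * a))) :=
    ((continuous_two_cos.tendsto a).mono_left nhdsWithin_le_nhds).congr'
      (eventually_nhdsWithin_of_forall fun t ht => (h t ht).symm)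
  obtain ⟨κ, hκ, hcos⟩ := exists_norm_two_cos_lt ha
  obtain ⟨⟨u, v⟩, huv, hsub⟩ := hbasis.mem_iff.1
    (inter_mem self_mem_nhdsWithin (mem_nhdsWithin_of_mem_nhds hcos))
  obtain ⟨R, hR⟩ := hF.exists_norm_le_of_isPreconnected (hconn u v)
    (hla.mono fun t ht => (hsub ht).1) hκ fun t ht => by
      rw [h t (hsub ht).1]
      exact (hsub ht).2.le
  obtain ⟨l, -, hl⟩ := (isCompact_closedBall (0 : ℂ) R).exists_mapClusterPt
    (le_principal_iff.2 (mem_map.2 (mem_of_superset (hbasis.mem_of_mem huv) fun t ht =>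
      mem_closedBall_zero_iff.2 (hR t ht))))
  have hFl : F l = 2 * Complex.cos (Real.pi * a) :=
    eq_of_nhds_neBot
      ((hl.tendsto_comp (hF.differentiable.continuous.tendsto l)).clusterPt.mono hFt)
  exact ⟨l, tendsto_of_mapClusterPt_of_tendsto_comp hbasis (fun _ _ => hconn _ _)
    self_mem_nhdsWithin hla hl hF.differentiable.continuous (hFl ▸ hFt) (hF.eventually_ne l _), hFl⟩

end BranchLimits

section DerivativeAlongFibres

variable {F : ℂ → ℂ} {l : ℂ}

lemma isTheta_pow_of_analyticOrderAt_eq {f : ℂ → ℂ} (hf : AnalyticAt ℂ f l) {n : ℕ}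
    (hn : analyticOrderAt f l = n) : f =Θ[𝓝 l] fun z => (z - l) ^ n := by
  obtain ⟨g, hg, hgl, (hfg : f =ᶠ[𝓝 l] fun z => (z - l) ^ n • g z)⟩ :=
    hf.analyticOrderAt_eq_natCast.1 hn
  have hg₁ : g =Θ[𝓝 l] fun _ => (1 : ℂ) :=
    ((Asymptotics.isEquivalent_const_iff_tendsto hgl).2 hg.continuousAt).isTheta.trans
      (Asymptotics.isTheta_const_const hgl one_ne_zero)
  simpa only [smul_eq_mul, mul_one] using
    hfg.isTheta.trans ((Asymptotics.isTheta_refl (fun z => (z - l) ^ n) (𝓝 l)).smul hg₁)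

/-- If `F - F l` vanishes to order `m + 1` at `l` then `θ = m / (m + 1)` works. -/
lemma exists_rpow_norm_sub_isBigO_deriv (hF : AnalyticAt ℂ F l)
    (hne : ∀ᶠ z in 𝓝[≠] l, F z ≠ F l) :
    ∃ θ : ℝ, 0 ≤ θ ∧ θ < 1 ∧ (fun z => ‖F z - F l‖ ^ θ) =O[𝓝 l] deriv F := by
  have htop : analyticOrderAt (fun z => F z - F l) l ≠ ⊤ := fun h => by
    obtain ⟨z, hz, hFz⟩ :=
      (((analyticOrderAt_eq_top.1 h).filter_mono nhdsWithin_le_nhds).and hne).exists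
    exact hFz (sub_eq_zero.1 hz)
  have hord := hF.analyticOrderAt_deriv_add_one
  obtain ⟨m, hm⟩ := ENat.ne_top_iff_exists.1
    (fun h => htop (by rw [← hord, h, top_add]) : analyticOrderAt (deriv F) l ≠ ⊤)
  have hsub : (fun z => F z - F l) =Θ[𝓝 l] fun z => (z - l) ^ (m + 1) :=
    isTheta_pow_of_analyticOrderAt_eq (hF.fun_sub analyticAt_const) (by rw [← hord, ← hm]; rfl)
  have hderiv := isTheta_pow_of_analyticOrderAt_eq hF.deriv hm.symm
  have hm₁ : (0 : ℝ) < m + 1 := by positivity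
  refine ⟨m / (m + 1), by positivity, (div_lt_one hm₁).2 (lt_add_one _), ?_⟩
  have hpow : ∀ z : ℂ, ‖(z - l) ^ (m + 1)‖ ^ ((m : ℝ) / (m + 1)) = ‖(z - l) ^ m‖ := fun z => by
    rw [norm_pow, norm_pow, ← Real.rpow_natCast, ← Real.rpow_mul (norm_nonneg _), Nat.cast_add_one,
      mul_div_cancel₀ _ hm₁.ne', Real.rpow_natCast]
  have hle := Asymptotics.IsBigO.rpow (r := (m : ℝ) / (m + 1)) (by positivity)
    (Eventually.of_forall fun _ => norm_nonneg _) hsub.isBigO.norm_norm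
  simp only [hpow] at hle
  exact hle.of_norm_right.trans hderiv.isBigO_symm

lemma exists_inv_deriv_isBigO_rpow (hF : AnalyticAt ℂ F l) (hne : ∀ᶠ z in 𝓝[≠] l, F z ≠ F l)
    {φ : ℝ → ℂ} {φ' : ℂ} {a : ℝ} (hφ : HasDerivAt φ φ' a) (hφ' : φ' ≠ 0) {la : ℝ → ℂ} {J : Set ℝ}
    (hla : Tendsto la (𝓝[J] a) (𝓝 l)) (hFla : ∀ t ∈ J, F (la t) = φ t) (hFl : F l = φ a)
    (haJ : a ∉ J) :
    ∃ θ : ℝ, θ < 1 ∧ (∀ᶠ t in 𝓝[J] a, deriv F (la t) ≠ 0) ∧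
      (fun t => (deriv F (la t))⁻¹) =O[𝓝[J] a] fun t => |t - a| ^ (-θ) := by
  obtain ⟨θ, hθ₀, hθ₁, hle⟩ := exists_rpow_norm_sub_isBigO_deriv hF hne
  have hφa : (fun t => t - a) =O[𝓝[J] a] fun t => F (la t) - F l := by
    have hpair : Tendsto (fun t => (t, a)) (𝓝[J] a) (𝓝 a ×ˢ pure a) :=
      (tendsto_id'.2 nhdsWithin_le_nhds).prodMk tendsto_const_pure
    refine ((hφ.isTheta_sub hφ').isBigO_symm.comp_tendsto hpair).congr' EventuallyEq.rfl ?_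
    exact eventually_nhdsWithin_of_forall fun t ht => by
      simp only [Function.comp_apply, hFla t ht, hFl]
  have hrpow : (fun t => |t - a| ^ θ) =O[𝓝[J] a] fun t => deriv F (la t) :=
    (Asymptotics.IsBigO.rpow hθ₀ (Eventually.of_forall fun _ => norm_nonneg _)
      hφa.norm_norm).trans (hle.comp_tendsto hla)
  have hpos : ∀ᶠ t in 𝓝[J] a, |t - a| ^ θ ≠ 0 := eventually_nhdsWithin_of_forall fun t ht =>
    (Real.rpow_pos_of_pos (abs_pos.2 (sub_ne_zero.2 (ne_of_mem_of_not_mem ht haJ))) θ).ne'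
  refine ⟨θ, hθ₁, hpos.mp (hrpow.eq_zero_imp.mono fun t => mt), ?_⟩
  simp only [Real.rpow_neg (abs_nonneg _)]
  exact hrpow.inv_rev (hpos.mono fun t ht h => (ht h).elim)

lemma integrableAtFilter_abs_sub_rpow (a : ℝ) {r : ℝ} (hr : -1 < r) :
    IntegrableAtFilter (fun t : ℝ => |t - a| ^ r) (𝓝 a) := by
  have habs : IntervalIntegrable (fun t : ℝ => |t| ^ r) volume (-1) 1 := by
    refine intervalIntegrable_of_even (fun t => by rw [abs_neg]) fun x hx => ?_
    refine (intervalIntegral.intervalIntegrable_rpow' hr).congr fun t ht => ?_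
    rw [uIoc_of_le hx.le] at ht
    simp only [abs_of_pos ht.1]
  have hint := habs.comp_sub_right a
  rw [intervalIntegrable_iff_integrableOn_Ioo_of_le (by linarith)] at hint
  exact ⟨_, Ioo_mem_nhds (by linarith) (by linarith), hint⟩

end DerivativeAlongFibres

section LocalIntegrability

lemma integrableAtFilter_of_eventuallyEq {E : Type*} [NormedAddCommGroup E] {f g : ℝ → E}
    {l : Filter ℝ} [IsMeasurablyGenerated l] (hfg : f =ᶠ[l] g) (hg : IntegrableAtFilter g l) :
    IntegrableAtFilter f l := by
  obtain ⟨s, hs, hint⟩ := hg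
  obtain ⟨u, hu, hum, hfgu⟩ := hfg.exists_measurable_mem
  refine ⟨s ∩ u, inter_mem hs hu, (hint.mono_set inter_subset_left).congr ?_⟩
  exact ae_restrict_of_ae_restrict_of_subset inter_subset_right
    (ae_restrict_of_forall_mem hum fun t ht => (hfgu t ht).symm)

variable {F : ℂ → ℂ} {la : ℝ → ℂ} {J : Set ℝ} {a : ℝ} {E : Type*} [NormedAddCommGroup E]
  [NormedSpace ℂ E]

lemma aestronglyMeasurable_inv_deriv_smul (hF : Differentiable ℂ F) (hJ : MeasurableSet J)
    (hla : ContinuousOn la J) {G : ℂ × ℂ → E} (hG : Continuous G) :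
    AEStronglyMeasurable (fun t : ℝ => (deriv F (la t))⁻¹ • G (la t, t)) (volume.restrict J) :=
  ((hF.deriv.continuous.comp_continuousOn hla).aemeasurable hJ).inv.aestronglyMeasurable.smul
    ((hG.comp_continuousOn
      (hla.prodMk Complex.continuous_ofReal.continuousOn)).aestronglyMeasurable hJ)

theorem IsCosineType.integrableAtFilter_inv_deriv_smul (hF : IsCosineType F) (hJ : J.OrdConnected)
    (hla : ContinuousOn la J) (h : ∀ t ∈ J, F (la t) = 2 * Complex.cos (Real.pi * t))
    (ha : ∀ n : ℤ, a ≠ n) (haJ : a ∉ J) {G : ℂ × ℂ → E} (hG : Continuous G) :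
    (∀ᶠ t in 𝓝[J] a, deriv F (la t) ≠ 0) ∧
      IntegrableAtFilter (fun t : ℝ => (deriv F (la t))⁻¹ • G (la t, t)) (𝓝[J] a) := by
  rcases (𝓝[J] a).eq_or_neBot with hbot | _
  · rw [hbot]
    exact ⟨eventually_bot, ∅, mem_bot, integrableOn_empty⟩
  obtain ⟨l, hl, hFl⟩ := hF.exists_tendsto hJ hla h ha
  obtain ⟨θ, hθ, hne, hO⟩ := exists_inv_deriv_isBigO_rpow (hF.differentiable.analyticAt l)
    (hF.eventually_ne l _) (hasDerivAt_two_cos a) (deriv_two_cos_ne_zero ha) hl h hFl haJ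
  have hofReal : Tendsto (fun t : ℝ => (t : ℂ)) (𝓝[J] a) (𝓝 a) :=
    (Complex.continuous_ofReal.tendsto a).mono_left nhdsWithin_le_nhds
  have hbound := hO.smul
    (((hG.tendsto (l, (a : ℂ))).comp (hl.prodMk_nhds hofReal)).isBigO_one ℝ)
  simp only [smul_eq_mul, mul_one] at hbound
  have := hJ.measurableSet.nhdsWithin_isMeasurablyGenerated a
  exact ⟨hne, hbound.integrableAtFilter
    ⟨J, self_mem_nhdsWithin,
      aestronglyMeasurable_inv_deriv_smul hF.differentiable hJ.measurableSet hla hG⟩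
    ((integrableAtFilter_abs_sub_rpow a (neg_lt_neg hθ)).filter_mono nhdsWithin_le_nhds)⟩

end LocalIntegrability

section PuncturedNeighbourhoods

lemma eventually_ne_int (a : ℝ) : ∀ᶠ t : ℝ in 𝓝[≠] a, ∀ n : ℤ, t ≠ n := by
  have hcodiscrete : (range ((↑) : ℤ → ℝ))ᶜ ∈ codiscrete ℝ := by
    rw [mem_codiscrete', compl_compl]
    exact ⟨Int.isClosedEmbedding_coe_real.isClosed_range.isOpen_compl,
      Int.isClosedEmbedding_coe_real.isEmbedding.isDiscrete_range⟩
  filter_upwards [eventually_nhdsNE_of_mem_codiscrete hcodiscrete a] with t ht n hn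
  exact ht ⟨n, hn.symm⟩

lemma eventually_two_cos_ne_at_int (n : ℤ) : ∀ᶠ t : ℝ in 𝓝[≠] (n : ℝ),
    2 * Complex.cos (Real.pi * t) ≠ 2 * Complex.cos (Real.pi * (n : ℝ)) := by
  filter_upwards [eventually_ne_int n] with t ht heq
  have hcos : Real.cos (Real.pi * t) = Real.cos (Real.pi * n) := by
    exact_mod_cast mul_left_cancel₀ two_ne_zero heq
  have hsin : Real.sin (Real.pi * n) = 0 := mul_comm Real.pi n ▸ Real.sin_int_mul_pi n
  refine sin_pi_mul_ne_zero ht (sq_eq_zero_iff.1 ?_)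
  rw [Real.sin_sq, hcos, ← Real.sin_sq, hsin, zero_pow two_ne_zero]

lemma ne_intCast_of_mem_Ioo {a : ℝ} {m : ℤ} (ha : a ∈ Ioo (m : ℝ) (m + 1)) (n : ℤ) : a ≠ n := by
  rintro rfl
  have hlt : m < n := by exact_mod_cast ha.1
  have hgt : n < m + 1 := by exact_mod_cast ha.2
  lia

lemma integrableOn_of_forall_integrableAtFilter_sdiff {E : Type*} [NormedAddCommGroup E]
    {g : ℝ → E} {K : Set ℝ} (hK : IsCompact K)
    (h : ∀ a ∈ K, IntegrableAtFilter g (𝓝[K \ {a}] a)) : IntegrableOn g K := by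
  refine LocallyIntegrableOn.integrableOn_isCompact (fun a ha => ?_) hK
  rw [← insert_sdiff_self_of_mem ha, nhdsWithin_insert, IntegrableAtFilter.sup_iff]
  exact ⟨⟨{a}, mem_pure.2 rfl, integrableOn_singleton (hx := by simp)⟩, h a ha⟩

end PuncturedNeighbourhoods

section Bloch

variable {p q : ℝ → ℂ}

theorem BoundedPotential.isCosineType (hpq : BoundedPotential p q) :
    IsCosineType (discriminant p q) :=
  ⟨hpq.differentiable_discriminant, fun _ hε =>
    (hpq.exists_asymptotic hε).imp fun _ hR z hz => (hR z hz).1⟩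

lemma BoundedPotential.hasSineAsymptotic_sSol (hpq : BoundedPotential p q) :
    HasSineAsymptotic 1 fun mu => sSol p q mu Real.pi 0 := fun _ hε =>
  (hpq.exists_asymptotic hε).imp fun _ hR z hz => by simpa only [one_mul] using (hR z hz).2

lemma BoundedPotential.eventually_notMem_exceptional (hpq : BoundedPotential p q) (h : ℝ) {a : ℝ}
    (ha : ∀ n : ℤ, a ≠ n) : ∀ᶠ t : ℝ in 𝓝[≠] a, (t : ℂ) ∉ exceptional p q h := by
  have hF := hpq.isCosineType
  filter_upwards [
    hF.eventually_forall_ne_zero hF.hasSineAsymptotic_deriv two_pi_ne_zero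
      hF.differentiable.deriv ha,
    hF.eventually_forall_ne_zero hpq.hasSineAsymptotic_sSol one_ne_zero
      hpq.differentiable_sSol_zero ha] with t hderiv hsSol
  rintro ⟨-, mu, hmu, hzero⟩
  rw [hpq.charDet_eq_zero_iff] at hmu
  exact hzero.elim (hderiv mu hmu) (hsSol mu hmu)

variable {lam : ℤ → Fin 2 → ℂ → ℂ} {Psi PsiStar : ℤ → Fin 2 → ℂ → ℝ → Fin 2 → ℂ}
  {f : ℝ → Fin 2 → ℂ} {x : ℝ}

namespace IsBlochSystem

variable {S : Set ℝ}

lemma continuousOn_ofReal (hB : IsBlochSystem p q (Complex.ofReal '' S) lam Psi PsiStar) (k : ℤ)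
    (j : Fin 2) : ContinuousOn (fun t : ℝ => lam k j t) S :=
  (hB.cont k j).comp Complex.continuous_ofReal.continuousOn (mapsTo_image _ _)

lemma discriminant_eq (hB : IsBlochSystem p q (Complex.ofReal '' S) lam Psi PsiStar)
    (hpq : BoundedPotential p q) (k : ℤ) (j : Fin 2) {t : ℝ} (ht : t ∈ S) :
    discriminant p q (lam k j t) = 2 * Complex.cos (Real.pi * t) :=
  (hpq.charDet_eq_zero_iff _ _).1 (hB.charDet_eq_zero k j (mem_image_of_mem _ ht))

lemma expansionTerm_eventuallyEq (hB : IsBlochSystem p q (Complex.ofReal '' S) lam Psi PsiStar)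
    (hpq : BoundedPotential p q) (hf : Continuous f) (hfc : HasCompactSupport f)
    (hx : x ∈ Icc 0 Real.pi) (k : ℤ) (j : Fin 2) {a : ℝ} {l : Filter ℝ} (hl : l ≤ 𝓝[≠] a)
    (hS : ∀ᶠ t in l, t ∈ S) (hne : ∀ᶠ t : ℝ in l, deriv (discriminant p q) (lam k j t) ≠ 0) :
    (fun t : ℝ => expansionTerm f t (Psi k j t) (PsiStar k j t) x) =ᶠ[l] fun t : ℝ =>
      (deriv (discriminant p q) (lam k j t))⁻¹ • residueTerm p q f x (lam k j t) t := by
  filter_upwards [hS, hne, hl (eventually_ne_int a)] with t htS ht' ht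
  exact hB.expansionTerm_eq hpq hf hfc hx k j (mem_image_of_mem _ htS)
    (fun n => by exact_mod_cast ht n) ht'

theorem integrableAtFilter (hB : IsBlochSystem p q (Complex.ofReal '' S) lam Psi PsiStar)
    (hpq : BoundedPotential p q) (hf : Continuous f) (hfc : HasCompactSupport f)
    (hx : x ∈ Icc 0 Real.pi) (k : ℤ) (j : Fin 2) {a : ℝ} (ha : ∀ n : ℤ, a ≠ n) {I : Set ℝ}
    (hI : I.OrdConnected) (haI : a ∉ I) (hS : ∀ᶠ t in 𝓝[I] a, t ∈ S) :
    IntegrableAtFilter (fun t : ℝ => expansionTerm f t (Psi k j t) (PsiStar k j t) x) (𝓝[I] a) := by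
  obtain ⟨⟨u, v⟩, huv, hsub⟩ := (nhdsWithin_hasBasis (nhds_basis_Ioo a) I).mem_iff.1 hS
  have hlocal : 𝓝[Ioo u v ∩ I] a = 𝓝[I] a :=
    nhdsWithin_inter_of_mem (mem_nhdsWithin_of_mem_nhds (Ioo_mem_nhds huv.1 huv.2))
  obtain ⟨hne, hint⟩ := hpq.isCosineType.integrableAtFilter_inv_deriv_smul
    (ordConnected_Ioo.inter hI) ((hB.continuousOn_ofReal k j).mono hsub)
    (fun t ht => hB.discriminant_eq hpq k j (hsub ht)) ha (fun h => haI h.2)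
    (hpq.continuous_residueTerm hf hfc hx)
  rw [hlocal] at hne hint
  have := hI.measurableSet.nhdsWithin_isMeasurablyGenerated a
  exact integrableAtFilter_of_eventuallyEq (hB.expansionTerm_eventuallyEq hpq hf hfc hx k j
    (nhdsWithin_mono a fun _ ht => ne_of_mem_of_not_mem ht haI) hS hne) hint

theorem integrableOn_Icc (hB : IsBlochSystem p q (Complex.ofReal '' S) lam Psi PsiStar)
    (hpq : BoundedPotential p q) (hf : Continuous f) (hfc : HasCompactSupport f)
    (hx : x ∈ Icc 0 Real.pi) (k : ℤ) (j : Fin 2) {u v : ℝ}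
    (hS : ∀ a ∈ Icc u v, ∀ᶠ t in 𝓝[≠] a, t ∈ Icc u v → t ∈ S)
    (hint : ∀ n : ℤ, (n : ℝ) ∈ Icc u v → IntegrableAtFilter
      (fun t : ℝ => expansionTerm f t (Psi k j t) (PsiStar k j t) x) (𝓝[≠] (n : ℝ))) :
    IntegrableOn (fun t : ℝ => expansionTerm f t (Psi k j t) (PsiStar k j t) x) (Icc u v) := by
  refine integrableOn_of_forall_integrableAtFilter_sdiff isCompact_Icc fun a ha => ?_
  by_cases han : ∃ n : ℤ, a = n
  · obtain ⟨n, rfl⟩ := han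
    exact (hint n ha).filter_mono (nhdsWithin_mono _ fun _ ht => ht.2)
  have hside : ∀ s : Set ℝ, s.OrdConnected → a ∉ s → IntegrableAtFilter
      (fun t : ℝ => expansionTerm f t (Psi k j t) (PsiStar k j t) x) (𝓝[Icc u v ∩ s] a) := by
    intro s hs has
    refine hB.integrableAtFilter hpq hf hfc hx k j (not_exists.1 han) (ordConnected_Icc.inter hs)
      (fun h => has h.2) ?_
    filter_upwards [self_mem_nhdsWithin, nhdsWithin_mono a
      (fun t ht => ne_of_mem_of_not_mem ht.2 has) (hS a ha)] with t ht himp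
    exact himp ht.1
  rw [sdiff_eq, ← Iio_union_Ioi, inter_union_distrib_left, nhdsWithin_union,
    IntegrableAtFilter.sup_iff]
  exact ⟨hside _ ordConnected_Iio self_notMem_Iio, hside _ ordConnected_Ioi self_notMem_Ioi⟩

lemma integrableOn_Icc_of_setE {h : ℝ}
    (hB : IsBlochSystem p q (Complex.ofReal '' setE p q h) lam Psi PsiStar)
    (hpq : BoundedPotential p q) (hf : Continuous f) (hfc : HasCompactSupport f)
    (hx : x ∈ Icc 0 Real.pi) (k : ℤ) (j : Fin 2) {m : ℤ} {u v : ℝ} (hu : m < u) (hv : v < m + 1)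
    (huv : Icc u v ⊆ Icc h (1 - h) ∪ Icc (1 + h) (2 - h)) :
    IntegrableOn (fun t : ℝ => expansionTerm f t (Psi k j t) (PsiStar k j t) x) (Icc u v) := by
  have hnonint : ∀ a ∈ Icc u v, ∀ n : ℤ, a ≠ n := fun a ha =>
    ne_intCast_of_mem_Ioo ⟨hu.trans_le ha.1, ha.2.trans_lt hv⟩
  refine hB.integrableOn_Icc hpq hf hfc hx k j (fun a ha => ?_)
    fun n hn => (hnonint n hn n rfl).elim
  filter_upwards [hpq.eventually_notMem_exceptional h (hnonint a ha)] with t ht htuv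
  exact ⟨huv htuv, ht⟩

theorem integrableOn_setE {h : ℝ} (h_pos : 0 < h)
    (hB : IsBlochSystem p q (Complex.ofReal '' setE p q h) lam Psi PsiStar)
    (hpq : BoundedPotential p q) (hf : Continuous f) (hfc : HasCompactSupport f)
    (hx : x ∈ Icc 0 Real.pi) (k : ℤ) (j : Fin 2) :
    IntegrableOn (fun t : ℝ => expansionTerm f t (Psi k j t) (PsiStar k j t) x) (setE p q h) :=
  ((hB.integrableOn_Icc_of_setE hpq hf hfc hx k j (m := 0) (by simpa using h_pos)
    (by push_cast; linarith) subset_union_left).union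
  (hB.integrableOn_Icc_of_setE hpq hf hfc hx k j (m := 1) (by push_cast; linarith)
    (by push_cast; linarith) subset_union_right)).mono_set fun _ ht => ht.1

end IsBlochSystem

section Semicircles

lemma circleMap_mem_semicircle {a h θ : ℝ} (hh : 0 ≤ h) (hθ : θ ∈ Icc 0 Real.pi) :
    circleMap a h θ ∈ semicircle a h := by
  refine ⟨mem_sphere_iff_norm.1 (circleMap_mem_sphere _ hh θ), ?_⟩
  have him : (circleMap a h θ).im = h * Real.sin θ := by
    simp [circleMap, Complex.exp_ofReal_mul_I_im]
  exact him ▸ mul_nonneg hh (Real.sin_nonneg_of_mem_Icc hθ)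

lemma semicircle_subset_stripD {a h : ℝ} (ha₀ : 0 ≤ a) (ha : a + 2 * h ≤ 2) :
    semicircle a h ⊆ stripD h := by
  rintro t ⟨ht, -⟩
  have hre := Complex.abs_re_le_norm (t - a)
  have him := Complex.abs_im_le_norm (t - a)
  rw [ht, Complex.sub_re, Complex.ofReal_re, abs_le] at hre
  rw [ht, Complex.sub_im, Complex.ofReal_im, sub_zero] at him
  exact ⟨by linarith [abs_nonneg t.im], by linarith, by linarith⟩

lemma ne_intCast_of_mem_semicircle {a : ℤ} {h : ℝ} (h_pos : 0 < h) (h_lt : h < 1) {t : ℂ}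
    (ht : t ∈ semicircle a h) (n : ℤ) : t ≠ n := by
  rintro rfl
  have hnorm : ((|n - a| : ℤ) : ℝ) = h := by
    rw [← ht.1, Complex.ofReal_intCast, ← Int.cast_sub, Complex.norm_intCast, Int.cast_abs]
  rw [← hnorm] at h_pos h_lt
  have hpos : 0 < |n - a| := by exact_mod_cast h_pos
  have hlt : |n - a| < 1 := by exact_mod_cast h_lt
  lia

theorem IsBlochSystem.semicircleIntegrable {a : ℤ} {h : ℝ} (h_pos : 0 < h) (h_lt : h < 1)
    (ha : semicircle a h ⊆ stripD h)
    (hB : IsBlochSystem p q (semicircle a h) lam Psi PsiStar) (hpq : BoundedPotential p q)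
    (havoid : Disjoint (semicircle a h) (exceptional p q h)) (hf : Continuous f)
    (hfc : HasCompactSupport f) (hx : x ∈ Icc 0 Real.pi) (k : ℤ) (j : Fin 2) :
    SemicircleIntegrable (fun t : ℂ => expansionTerm f t (Psi k j t) (PsiStar k j t) x) a h := by
  have hne : ∀ t ∈ semicircle a h, deriv (discriminant p q) (lam k j t) ≠ 0 := fun t ht h₀ =>
    disjoint_left.1 havoid ht ⟨ha ht, lam k j t, hB.charDet_eq_zero k j ht, .inl h₀⟩
  have hcont : ContinuousOn
      (fun t : ℂ => expansionTerm f t (Psi k j t) (PsiStar k j t) x) (semicircle a h) := by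
    refine ContinuousOn.congr
      (((hpq.differentiable_discriminant.deriv.continuous.comp_continuousOn (hB.cont k j)).inv₀
        hne).smul ((hpq.continuous_residueTerm hf hfc hx).comp_continuousOn
          ((hB.cont k j).prodMk continuousOn_id))) fun t ht => ?_
    exact hB.expansionTerm_eq hpq hf hfc hx k j ht (ne_intCast_of_mem_semicircle h_pos h_lt ht)
      (hne t ht)
  refine ContinuousOn.intervalIntegrable_of_Icc Real.pi_pos.le
    (hcont.comp (continuous_circleMap a h).continuousOn fun θ hθ => ?_)
  exact_mod_cast circleMap_mem_semicircle (a := a) h_pos.le hθ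

end Semicircles

section IntegralPoints

lemma BoundedPotential.exists_eventually_norm_ip_gelfand_le (hpq : BoundedPotential p q)
    (hf : Continuous f) (hfc : HasCompactSupport f) (R a : ℝ) :
    ∃ C, ∀ᶠ t : ℝ in 𝓝 a, ∀ (mu : ℂ) (y : ℝ → Fin 2 → ℂ), ‖mu‖ ≤ R →
      IsNormalizedEigenfunction p q t mu y → ‖ip (gelfand f t) y‖ ≤ C := by
  obtain ⟨C, hC⟩ := hpq.exists_norm_eigenfunction_le R
  have hcont : Continuous fun z : ℝ × ℝ => gelfand f z.1 (clamp z.2) :=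
    (continuous_gelfand_clamp hf hfc).comp
      ((Complex.continuous_ofReal.comp continuous_fst).prodMk continuous_snd)
  obtain ⟨B, hB⟩ := ((isCompact_Icc (a := a - 1) (b := a + 1)).prod
    (isCompact_Icc (a := (0 : ℝ)) (b := Real.pi))).exists_bound_of_continuousOn hcont.continuousOn
  refine ⟨2 * B * C * Real.pi, ?_⟩
  filter_upwards [Icc_mem_nhds (sub_one_lt a) (lt_add_one a)] with t ht mu y hmu hy
  rw [ip_eq_pairing]
  refine norm_pairing_le (fun s hs => ?_) (fun s hs => ?_) ⟨Real.pi_pos.le, le_rfl⟩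
  · simpa only [clamp_of_mem hs] using hB (t, s) ⟨ht, hs⟩
  · have hstar : (fun i => conj (y s i)) = star (y s) := rfl
    rw [hstar, norm_star]
    exact hC t mu y hmu hy s hs

namespace IsBlochSystem

variable {S : Set ℝ} {n : ℤ}

lemma eventually_deriv_ne_zero (hB : IsBlochSystem p q (Complex.ofReal '' S) lam Psi PsiStar)
    (hpq : BoundedPotential p q) (k : ℤ) (j : Fin 2) (hS : S ∈ 𝓝 (n : ℝ)) :
    ∀ᶠ t : ℝ in 𝓝[≠] (n : ℝ), deriv (discriminant p q) (lam k j t) ≠ 0 := by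
  have hF := hpq.isCosineType
  have hlam : ∀ᶠ t : ℝ in 𝓝[≠] (n : ℝ), lam k j t ≠ lam k j (n : ℝ) := by
    filter_upwards [mem_nhdsWithin_of_mem_nhds hS, eventually_two_cos_ne_at_int n]
      with t ht hcos heq
    exact hcos (by rw [← hB.discriminant_eq hpq k j ht, heq,
      hB.discriminant_eq hpq k j (mem_of_mem_nhds hS)])
  have htend : Tendsto (fun t : ℝ => lam k j t) (𝓝[≠] (n : ℝ)) (𝓝[≠] (lam k j (n : ℝ))) :=
    tendsto_nhdsWithin_iff.2 ⟨((hB.continuousOn_ofReal k j).continuousAt hS).tendsto.mono_left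
      nhdsWithin_le_nhds, hlam⟩
  exact htend.eventually (eventually_nhdsNE_of_mem_codiscrete
    (mem_codiscrete_ne_zero hF.differentiable.deriv
      (hF.hasSineAsymptotic_deriv.exists_ne_zero two_pi_ne_zero)) _)

lemma expansionTerm_isBigO (hB : IsBlochSystem p q (Complex.ofReal '' S) lam Psi PsiStar)
    (hpq : BoundedPotential p q) (hf : Continuous f) (hfc : HasCompactSupport f)
    (hx : x ∈ Icc 0 Real.pi) (k : ℤ) (j : Fin 2) (hS : S ∈ 𝓝 (n : ℝ)) :
    (fun t : ℝ => expansionTerm f t (Psi k j t) (PsiStar k j t) x) =O[𝓝[≠] (n : ℝ)]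
      fun t : ℝ => ‖(ip (Psi k j t) (PsiStar k j t))⁻¹‖ := by
  have hlam := (hB.continuousOn_ofReal k j).continuousAt hS
  obtain ⟨R, hR⟩ := exists_gt ‖lam k j (n : ℝ)‖
  obtain ⟨C₁, hpsi⟩ := hpq.exists_norm_eigenfunction_le R
  obtain ⟨C₂, hip⟩ := hpq.conj.exists_eventually_norm_ip_gelfand_le hf hfc R n
  refine Asymptotics.IsBigO.of_bound (C₂ * C₁) ?_
  filter_upwards [mem_nhdsWithin_of_mem_nhds hS, hB.eventually_deriv_ne_zero hpq k j hS,
    hip.filter_mono nhdsWithin_le_nhds,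
    (hlam.norm.eventually (gt_mem_nhds hR)).filter_mono nhdsWithin_le_nhds] with t ht hne hip hltR
  have htS : (t : ℂ) ∈ Complex.ofReal '' S := mem_image_of_mem _ ht
  have hsimple := hpq.multiplicity_eq_one (hB.charDet_eq_zero k j htS) hne
  have hstar := hB.eigenStar k j t htS hsimple
  rw [Complex.conj_ofReal] at hstar
  have hgelfand := hip _ _ ((RCLike.norm_conj _).trans_le hltR.le) hstar
  rw [expansionTerm, norm_smul, norm_mul, mul_assoc, norm_norm, mul_comm]
  exact mul_le_mul_of_nonneg_right (mul_le_mul hgelfand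
    (hpsi t _ _ hltR.le (hB.eigen k j t htS hsimple) x hx) (norm_nonneg _)
    ((norm_nonneg _).trans hgelfand)) (norm_nonneg _)

theorem integrableAtFilter_of_not_isESS
    (hB : IsBlochSystem p q (Complex.ofReal '' S) lam Psi PsiStar) (hpq : BoundedPotential p q)
    (hf : Continuous f) (hfc : HasCompactSupport f) (hx : x ∈ Icc 0 Real.pi) (k : ℤ) (j : Fin 2)
    (hS : S ∈ 𝓝 (n : ℝ)) (hess : ¬IsESS lam Psi PsiStar n (lam k j (n : ℝ))) :
    IntegrableAtFilter (fun t : ℝ => expansionTerm f t (Psi k j t) (PsiStar k j t) x)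
      (𝓝[≠] (n : ℝ)) := by
  obtain ⟨ε, hε, hint⟩ : ∃ ε > 0, IntegrableOn
      (fun t : ℝ => ‖(ip (Psi k j t) (PsiStar k j t))⁻¹‖) (Ioo (n - ε) (n + ε)) := by
    by_contra! hcon
    exact hess ⟨k, j, rfl, hcon⟩
  obtain ⟨u, v, huv, hsub⟩ := mem_nhds_iff_exists_Ioo_subset.1 hS
  have hmeas := aestronglyMeasurable_inv_deriv_smul hpq.differentiable_discriminant
    measurableSet_Ioo ((hB.continuousOn_ofReal k j).mono hsub)
    (hpq.continuous_residueTerm hf hfc hx)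
  have heq := hB.expansionTerm_eventuallyEq hpq hf hfc hx k j le_rfl
    (mem_nhdsWithin_of_mem_nhds hS) (hB.eventually_deriv_ne_zero hpq k j hS)
  have := (measurableSet_singleton (n : ℝ)).compl.nhdsWithin_isMeasurablyGenerated n
  refine integrableAtFilter_of_eventuallyEq heq <|
    ((hB.expansionTerm_isBigO hpq hf hfc hx k j hS).congr' heq .rfl).integrableAtFilter
      ⟨Ioo u v, mem_nhdsWithin_of_mem_nhds (Ioo_mem_nhds huv.1 huv.2), hmeas⟩
      ⟨_, mem_nhdsWithin_of_mem_nhds (Ioo_mem_nhds ?_ ?_), hint⟩ <;> linarith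

theorem integrableOn_Ioo_of_not_isESS {h : ℝ} (h_pos : 0 < h) (h_lt : h < 1)
    (hB : IsBlochSystem p q (Complex.ofReal '' Ioo (n - h) (n + h)) lam Psi PsiStar)
    (hpq : BoundedPotential p q) (hf : Continuous f) (hfc : HasCompactSupport f)
    (hx : x ∈ Icc 0 Real.pi) (k : ℤ) (j : Fin 2)
    (hess : ¬IsESS lam Psi PsiStar n (lam k j (n : ℝ))) :
    IntegrableOn (fun t : ℝ => expansionTerm f t (Psi k j t) (PsiStar k j t) x)
      (Ioo (n - h) (n + h)) := by
  refine (hB.integrableOn_Icc hpq hf hfc hx k j (fun a _ => ?_) fun m hm => ?_).mono_set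
    Ioo_subset_Icc_self
  · have hfin : ({(n : ℝ) - h, n + h} : Set ℝ).Finite := toFinite _
    filter_upwards [nhdsNE_le_cofinite a hfin.compl_mem_cofinite] with t ht hmem
    rw [← Icc_sdiff_both]
    exact ⟨hmem, ht⟩
  · have hlo : n - 1 < m := by exact_mod_cast (by linarith [hm.1] : (n : ℝ) - 1 < m)
    have hhi : m < n + 1 := by exact_mod_cast (by linarith [hm.2] : (m : ℝ) < n + 1)
    obtain rfl : m = n := by lia
    exact hB.integrableAtFilter_of_not_isESS hpq hf hfc hx k j
      (Ioo_mem_nhds (sub_lt_self _ h_pos) (lt_add_of_pos_right _ h_pos)) hess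

end IsBlochSystem

end IntegralPoints

end Bloch

end Dirac

end

theorem theorem4_general {p q : ℝ → ℂ} (hpq : Dirac.BoundedPotential p q)
    {h : ℝ} (h_pos : 0 < h) (h_le : h ≤ 1 / 2)
    (h_avoid : Disjoint (Dirac.semicircle 0 h ∪ Dirac.semicircle 1 h) (Dirac.exceptional p q h))
    {f : ℝ → Fin 2 → ℂ} (hf : Continuous f) (hfc : HasCompactSupport f)
    (lam : ℤ → Fin 2 → ℂ → ℂ) (Psi PsiStar : ℤ → Fin 2 → ℂ → ℝ → Fin 2 → ℂ)
    (k : ℤ) (j : Fin 2) (x : ℝ) (hx : x ∈ Icc 0 Real.pi) :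
    (Dirac.IsBlochSystem p q (Complex.ofReal '' Dirac.setE p q h) lam Psi PsiStar →
      IntegrableOn
        (fun t : ℝ => Dirac.expansionTerm f t (Psi k j t) (PsiStar k j t) x)
        (Dirac.setE p q h)) ∧
    (Dirac.IsBlochSystem p q (Dirac.semicircle 0 h) lam Psi PsiStar →
      Dirac.SemicircleIntegrable
        (fun t : ℂ => Dirac.expansionTerm f t (Psi k j t) (PsiStar k j t) x) 0 h) ∧
    (Dirac.IsBlochSystem p q (Dirac.semicircle 1 h) lam Psi PsiStar →
      Dirac.SemicircleIntegrable
        (fun t : ℂ => Dirac.expansionTerm f t (Psi k j t) (PsiStar k j t) x) 1 h) ∧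
    (Dirac.IsBlochSystem p q (Complex.ofReal '' Ioo (-h) h) lam Psi PsiStar →
      ¬ Dirac.IsESS lam Psi PsiStar 0 (lam k j 0) →
      IntegrableOn
        (fun t : ℝ => Dirac.expansionTerm f t (Psi k j t) (PsiStar k j t) x)
        (Ioo (-h) h)) ∧
    (Dirac.IsBlochSystem p q (Complex.ofReal '' Ioo (1 - h) (1 + h)) lam Psi PsiStar →
      ¬ Dirac.IsESS lam Psi PsiStar 1 (lam k j 1) →
      IntegrableOn
        (fun t : ℝ => Dirac.expansionTerm f t (Psi k j t) (PsiStar k j t) x)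
        (Ioo (1 - h) (1 + h))) := by
  obtain ⟨h_avoid₀, h_avoid₁⟩ := disjoint_union_left.1 h_avoid
  have h_lt : h < 1 := by linarith
  have hsub₀ := Dirac.semicircle_subset_stripD (a := (0 : ℤ)) (h := h) (by simp) (by simp; linarith)
  have hsub₁ := Dirac.semicircle_subset_stripD (a := (1 : ℤ)) (h := h) (by simp) (by simp; linarith)
  refine ⟨fun hB => hB.integrableOn_setE h_pos hpq hf hfc hx k j, fun hB => ?_, fun hB => ?_,
    fun hB hess => ?_, fun hB hess => ?_⟩
  · exact_mod_cast Dirac.IsBlochSystem.semicircleIntegrable h_pos h_lt hsub₀ (by exact_mod_cast hB)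
      hpq (by exact_mod_cast h_avoid₀) hf hfc hx k j
  · exact_mod_cast Dirac.IsBlochSystem.semicircleIntegrable h_pos h_lt hsub₁ (by exact_mod_cast hB)
      hpq (by exact_mod_cast h_avoid₁) hf hfc hx k j
  · simpa using Dirac.IsBlochSystem.integrableOn_Ioo_of_not_isESS (n := 0) h_pos h_lt
      (by simpa using hB) hpq hf hfc hx k j (by simpa using hess)
  · simpa using Dirac.IsBlochSystem.integrableOn_Ioo_of_not_isESS (n := 1) h_pos h_lt
      (by simpa using hB) hpq hf hfc hx k j (by simpa using hess)

theorem theorem4 (p q : ℝ → ℂ)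
    (hp : Function.Periodic p Real.pi) (hq : Function.Periodic q Real.pi)
    (hpv : BoundedVariationOn p (Icc 0 Real.pi)) (hqv : BoundedVariationOn q (Icc 0 Real.pi))
    (h : ℝ) (h_pos : 0 < h) (h_lt : h < 1 / 10)
    (h_avoid : Disjoint (Dirac.semicircle 0 h ∪ Dirac.semicircle 1 h) (Dirac.exceptional p q h))
    (f : ℝ → Fin 2 → ℂ) (hf : Continuous f) (hfc : HasCompactSupport f)
    (lam : ℤ → Fin 2 → ℂ → ℂ) (Psi PsiStar : ℤ → Fin 2 → ℂ → ℝ → Fin 2 → ℂ)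
    (k : ℤ) (j : Fin 2) (x : ℝ) (hx : x ∈ Icc 0 Real.pi) :
    (Dirac.IsBlochSystem p q (Complex.ofReal '' Dirac.setE p q h) lam Psi PsiStar →
      IntegrableOn
        (fun t : ℝ => Dirac.expansionTerm f t (Psi k j t) (PsiStar k j t) x)
        (Dirac.setE p q h)) ∧
    (Dirac.IsBlochSystem p q (Dirac.semicircle 0 h) lam Psi PsiStar →
      Dirac.SemicircleIntegrable
        (fun t : ℂ => Dirac.expansionTerm f t (Psi k j t) (PsiStar k j t) x) 0 h) ∧
    (Dirac.IsBlochSystem p q (Dirac.semicircle 1 h) lam Psi PsiStar →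
      Dirac.SemicircleIntegrable
        (fun t : ℂ => Dirac.expansionTerm f t (Psi k j t) (PsiStar k j t) x) 1 h) ∧
    (Dirac.IsBlochSystem p q (Complex.ofReal '' Ioo (-h) h) lam Psi PsiStar →
      ¬ Dirac.IsESS lam Psi PsiStar 0 (lam k j 0) →
      IntegrableOn
        (fun t : ℝ => Dirac.expansionTerm f t (Psi k j t) (PsiStar k j t) x)
        (Ioo (-h) h)) ∧
    (Dirac.IsBlochSystem p q (Complex.ofReal '' Ioo (1 - h) (1 + h)) lam Psi PsiStar →
      ¬ Dirac.IsESS lam Psi PsiStar 1 (lam k j 1) →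
      IntegrableOn
        (fun t : ℝ => Dirac.expansionTerm f t (Psi k j t) (PsiStar k j t) x)
        (Ioo (1 - h) (1 + h))) := by
  exact theorem4_general (Dirac.boundedPotential_of_boundedVariationOn hpv hqv) h_pos
    (h_lt.le.trans (by norm_num)) h_avoid hf hfc lam Psi PsiStar k j x hx
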